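/- A sequence $\mathcal P$ of Beurling primes is a sequence $1<p_1\le p_2\le\cdots$ of real numbers with $p_j\to\infty$; let $\mathcal G$ be the free commutative semigroup with unit generated by the $p_j$ (equal values being distinct generators), with the multiplicative norm $|\cdot|$ given on the generators by $|p_j|=p_j$. Put $\mathcal N(x)=\#\{g\in\mathcal G:|g|\le x\}$, $\psi(x)=\sum_{|g|\le x}\Lambda(g)$, where $\Lambda(p_j^k)=\log p_j$ for $k\ge1$ and $\Lambda(g)=0$ for all other $g$, and $\zeta(s)=\sum_{g\in\mathcal G}|g|^{-s}$. For $\kappa>0$ and $0<\theta<1$, Axiom $A(\kappa,\theta)$ says that, for some constant $A$, $|\mathcal N(x)-\kappa(x-1)|\le Ax^{\theta}$ for all $x\ge1$. **Theorem.** Let $1/2\le r<1$, and let $\mathcal S$ be a finite multiset of complex numbers, symmetric with respect to the real axis (with multiplicities), all of whose elements satisfy $r<\Re\rho<1$. Then there are a sequence $\mathcal P$ of Beurling primes and a constant $\kappa$ with all of the following properties. 1. If $r>1/2$, then Axiom $A(\kappa,r)$ holds, while Axiom $A(\kappa',\theta)$ fails for every $\theta<r$ and every $\kappa'$. If $r=1/2$,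 then Axiom $A(\kappa,\theta)$ holds for every $\theta$ with $1/2<\theta<1$. 2. $\psi(x)\sim x$ as $x\to\infty$. Moreover, for $x\ge 1$, sums being taken with multiplicity, $$\psi(x)-x=\frac{x^r}{r}-\sum_{\rho\in\mathcal S}\frac{x^\rho}{\rho}+O(\sqrt x)\quad\text{if } r>1/2,\qquad \psi(x)-x=-\sum_{\rho\in\mathcal S}\frac{x^\rho}{\rho}+O(\sqrt x)\quad\text{if } r=1/2 .$$ 3. The series $\zeta(s)$ converges absolutely for $\Re s>1$ and has a meromorphic continuation to $\Re s>1/2$, which is analytic there except for a simple pole at $s=1$ with residue $\kappa$ and, if $r>1/2$, another simple pole at $s=r$. In this half-plane it vanishes precisely at the points of $\mathcal S$, with the multiplicities prescribed by $\mathcal S$. -/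

import Mathlib

open Filter Topology Asymptotics

noncomputable section

/-- A sequence of Beurling generalized primes `1 < p₀ ≤ p₁ ≤ p₂ ≤ …`, `p_j → ∞`
(repetitions are allowed). -/
structure BeurlingPrimes where
  /-- the primes (more precisely: their norms), listed in nondecreasing order -/
  p : ℕ → ℝ
  one_lt : ∀ j, 1 < p j
  mono : Monotone p
  tendsto : Tendsto p atTop atTop

namespace BeurlingPrimes

/-- The free commutative semigroup with unit generated by the primes, written additively:
`g : ℕ →₀ ℕ` stands for the formal product `∏ⱼ pⱼ ^ (g j)`. -/
abbrev Integers (_P : BeurlingPrimes) : Type := ℕ →₀ ℕ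

variable (P : BeurlingPrimes)

/-- The multiplicative norm `|g| = ∏ⱼ pⱼ ^ (g j)`. -/
def norm (g : P.Integers) : ℝ := g.prod fun j k => P.p j ^ k

/-- The counting function `N(x) = #{g : |g| ≤ x}` of the generalized integers, with
multiplicity (elements are counted, not values of the norm); the set is finite by
`finite_norm_le` below. -/
def N (x : ℝ) : ℕ := Set.ncard {g : P.Integers | P.norm g ≤ x}

open Classical in
/-- The generalized von Mangoldt function: `log p_j` on the powers `p_j ^ k`, `k ≥ 1`,
and `0` elsewhere. -/
def Lambda (g : P.Integers) : ℝ :=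
  if h : ∃ j k : ℕ, 0 < k ∧ g = Finsupp.single j k then Real.log (P.p h.choose) else 0

/-- `ψ(x) = ∑_{|g| ≤ x} Λ(g)`, a finite sum by `finite_norm_le` below. -/
def psi (x : ℝ) : ℝ := ∑ᶠ g ∈ {g : P.Integers | P.norm g ≤ x}, P.Lambda g

/-- Axiom A with the constants `κ > 0` and `0 < θ < 1`:
`|N(x) - κ (x - 1)| ≤ A x ^ θ` for all `x ≥ 1`, with some constant `A`. -/
def AxiomA (κ θ : ℝ) : Prop :=
  0 < κ ∧ 0 < θ ∧ θ < 1 ∧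
    ∃ A : ℝ, ∀ x : ℝ, 1 ≤ x → |(P.N x : ℝ) - κ * (x - 1)| ≤ A * x ^ θ

/-- `Z` is the meromorphic continuation to `Re s > σ` of the Beurling zeta function
`∑_g |g| ^ (-s)`, the series being absolutely convergent for `Re s > 1`. -/
def IsZetaContinuation (σ : ℝ) (Z : ℂ → ℂ) : Prop :=
  MeromorphicOn Z {s : ℂ | σ < s.re} ∧
    ∀ s : ℂ, 1 < s.re → HasSum (fun g : P.Integers => (P.norm g : ℂ) ^ (-s)) (Z s)

theorem Lambda_single (j k : ℕ) (hk : 0 < k) :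
    P.Lambda (Finsupp.single j k) = Real.log (P.p j) := by
  have h : ∃ j' k' : ℕ, 0 < k' ∧
      (Finsupp.single j k : ℕ →₀ ℕ) = Finsupp.single j' k' := ⟨j, k, hk, rfl⟩
  have h2 : j = h.choose := by
    obtain ⟨k', hk', he⟩ := h.choose_spec
    rcases (Finsupp.single_eq_single_iff _ _ _ _).1 he with h | h
    · exact h.1
    · omega
  unfold Lambda
  rw [dif_pos h, ← h2]

theorem pow_le_norm (g : P.Integers) (j : ℕ) : P.p j ^ g j ≤ P.norm g := by
  have h1 : ∀ i, 1 ≤ P.p i ^ g i := fun i => one_le_pow₀ (P.one_lt i).le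
  have h2 : ∀ s : Finset ℕ, 1 ≤ ∏ i ∈ s, P.p i ^ g i := fun s =>
    Finset.prod_induction _ (fun y : ℝ => 1 ≤ y) (fun _ _ => one_le_mul_of_one_le_of_one_le)
      le_rfl fun i _ => h1 i
  by_cases hj : j ∈ g.support
  · unfold norm Finsupp.prod
    rw [← Finset.mul_prod_erase _ _ hj]
    exact le_mul_of_one_le_right (zero_le_one.trans (h1 j))
      (h2 _)
  · rw [Finsupp.notMem_support_iff.1 hj, pow_zero]
    exact h2 _

theorem finite_norm_le (x : ℝ) : {g : P.Integers | P.norm g ≤ x}.Finite := by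
  obtain ⟨J, hJ⟩ := (P.tendsto.eventually_gt_atTop x).exists_forall_of_atTop
  obtain ⟨K, hK⟩ := pow_unbounded_of_one_lt x (P.one_lt 0)
  refine (Set.finite_Iic (Finsupp.indicator (Finset.range J) fun _ _ => K)).subset ?_
  intro g hg j
  have hgj := (P.pow_le_norm g j).trans hg
  by_cases hj : j < J
  · rw [Finsupp.indicator_of_mem (Finset.mem_range.2 hj)]
    by_contra! h
    have h1 : P.p 0 ^ K ≤ P.p 0 ^ g j := pow_le_pow_right₀ (P.one_lt 0).le h.le
    have h2 : P.p 0 ^ g j ≤ P.p j ^ g j :=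
      pow_le_pow_left₀ (zero_lt_one.trans (P.one_lt 0)).le (P.mono (Nat.zero_le j)) _
    linarith
  · rw [Finsupp.indicator_of_notMem (by simpa using hj)]
    by_contra! h
    have h1 : P.p j ≤ P.p j ^ g j := le_self_pow₀ (P.one_lt j).le (by omega)
    have := hJ j (by omega)
    linarith

end BeurlingPrimes

end

noncomputable section

open MeasureTheory ProbabilityTheory

/-! One prescribes a density of primes whose Mellin transform is exactly the logarithm of a function
with the required zeros and poles, and then replaces the density by actual primes without spoiling
the half-plane `Re s > 1/2`.

The kernel `logKernel u = (1 - 1/u) / log u` satisfies `exp (∫₁^∞ logKernel u * u^(-z-1) du) =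
(z+1)/z` for `Re z > 0` (`exp_integral_logKernel_mul_cpow`). So the density `f = logKernel * (1 +
u^(r-1) - ∑ u^(ρ-1))` has the transform `log zeroRational`, with poles at `1` and `r` and zeros at
`S`; the compensating factors `s`, `s - r + 1`, `s - ρ + 1` do not vanish for `Re s > 1/2`. Symmetry
of `S` makes `f` real, and `r < 1`, `Re ρ < 1` make it positive from some `a` on.

Cut `[a, ∞)` into intervals of `f`-mass `1` and draw one prime from each, independently, with law `f
du`. Hoeffding's inequality and Borel–Cantelli show that almost every choice has exponential sums `∑
p_j^(-in)`, `j < J`, within `O(√(J log(|n|+J+1)))` of the corresponding integrals, for all integers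
`n` and all `J` at once (`exists_densitySampling`). By Abel summation, `∑ p^(-s) - ∫_a^∞ f u^(-s)
du` is `O(√log(|Im s|+4))` on `Re s ≥ σ₀ > 1/2` (`exists_norm_discrepancy_le`). The higher prime
powers are bounded there and the missing piece of the integral is entire. Hence `ζ = zeroRational *
exp G` with `G` holomorphic in `Re s > 1/2` and of the same slow growth, which yields the zeros and
poles and makes `exp G` smaller than any power of `|Im s|`.

That growth allows Mellin inversion for `∫₀ˣ N` on a line `Re s = σ₀` near `1/2`. Differencing with
step `√x` gives Axiom A for every exponent in `(1/2, 1)` that is at least `r`, the pole at `r`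
contributing `x^r` (`exists_abs_N_sub_le`). Conversely, Axiom A with an exponent below `r` would
continue `ζ` analytically to `r`, where it has a pole (`not_axiomA_of_lt`).

The formula for `ψ` needs no randomness: one prime per unit of mass forces `∑_{p ≤ x} log p = ∫_a^x
f log u du + O(log x)`, the integral is elementary up to `O(log x)`, and prime powers add `O(√x)`.
For `r = 1/2` the same density serves: `x^r / r = 2√x` joins the error term, and the pole at `r`
lies on the boundary. -/

/-! ### Concentration of sums over independent samples. -/

/-- Hoeffding: a variable with values in `[-1, 1]` is, once centred, sub-Gaussian with parameter
`1`. The factor `2` accounts for the two tails. -/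
theorem measureReal_abs_sum_sample_ge_le (μ : ℕ → Measure ℝ) [∀ j, IsProbabilityMeasure (μ j)]
    {φ : ℝ → ℝ} (hφ : Measurable φ) (hb : ∀ x, |φ x| ≤ 1) (J : ℕ) {ε : ℝ} (hε : 0 ≤ ε) :
    (Measure.infinitePi μ).real
      {ω | ε ≤ |∑ j ∈ Finset.range J, (φ (ω j) - ∫ x, φ x ∂μ j)|}
      ≤ 2 * Real.exp (-ε ^ 2 / (2 * J)) := by
  set P := Measure.infinitePi μ with hP
  set X : ℕ → (ℕ → ℝ) → ℝ := fun j ω => φ (ω j) - ∫ x, φ x ∂μ j with hX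
  have hint : ∀ j, ∫ ω, φ (ω j) ∂P = ∫ x, φ x ∂μ j := fun j => by
    rw [← (measurePreserving_eval_infinitePi μ j).map_eq]
    exact (integral_map (measurable_pi_apply j).aemeasurable hφ.aestronglyMeasurable).symm
  have hindep : iIndepFun X P :=
    iIndepFun_infinitePi (X := fun j x => φ x - ∫ y, φ y ∂μ j) (by fun_prop)
  have hsub : ∀ j, HasSubgaussianMGF (X j) 1 P := fun j => by
    have := hasSubgaussianMGF_of_mem_Icc (μ := P) (X := fun ω => φ (ω j)) (a := -1) (b := 1)
      (hφ.comp (measurable_pi_apply j)).aemeasurable (ae_of_all _ fun ω => abs_le.1 (hb _))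
    rw [hint] at this
    convert this using 1
    rw [← NNReal.coe_inj]
    norm_num
  have hsub' : ∀ j, HasSubgaussianMGF ((fun j => -X j) j) 1 P := fun j => (hsub j).neg
  have hindep' : iIndepFun (fun j => -X j) P :=
    hindep.comp (fun _ x => -x) (fun _ => measurable_neg)
  have h1 := HasSubgaussianMGF.measure_sum_range_ge_le_of_iIndepFun hindep (n := J)
    (fun i _ => hsub i) hε
  have h2 := HasSubgaussianMGF.measure_sum_range_ge_le_of_iIndepFun hindep' (n := J)
    (fun i _ => hsub' i) hε
  have hsubset : {ω | ε ≤ |∑ j ∈ Finset.range J, X j ω|} ⊆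
      {ω | ε ≤ ∑ j ∈ Finset.range J, X j ω} ∪ {ω | ε ≤ ∑ j ∈ Finset.range J, (-X j) ω} := by
    intro ω hω
    simp only [Set.mem_union, Set.mem_ofPred_eq, Pi.neg_apply, Finset.sum_neg_distrib] at hω ⊢
    exact le_abs.1 hω
  calc P.real {ω | ε ≤ |∑ j ∈ Finset.range J, X j ω|} ≤ _ := measureReal_mono hsubset
    _ ≤ _ := measureReal_union_le _ _
    _ ≤ 2 * Real.exp (-ε ^ 2 / (2 * J)) := by
      simp only [NNReal.coe_one, mul_one] at h1 h2
      linarith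

/-- Borel–Cantelli over all pairs `(n, J)`: with `L = |n| + J + 1`, exceeding `4 √(J log L)` has
probability at most `2 L⁻⁸`, which is summable. Almost surely only finitely many pairs are
exceptional, and the constant `C` absorbs them. -/
theorem ae_exists_abs_sum_sample_le (μ : ℕ → Measure ℝ) [∀ j, IsProbabilityMeasure (μ j)]
    {φ : ℤ → ℝ → ℝ} (hφ : ∀ n, Measurable (φ n)) (hb : ∀ n x, |φ n x| ≤ 1) :
    ∀ᵐ ω ∂(Measure.infinitePi μ), ∃ C : ℝ, 0 ≤ C ∧ ∀ (n : ℤ) (J : ℕ),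
      |∑ j ∈ Finset.range J, (φ n (ω j) - ∫ x, φ n x ∂μ j)|
        ≤ C * Real.sqrt (J * Real.log (|(n : ℝ)| + J + 1)) := by
  set P := Measure.infinitePi μ
  -- The second index is shifted to `J = i.2 + 1`, because the scale vanishes at `J = 0` and is
  -- divided by below.
  set lam : ℤ × ℕ → ℝ := fun i => Real.sqrt ((i.2 + 1 : ℕ) *
    Real.log (|(i.1 : ℝ)| + (i.2 + 1 : ℕ) + 1)) with hlam
  have hpos : ∀ i, 0 < lam i := fun i => by
    refine Real.sqrt_pos.2 (mul_pos (by positivity) (Real.log_pos ?_))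
    have := abs_nonneg (i.1 : ℝ)
    push_cast
    linarith [(Nat.cast_nonneg i.2 : (0 : ℝ) ≤ i.2)]
  set B : ℤ × ℕ → Set (ℕ → ℝ) := fun i =>
    {ω | 4 * lam i ≤ |∑ j ∈ Finset.range (i.2 + 1), (φ i.1 (ω j) - ∫ x, φ i.1 x ∂μ j)|}
  have hBle : ∀ i, P.real (B i) ≤
      2 * ((1 / (|(i.1 : ℝ)| + 1) ^ 2) * (1 / ((i.2 : ℝ) + 1) ^ 2)) := fun i => by
    refine (measureReal_abs_sum_sample_ge_le μ (hφ i.1) (hb i.1) (i.2 + 1)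
      (by linarith [hpos i])).trans ?_
    have h0 := abs_nonneg (i.1 : ℝ)
    have h0' : (0 : ℝ) ≤ i.2 := Nat.cast_nonneg _
    set L := |(i.1 : ℝ)| + (i.2 + 1 : ℕ) + 1 with hL
    have hL1 : 1 ≤ L := by rw [hL]; push_cast; linarith
    have hLlog : 0 ≤ Real.log L := Real.log_nonneg hL1
    have hexp : -(4 * lam i) ^ 2 / (2 * ((i.2 + 1 : ℕ) : ℝ)) = -(8 * Real.log L) := by
      have hsq : lam i ^ 2 = (i.2 + 1 : ℕ) * Real.log L := Real.sq_sqrt (by positivity)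
      have hne : ((i.2 + 1 : ℕ) : ℝ) ≠ 0 := by positivity
      rw [mul_pow, hsq]
      field_simp
      ring
    rw [hexp, Real.exp_neg]
    have h8 : Real.exp (8 * Real.log L) = L ^ 8 := by
      rw [← Real.exp_log (show 0 < L by linarith), ← Real.exp_nat_mul]
      simp
    rw [h8, ← one_div, one_div_mul_one_div]
    refine mul_le_mul_of_nonneg_left (one_div_le_one_div_of_le (by positivity) ?_) (by norm_num)
    calc (|(i.1 : ℝ)| + 1) ^ 2 * ((i.2 : ℝ) + 1) ^ 2 ≤ L ^ 2 * L ^ 2 := by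
          gcongr <;> (rw [hL]; push_cast; linarith)
      _ = L ^ 4 := by ring
      _ ≤ L ^ 8 := pow_le_pow_right₀ hL1 (by norm_num)
  have hsN : Summable fun n : ℕ => 1 / ((n : ℝ) + 1) ^ 2 := by
    have := (summable_nat_add_iff 1).2 (Real.summable_one_div_nat_pow.2 one_lt_two)
    simpa using this
  have hsZ : Summable fun n : ℤ => 1 / (|(n : ℝ)| + 1) ^ 2 := by
    refine Summable.of_nat_of_neg ?_ ?_ <;> simpa using hsN
  have hsum : Summable fun i => P.real (B i) :=
    Summable.of_nonneg_of_le (fun _ => measureReal_nonneg) hBle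
      ((hsZ.mul_of_nonneg hsN (fun _ => by positivity) (fun _ => by positivity)).mul_left 2)
  have htop : ∑' i, P (B i) ≠ ⊤ := by
    have : ∀ i, P (B i) = ENNReal.ofReal (P.real (B i)) := fun i => by simp [Measure.real]
    simp_rw [this]
    exact hsum.tsum_ofReal_ne_top
  have hae := ae_finite_setOfPred_mem htop
  filter_upwards [hae] with ω hω
  set T : ℤ × ℕ → ℝ := fun i =>
    |∑ j ∈ Finset.range (i.2 + 1), (φ i.1 (ω j) - ∫ x, φ i.1 x ∂μ j)| with hT
  obtain ⟨M, hM⟩ := (hω.image fun i => T i / lam i).bddAbove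
  -- `M` bounds the ratio on the finitely many exceptional pairs, `4` on all others.
  refine ⟨max 4 M, le_max_of_le_left (by norm_num), fun n J => ?_⟩
  rcases J with _ | J
  · simp
  by_cases hmem : (n, J) ∈ {i | ω ∈ B i}
  · have h1 : T (n, J) / lam (n, J) ≤ M := hM ⟨_, hmem, rfl⟩
    rw [div_le_iff₀ (hpos _)] at h1
    exact h1.trans (mul_le_mul_of_nonneg_right (le_max_right _ _) (hpos _).le)
  · have h1 : T (n, J) < 4 * lam (n, J) := not_le.1 hmem
    exact h1.le.trans (mul_le_mul_of_nonneg_right (le_max_left _ _) (hpos _).le)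

/-- Three almost sure events (real parts, imaginary parts, supports `K j`) intersect, so a single
deterministic sequence can be taken from them. -/
theorem exists_sample_norm_sum_le (μ : ℕ → Measure ℝ) [∀ j, IsProbabilityMeasure (μ j)]
    {K : ℕ → Set ℝ} (hK : ∀ j, ∀ᵐ x ∂μ j, x ∈ K j)
    {φ : ℤ → ℝ → ℂ} (hφ : ∀ n, Measurable (φ n)) (hb : ∀ n x, ‖φ n x‖ ≤ 1) :
    ∃ p : ℕ → ℝ, (∀ j, p j ∈ K j) ∧ ∃ C : ℝ, 0 ≤ C ∧ ∀ (n : ℤ) (J : ℕ),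
      ‖∑ j ∈ Finset.range J, (φ n (p j) - ∫ x, φ n x ∂μ j)‖
        ≤ C * Real.sqrt (J * Real.log (|(n : ℝ)| + J + 1)) := by
  have h1 := ae_exists_abs_sum_sample_le μ (φ := fun n x => (φ n x).re)
    (fun n => Complex.measurable_re.comp (hφ n))
    (fun n x => (Complex.abs_re_le_norm _).trans (hb n x))
  have h2 := ae_exists_abs_sum_sample_le μ (φ := fun n x => (φ n x).im)
    (fun n => Complex.measurable_im.comp (hφ n))
    (fun n x => (Complex.abs_im_le_norm _).trans (hb n x))
  have h3 : ∀ᵐ ω ∂(Measure.infinitePi μ), ∀ j, ω j ∈ K j := ae_all_iff.2 fun j =>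
    (measurePreserving_eval_infinitePi μ j).quasiMeasurePreserving.ae (hK j)
  obtain ⟨p, ⟨C₁, hC₁, h1⟩, ⟨C₂, hC₂, h2⟩, h3⟩ := (h1.and (h2.and h3)).exists
  have hint : ∀ n j, Integrable (φ n) (μ j) := fun n j =>
    Integrable.of_bound (hφ n).aestronglyMeasurable 1 (ae_of_all _ (hb n))
  refine ⟨p, h3, C₁ + C₂, by positivity, fun n J => (Complex.norm_le_abs_re_add_abs_im _).trans ?_⟩
  rw [add_mul]
  refine add_le_add (le_of_eq_of_le ?_ (h1 n J)) (le_of_eq_of_le ?_ (h2 n J))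
  · simp only [Complex.re_sum, Complex.sub_re]
    congr! 3 with j
    exact (Complex.reCLM.integral_comp_comm (hint n j)).symm
  · simp only [Complex.im_sum, Complex.sub_im]
    congr! 3 with j
    exact (Complex.imCLM.integral_comp_comm (hint n j)).symm

/-! ### Sampling a density at its quantiles. -/

/-- A sequence `p` sampling the density `f` on `[a, ∞)`: `[a, ∞)` is cut at the points `q j` into
intervals of mass `1`, each containing one `p j`, and the exponential sums over the `p j` are close
to the corresponding integrals. -/
structure DensitySampling (f : ℝ → ℝ) (a M : ℝ) where
  two_le : 2 ≤ a
  cont : ContinuousOn f (Set.Ici a)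
  pos : ∀ u, a ≤ u → 0 < f u
  le : ∀ u, a ≤ u → f u ≤ M
  /-- the cut points -/
  q : ℕ → ℝ
  q_zero : q 0 = a
  q_mono : Monotone q
  q_lower : ∀ j : ℕ, (j : ℝ) ≤ M * (q j - a)
  integral_q : ∀ j, ∫ u in q j..q (j + 1), f u = 1
  /-- the sample points -/
  p : ℕ → ℝ
  p_mem : ∀ j, p j ∈ Set.Icc (q j) (q (j + 1))
  /-- the constant in the bound for the exponential sums -/
  C : ℝ
  C_nonneg : 0 ≤ C
  norm_sum_le : ∀ (n : ℤ) (J : ℕ),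
    ‖∑ j ∈ Finset.range J, ((p j : ℂ) ^ (-(n * Complex.I)) -
        ∫ u in q j..q (j + 1), (f u : ℂ) * (u : ℂ) ^ (-(n * Complex.I)))‖
      ≤ C * Real.sqrt (J * Real.log (|(n : ℝ)| + J + 1))

/-- The cut points are where the primitive of `f` takes the values `0, 1, 2, …`: it is strictly
increasing since `f > 0`, and unbounded by `hlim`. The bound `f ≤ M` keeps the points from being too
dense. -/
theorem exists_quantiles {f : ℝ → ℝ} {a M : ℝ} (hf : ContinuousOn f (Set.Ici a))
    (hpos : ∀ u, a ≤ u → 0 < f u) (hle : ∀ u, a ≤ u → f u ≤ M)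
    (hlim : Tendsto (fun x => ∫ u in a..x, f u) atTop atTop) :
    ∃ q : ℕ → ℝ, q 0 = a ∧ Monotone q ∧ (∀ j : ℕ, (j : ℝ) ≤ M * (q j - a)) ∧
      ∀ j, ∫ u in q j..q (j + 1), f u = 1 := by
  set F : ℝ → ℝ := fun x => ∫ u in a..x, f u with hF
  have hint : ∀ x y, a ≤ x → a ≤ y → IntervalIntegrable f volume x y := fun x y hx hy =>
    (hf.mono fun z hz => (le_min hx hy).trans hz.1).intervalIntegrable
  have hsub : ∀ x y, a ≤ x → a ≤ y → F y - F x = ∫ u in x..y, f u := fun x y hx hy =>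
    intervalIntegral.integral_interval_sub_left (hint _ _ le_rfl hy) (hint _ _ le_rfl hx)
  have hmono : ∀ x y, a ≤ x → x < y → F x < F y := fun x y hx hxy => by
    have : 0 < ∫ u in x..y, f u := intervalIntegral.intervalIntegral_pos_of_pos_on
      (hint _ _ hx (hx.trans hxy.le)) (fun z hz => hpos z (hx.trans hz.1.le)) hxy
    linarith [hsub x y hx (hx.trans hxy.le)]
  have hex : ∀ j : ℕ, ∃ x, a ≤ x ∧ F x = j := fun j => by
    obtain ⟨b, hb, hab⟩ := ((hlim.eventually_ge_atTop (j : ℝ)).and (eventually_ge_atTop a)).exists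
    have hc : ContinuousOn F (Set.Icc a b) := by
      have := intervalIntegral.continuousOn_primitive_interval'
        (hint a b le_rfl hab) (Set.left_mem_uIcc)
      rwa [Set.uIcc_of_le hab] at this
    obtain ⟨x, hx, hxj⟩ := intermediate_value_Icc hab hc
      (show (j : ℝ) ∈ Set.Icc (F a) (F b) from ⟨by simp [hF], hb⟩)
    exact ⟨x, hx.1, hxj⟩
  choose q hqa hq using hex
  refine ⟨q, ?_, monotone_nat_of_le_succ fun j => ?_, fun j => ?_, fun j => ?_⟩
  · by_contra hne
    have := hmono a (q 0) le_rfl (lt_of_le_of_ne (hqa 0) (Ne.symm hne))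
    rw [hq 0] at this
    simp [hF] at this
  · by_contra! hlt
    have := hmono _ _ (hqa (j + 1)) hlt
    rw [hq, hq] at this
    push_cast at this
    linarith
  · rw [← hq j]
    have := intervalIntegral.integral_mono_on (hqa j) (hint _ _ le_rfl (hqa j))
      (intervalIntegrable_const (c := M)) fun x hx => hle x hx.1
    simpa [hF, mul_comm] using this
  · rw [← hsub _ _ (hqa j) (hqa (j + 1)), hq, hq]
    push_cast
    ring

theorem cpow_neg_int_mul_I {x : ℝ} (hx : 0 < x) (n : ℤ) :
    (x : ℂ) ^ (-(n * Complex.I)) = Complex.exp (((-(n * Real.log x) : ℝ) : ℂ) * Complex.I) := by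
  rw [Complex.cpow_def_of_ne_zero (by exact_mod_cast hx.ne'), ← Complex.ofReal_log hx.le]
  push_cast
  ring_nf

/-- The `j`-th point is drawn from `f du` on `(q j, q (j+1)]`, a probability measure because the
mass is `1`. -/
theorem exists_densitySampling {f : ℝ → ℝ} {a M : ℝ} (ha : 2 ≤ a)
    (hf : ContinuousOn f (Set.Ici a))
    (hpos : ∀ u, a ≤ u → 0 < f u) (hle : ∀ u, a ≤ u → f u ≤ M)
    (hlim : Tendsto (fun x => ∫ u in a..x, f u) atTop atTop) :
    Nonempty (DensitySampling f a M) := by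
  obtain ⟨q, hq0, hqm, hql, hqi⟩ := exists_quantiles hf hpos hle hlim
  have hqa : ∀ j, a ≤ q j := fun j => hq0 ▸ hqm (Nat.zero_le j)
  have hqs : ∀ j, q j ≤ q (j + 1) := fun j => hqm (Nat.le_succ j)
  have hsub : ∀ j, Set.Ioc (q j) (q (j + 1)) ⊆ Set.Ici a := fun j x hx => (hqa j).trans hx.1.le
  have hii : ∀ j, IntegrableOn f (Set.Ioc (q j) (q (j + 1))) volume := fun j => by
    rw [← intervalIntegrable_iff_integrableOn_Ioc_of_le (hqs j)]
    refine (hf.mono fun z hz => ?_).intervalIntegrable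
    rw [Set.uIcc_of_le (hqs j)] at hz
    exact (hqa j).trans hz.1
  set μ : ℕ → Measure ℝ := fun j =>
    (volume.restrict (Set.Ioc (q j) (q (j + 1)))).withDensity fun u => ENNReal.ofReal (f u)
    with hμ
  have hnn : ∀ j, 0 ≤ᵐ[volume.restrict (Set.Ioc (q j) (q (j + 1)))] f := fun j =>
    (ae_restrict_mem measurableSet_Ioc).mono fun u hu => (hpos u (hsub j hu)).le
  have : ∀ j, IsProbabilityMeasure (μ j) := fun j => ⟨by
    rw [hμ, withDensity_apply _ MeasurableSet.univ, Measure.restrict_univ,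
      ← ofReal_integral_eq_lintegral_ofReal (hii j) (hnn j),
      ← intervalIntegral.integral_of_le (hqs j), hqi j, ENNReal.ofReal_one]⟩
  -- Written through the real logarithm, the test functions have modulus `1` on all of `ℝ`; `cpow`
  -- would not at negative arguments.
  set φ : ℤ → ℝ → ℂ := fun n x => Complex.exp (((-(n * Real.log x) : ℝ) : ℂ) * Complex.I) with hφ
  have hφm : ∀ n, Measurable (φ n) := fun n => by
    rw [hφ]
    fun_prop
  obtain ⟨p, hp, C, hC, hbound⟩ := exists_sample_norm_sum_le μ
    (K := fun j => Set.Icc (q j) (q (j + 1)))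
    (fun j => (withDensity_absolutelyContinuous _ _).ae_le
      ((ae_restrict_mem measurableSet_Ioc).mono fun u hu => Set.Ioc_subset_Icc_self hu))
    (φ := φ) hφm (fun n x => (Complex.norm_exp_ofReal_mul_I _).le)
  refine ⟨⟨ha, hf, hpos, hle, q, hq0, hqm, hql, hqi, p, hp, C, hC, fun n J => ?_⟩⟩
  refine le_of_eq_of_le ?_ (hbound n J)
  congr 1
  refine Finset.sum_congr rfl fun j _ => ?_
  congr 1
  · exact cpow_neg_int_mul_I (by linarith [hqa j, (hp j).1]) n
  · rw [intervalIntegral.integral_of_le (hqs j), hμ,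
      integral_withDensity_eq_integral_toReal_smul₀ (hii j).aemeasurable.ennreal_ofReal
        (ae_of_all _ fun _ => ENNReal.ofReal_lt_top)]
    refine setIntegral_congr_fun measurableSet_Ioc fun u hu => ?_
    have hu' := hsub j hu
    simp only [hφ]
    rw [cpow_neg_int_mul_I (by linarith [Set.mem_Ici.1 hu']) n,
      ENNReal.toReal_ofReal (hpos u hu').le, Complex.real_smul]

/-! ### The discrepancy between the sum over primes and the integral. -/

theorem cpow_sub_cpow_eq_integral {x y : ℝ} (hx : 0 < x) (hxy : x ≤ y) (w : ℂ) :
    (y : ℂ) ^ w - (x : ℂ) ^ w = ∫ v in x..y, w * (v : ℂ) ^ (w - 1) := by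
  symm
  refine intervalIntegral.integral_eq_sub_of_hasDerivAt (f := fun v : ℝ => (v : ℂ) ^ w) ?_ ?_
  · intro v hv
    rw [Set.uIcc_of_le hxy] at hv
    have hs : (v : ℂ) ∈ Complex.slitPlane := Complex.ofReal_mem_slitPlane.2 (hx.trans_le hv.1)
    simpa using ((hasDerivAt_id (v : ℂ)).cpow_const (c := w) hs).comp_ofReal
  · refine ContinuousOn.intervalIntegrable fun v hv => ContinuousAt.continuousWithinAt ?_
    rw [Set.uIcc_of_le hxy] at hv
    have : (v : ℂ) ∈ Complex.slitPlane := Complex.ofReal_mem_slitPlane.2 (hx.trans_le hv.1)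
    fun_prop (disch := assumption)

theorem continuousOn_rpow_const_uIcc {x y : ℝ} (hx : 0 < x) (hy : 0 < y) (b : ℝ) :
    ContinuousOn (fun v : ℝ => v ^ b) (Set.uIcc x y) := fun _ hv =>
  (Real.continuousAt_rpow_const _ _
    (Or.inl ((lt_min hx hy).trans_le hv.1).ne')).continuousWithinAt

theorem norm_cpow_sub_cpow_le {x y : ℝ} (hx : 0 < x) (hxy : x ≤ y) (w : ℂ) :
    ‖(y : ℂ) ^ w - (x : ℂ) ^ w‖ ≤ ‖w‖ * ∫ v in x..y, v ^ (w.re - 1) := by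
  rw [cpow_sub_cpow_eq_integral hx hxy, ← intervalIntegral.integral_const_mul]
  refine intervalIntegral.norm_integral_le_of_norm_le hxy (ae_of_all _ fun v hv => ?_)
    ((continuousOn_rpow_const_uIcc hx (hx.trans_le hxy) _).intervalIntegrable.const_mul _)
  rw [norm_mul, Complex.norm_cpow_eq_rpow_re_of_pos (hx.trans hv.1)]
  simp

theorem integral_rpow_neg_le {x y σ : ℝ} (hx : 1 ≤ x) (hxy : x ≤ y) (hσ : 0 < σ) :
    ∫ v in x..y, v ^ (-σ - 1) ≤ 1 / σ := by
  have h0 : (0 : ℝ) ∉ Set.uIcc x y := by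
    rw [Set.uIcc_of_le hxy]
    exact fun h => by linarith [h.1]
  rw [integral_rpow (Or.inr ⟨by linarith, h0⟩), sub_add_cancel, div_neg, ← neg_div, neg_sub]
  refine div_le_div_of_nonneg_right ?_ hσ.le
  have h1 := Real.rpow_le_one_of_one_le_of_nonpos hx (neg_nonpos.2 hσ.le)
  have h2 := Real.rpow_nonneg (show 0 ≤ y by linarith) (-σ)
  linarith

/-- Cut off outside `(x, y]`, the function `g` has a Mellin transform that converges everywhere and
is therefore entire; the integral is this transform at `1 - s`. -/
theorem differentiable_integral_mul_cpow_neg {g : ℝ → ℂ} {x y : ℝ} (hx : 0 < x) (hxy : x ≤ y)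
    (hg : ContinuousOn g (Set.Icc x y)) :
    Differentiable ℂ fun s : ℂ => ∫ u in x..y, g u * (u : ℂ) ^ (-s) := by
  set G : ℝ → ℂ := (Set.Ioc x y).indicator g with hG
  have hint : Integrable G := by
    rw [hG, integrable_indicator_iff measurableSet_Ioc]
    exact hg.integrableOn_Icc.mono_set Set.Ioc_subset_Icc_self
  have htop : ∀ b : ℝ, G =O[atTop] fun u : ℝ => u ^ (-b) := fun b =>
    IsBigO.of_bound 0 ((eventually_gt_atTop y).mono fun u hu => by
      simp [hG, hu.not_ge])
  have hzero : ∀ b : ℝ, G =O[𝓝[>] 0] fun u : ℝ => u ^ (-b) := fun b =>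
    IsBigO.of_bound 0 (((eventually_lt_nhds hx).filter_mono nhdsWithin_le_nhds).mono fun u hu => by
      simp [hG, hu.not_gt])
  have hm : Differentiable ℂ (mellin G) := fun s =>
    mellin_differentiableAt_of_isBigO_rpow (a := s.re + 1) (b := s.re - 1)
      (hint.locallyIntegrable.locallyIntegrableOn _) (htop _) (by linarith) (hzero _) (by linarith)
  have heq : (fun s : ℂ => ∫ u in x..y, g u * (u : ℂ) ^ (-s)) = fun s => mellin G (1 - s) := by
    funext s
    rw [intervalIntegral.integral_of_le hxy, mellin,
      ← integral_indicator measurableSet_Ioc, ← integral_indicator measurableSet_Ioi]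
    congr 1
    funext u
    by_cases hu : u ∈ Set.Ioc x y
    · rw [Set.indicator_of_mem hu, Set.indicator_of_mem (Set.mem_Ioi.2 (hx.trans hu.1)), hG,
        Set.indicator_of_mem hu, smul_eq_mul, mul_comm]
      congr 2
      ring
    · rw [Set.indicator_of_notMem hu]
      by_cases hu' : u ∈ Set.Ioi (0 : ℝ)
      · rw [Set.indicator_of_mem hu', hG, Set.indicator_of_notMem hu, smul_zero]
      · rw [Set.indicator_of_notMem hu']
  rw [heq]
  exact hm.comp (differentiable_const _ |>.sub differentiable_id)

namespace DensitySampling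

variable {f : ℝ → ℝ} {a M : ℝ} (X : DensitySampling f a M)

theorem le_q (j : ℕ) : a ≤ X.q j := X.q_zero.symm.trans_le (X.q_mono (Nat.zero_le j))

theorem two_le_q (j : ℕ) : 2 ≤ X.q j := X.two_le.trans (X.le_q j)

theorem q_pos (j : ℕ) : 0 < X.q j := two_pos.trans_le (X.two_le_q j)

theorem q_le_succ (j : ℕ) : X.q j ≤ X.q (j + 1) := X.q_mono (Nat.le_succ j)

theorem two_le_p (j : ℕ) : 2 ≤ X.p j := (X.two_le_q j).trans (X.p_mem j).1

theorem p_pos (j : ℕ) : 0 < X.p j := two_pos.trans_le (X.two_le_p j)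

theorem M_pos (X : DensitySampling f a M) : 0 < M := (X.pos a le_rfl).trans_le (X.le a le_rfl)

theorem add_two_le_q (j : ℕ) : (j : ℝ) + 2 ≤ (M + 1) * X.q j := by
  have h1 := X.q_lower j
  have h2 := X.two_le_q j
  nlinarith [X.M_pos, X.two_le]

theorem continuousOn_Icc (j : ℕ) : ContinuousOn f (Set.Icc (X.q j) (X.q (j + 1))) :=
  X.cont.mono fun _ hu => (X.le_q j).trans hu.1

theorem intervalIntegrable_mul (j : ℕ) {g : ℝ → ℂ}
    (hg : ContinuousOn g (Set.Icc (X.q j) (X.q (j + 1)))) :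
    IntervalIntegrable (fun u => (f u : ℂ) * g u) volume (X.q j) (X.q (j + 1)) := by
  refine ContinuousOn.intervalIntegrable ?_
  rw [Set.uIcc_of_le (X.q_le_succ j)]
  exact (Complex.continuous_ofReal.comp_continuousOn (X.continuousOn_Icc j)).mul hg

theorem continuousOn_cpow (j : ℕ) (s : ℂ) :
    ContinuousOn (fun u : ℝ => (u : ℂ) ^ s) (Set.Icc (X.q j) (X.q (j + 1))) := fun u hu => by
  have : (u : ℂ) ∈ Complex.slitPlane :=
    Complex.ofReal_mem_slitPlane.2 ((X.q_pos j).trans_le hu.1)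
  exact ContinuousAt.continuousWithinAt (by fun_prop (disch := assumption))

theorem norm_integral_mul_le (j : ℕ) {g : ℝ → ℂ} {B : ℝ}
    (hB : ∀ u ∈ Set.Icc (X.q j) (X.q (j + 1)), ‖g u‖ ≤ B) :
    ‖∫ u in X.q j..X.q (j + 1), (f u : ℂ) * g u‖ ≤ B := by
  have hf : IntervalIntegrable f volume (X.q j) (X.q (j + 1)) := by
    refine ContinuousOn.intervalIntegrable ?_
    rw [Set.uIcc_of_le (X.q_le_succ j)]
    exact X.continuousOn_Icc j
  refine (intervalIntegral.norm_integral_le_of_norm_le (X.q_le_succ j) (g := fun u => f u * B)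
    (ae_of_all _ fun u hu => ?_) (hf.mul_const B)).trans_eq ?_
  · have hfu : 0 < f u := X.pos u ((X.le_q j).trans hu.1.le)
    rw [norm_mul, Complex.norm_real, Real.norm_of_nonneg hfu.le]
    exact mul_le_mul_of_nonneg_left (hB u (Set.Ioc_subset_Icc_self hu)) hfu.le
  · rw [intervalIntegral.integral_mul_const, X.integral_q, one_mul]

/-- The contribution of one sampled prime to `∑ p⁻ˢ - ∫ u⁻ˢ f(u) du`. -/
def discrepancyTerm (s : ℂ) (j : ℕ) : ℂ :=
  (X.p j : ℂ) ^ (-s) - ∫ u in X.q j..X.q (j + 1), (f u : ℂ) * (u : ℂ) ^ (-s)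

/-- The function `∑ p⁻ˢ - ∫ u⁻ˢ f(u) du`, convergent for `Re s > 0`. -/
def discrepancy (s : ℂ) : ℂ := ∑' j, X.discrepancyTerm s j

theorem integral_rpow_mono_interval (j : ℕ) (b : ℝ) {x y : ℝ}
    (hx : X.q j ≤ x) (hxy : x ≤ y) (hy : y ≤ X.q (j + 1)) :
    ∫ v in x..y, v ^ b ≤ ∫ v in X.q j..X.q (j + 1), v ^ b := by
  refine intervalIntegral.integral_mono_interval hx hxy hy ?_
    (continuousOn_rpow_const_uIcc (X.q_pos j) (X.q_pos _) b).intervalIntegrable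
  exact (ae_restrict_mem measurableSet_Ioc).mono fun v hv =>
    Real.rpow_nonneg ((X.q_pos j).trans hv.1).le _

theorem norm_cpow_sub_cpow_le (j : ℕ) {x y : ℝ} (hx : x ∈ Set.Icc (X.q j) (X.q (j + 1)))
    (hy : y ∈ Set.Icc (X.q j) (X.q (j + 1))) (w : ℂ) :
    ‖(y : ℂ) ^ (-w) - (x : ℂ) ^ (-w)‖
      ≤ ‖w‖ * ∫ v in X.q j..X.q (j + 1), v ^ (-w.re - 1) := by
  wlog hxy : x ≤ y generalizing x y
  · rw [norm_sub_rev]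
    exact this hy hx (not_le.1 hxy).le
  refine (_root_.norm_cpow_sub_cpow_le ((X.q_pos j).trans_le hx.1) hxy (-w)).trans ?_
  rw [norm_neg, Complex.neg_re]
  exact mul_le_mul_of_nonneg_left (X.integral_rpow_mono_interval j _ hx.1 hxy hy.2) (norm_nonneg _)

/-- Because the interval has mass `1`, `p_j^(-s)` can be moved under the integral, and what remains
is the variation of `u^(-s)` on the interval. These variations add up to a convergent integral,
which gives holomorphy for `Re s > 0` with no randomness. -/
theorem norm_discrepancyTerm_le (s : ℂ) (j : ℕ) :
    ‖X.discrepancyTerm s j‖ ≤ ‖s‖ * ∫ v in X.q j..X.q (j + 1), v ^ (-s.re - 1) := by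
  have heq : X.discrepancyTerm s j =
      ∫ u in X.q j..X.q (j + 1), (f u : ℂ) * ((X.p j : ℂ) ^ (-s) - (u : ℂ) ^ (-s)) := by
    simp_rw [mul_sub]
    rw [intervalIntegral.integral_sub (X.intervalIntegrable_mul j continuousOn_const)
      (X.intervalIntegrable_mul j (X.continuousOn_cpow j _)), intervalIntegral.integral_mul_const,
      intervalIntegral.integral_ofReal, X.integral_q, Complex.ofReal_one, one_mul]
    rfl
  rw [heq]
  exact X.norm_integral_mul_le j fun u hu => X.norm_cpow_sub_cpow_le j hu (X.p_mem j) s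

theorem sum_integral_rpow (b : ℝ) (J : ℕ) :
    ∑ j ∈ Finset.range J, ∫ v in X.q j..X.q (j + 1), v ^ b = ∫ v in X.q 0..X.q J, v ^ b :=
  intervalIntegral.sum_integral_adjacent_intervals fun j _ =>
    (continuousOn_rpow_const_uIcc (X.q_pos j) (X.q_pos _) b).intervalIntegrable

theorem integral_rpow_nonneg (b : ℝ) (j : ℕ) : 0 ≤ ∫ v in X.q j..X.q (j + 1), v ^ b :=
  intervalIntegral.integral_nonneg (X.q_le_succ j) fun _ hv =>
    Real.rpow_nonneg ((X.q_pos j).trans_le hv.1).le _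

theorem sum_integral_rpow_neg_le {σ : ℝ} (hσ : 0 < σ) (J : ℕ) :
    ∑ j ∈ Finset.range J, ∫ v in X.q j..X.q (j + 1), v ^ (-σ - 1) ≤ 1 / σ := by
  rw [X.sum_integral_rpow]
  exact integral_rpow_neg_le (by linarith [X.two_le_q 0]) (X.q_mono (Nat.zero_le J)) hσ

theorem summable_integral_rpow_neg {σ : ℝ} (hσ : 0 < σ) :
    Summable fun j => ∫ v in X.q j..X.q (j + 1), v ^ (-σ - 1) :=
  summable_of_sum_range_le (X.integral_rpow_nonneg _) (X.sum_integral_rpow_neg_le hσ)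

theorem summable_discrepancyTerm {s : ℂ} (hs : 0 < s.re) : Summable (X.discrepancyTerm s) :=
  Summable.of_norm_bounded ((X.summable_integral_rpow_neg hs).mul_left ‖s‖)
    (X.norm_discrepancyTerm_le s)

theorem differentiable_discrepancyTerm (j : ℕ) : Differentiable ℂ fun s => X.discrepancyTerm s j := by
  have hp : (X.p j : ℂ) ≠ 0 := by exact_mod_cast (X.p_pos j).ne'
  refine Differentiable.sub (fun s => ?_) (differentiable_integral_mul_cpow_neg (X.q_pos j)
    (X.q_le_succ j) (Complex.continuous_ofReal.comp_continuousOn (X.continuousOn_Icc j)))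
  exact (differentiableAt_id.neg).const_cpow (Or.inl hp)

theorem differentiableAt_discrepancy {s : ℂ} (hs : 0 < s.re) :
    DifferentiableAt ℂ X.discrepancy s := by
  -- A common majorant needs `Re z` bounded below and `‖z‖` bounded above.
  set U : Set ℂ := {z | s.re / 2 < z.re} ∩ Metric.ball 0 (‖s‖ + 1)
  have hU : IsOpen U := (isOpen_lt continuous_const Complex.continuous_re).inter Metric.isOpen_ball
  have hsU : s ∈ U := ⟨show s.re / 2 < s.re by linarith, by simp⟩
  refine (Complex.differentiableOn_tsum_of_summable_norm
    (u := fun j => (‖s‖ + 1) * ∫ v in X.q j..X.q (j + 1), v ^ (-(s.re / 2) - 1))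
    ((X.summable_integral_rpow_neg (half_pos hs)).mul_left _)
    (fun j => (X.differentiable_discrepancyTerm j).differentiableOn) hU
    (fun j z hz => (X.norm_discrepancyTerm_le z j).trans ?_)).differentiableAt (hU.mem_nhds hsU)
  have h1 : ‖z‖ ≤ ‖s‖ + 1 := (mem_ball_zero_iff.1 hz.2).le
  have hz1 : s.re / 2 < z.re := hz.1
  refine mul_le_mul h1 ?_ (X.integral_rpow_nonneg _ j) (by positivity)
  refine intervalIntegral.integral_mono_on (X.q_le_succ j)
    (continuousOn_rpow_const_uIcc (X.q_pos j) (X.q_pos _) _).intervalIntegrable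
    (continuousOn_rpow_const_uIcc (X.q_pos j) (X.q_pos _) _).intervalIntegrable fun v hv => ?_
  exact Real.rpow_le_rpow_of_exponent_le (by linarith [hv.1, X.two_le_q j]) (by linarith)

end DensitySampling

/-! ### The discrepancy grows like `√log` to the right of `1/2`. -/

/-- Separates the frequency `y` from the length `x`. Since `3 > e`, `log (y + 3) ≥ 1`, so a sum of
two logarithms is at most `log (y + 3) * (1 + log (x + 1))`, and the second factor costs only a
small power of `x + 1`. -/
theorem sqrt_mul_log_le {δ : ℝ} (hδ : 0 < δ) {x y : ℝ} (hx : 0 ≤ x) (hy : 0 ≤ y) :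
    Real.sqrt (x * Real.log (y + x + 1)) ≤
      Real.sqrt (1 + 1 / (2 * δ)) * (x + 1) ^ (1 / 2 + δ) * Real.sqrt (Real.log (y + 3)) := by
  have hlog1 : 1 ≤ Real.log (y + 3) := by
    rw [Real.le_log_iff_exp_le (by linarith)]
    linarith [Real.exp_one_lt_d9]
  have h1 : Real.log (y + x + 1) ≤ Real.log (y + 3) + Real.log (x + 1) := by
    rw [← Real.log_mul (by linarith) (by linarith)]
    exact Real.log_le_log (by linarith) (by nlinarith)
  have hlx : 0 ≤ Real.log (x + 1) := Real.log_nonneg (by linarith)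
  have h2 : Real.log (x + 1) ≤ (x + 1) ^ (2 * δ) / (2 * δ) :=
    Real.log_le_rpow_div (by linarith) (by linarith)
  have h3 : 1 ≤ (x + 1) ^ (2 * δ) := Real.one_le_rpow (by linarith) (by linarith)
  have hpow : (x + 1) ^ (1 / 2 + δ) = Real.sqrt ((x + 1) * (x + 1) ^ (2 * δ)) := by
    rw [Real.sqrt_eq_rpow, ← Real.rpow_one_add' (by linarith) (by linarith),
      ← Real.rpow_mul (by linarith)]
    congr 1
    ring
  rw [hpow, ← Real.sqrt_mul (by positivity), ← Real.sqrt_mul (by positivity)]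
  refine Real.sqrt_le_sqrt ?_
  calc x * Real.log (y + x + 1)
      ≤ (x + 1) * (Real.log (y + 3) * (1 + Real.log (x + 1))) := by
        refine mul_le_mul (by linarith) ?_ (Real.log_nonneg (by linarith)) (by linarith)
        nlinarith
    _ ≤ (x + 1) * (Real.log (y + 3) * ((x + 1) ^ (2 * δ) + (x + 1) ^ (2 * δ) / (2 * δ))) := by
        gcongr
    _ = (1 + 1 / (2 * δ)) * ((x + 1) * (x + 1) ^ (2 * δ)) * Real.log (y + 3) := by
        field_simp

theorem sum_range_mul_eq_abel (c e : ℕ → ℂ) (J : ℕ) :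
    ∑ j ∈ Finset.range J, c j * e j = c J * ∑ j ∈ Finset.range J, e j +
      ∑ j ∈ Finset.range J, (c j - c (j + 1)) * ∑ i ∈ Finset.range (j + 1), e i := by
  induction J with
  | zero => simp
  | succ J ih =>
    rw [Finset.sum_range_succ, ih, Finset.sum_range_succ (fun j => (c j - c (j + 1)) * _),
      Finset.sum_range_succ (n := J) (f := e)]
    ring

namespace DensitySampling

variable {f : ℝ → ℝ} {a M : ℝ} (X : DensitySampling f a M)

/-- The sampling controls only integer frequencies without weights. Freezing the weight `u^(-w)` at
the left endpoint costs its variation over the interval twice, for the prime and for the integral.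
-/
theorem norm_discrepancyTerm_sub_le (w : ℂ) (n : ℤ) (j : ℕ) :
    ‖X.discrepancyTerm (w + n * Complex.I) j -
      (X.q j : ℂ) ^ (-w) * X.discrepancyTerm (n * Complex.I) j‖
      ≤ 2 * (‖w‖ * ∫ v in X.q j..X.q (j + 1), v ^ (-w.re - 1)) := by
  have hsplit : ∀ u ∈ Set.Icc (X.q j) (X.q (j + 1)),
      (u : ℂ) ^ (-(w + n * Complex.I)) = (u : ℂ) ^ (-w) * (u : ℂ) ^ (-(n * Complex.I)) := by
    intro u hu
    rw [← Complex.cpow_add _ _ (by exact_mod_cast ((X.q_pos j).trans_le hu.1).ne')]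
    congr 1
    ring
  have hnorm : ∀ u ∈ Set.Icc (X.q j) (X.q (j + 1)),
      ‖((u : ℂ) ^ (-w) - (X.q j : ℂ) ^ (-w)) * (u : ℂ) ^ (-(n * Complex.I))‖ ≤
      ‖w‖ * ∫ v in X.q j..X.q (j + 1), v ^ (-w.re - 1) := by
    intro u hu
    rw [norm_mul, Complex.norm_cpow_eq_rpow_re_of_pos ((X.q_pos j).trans_le hu.1)]
    simpa using X.norm_cpow_sub_cpow_le j (Set.left_mem_Icc.2 (X.q_le_succ j)) hu w
  have heq : X.discrepancyTerm (w + n * Complex.I) j -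
      (X.q j : ℂ) ^ (-w) * X.discrepancyTerm (n * Complex.I) j =
      ((X.p j : ℂ) ^ (-w) - (X.q j : ℂ) ^ (-w)) * (X.p j : ℂ) ^ (-(n * Complex.I)) -
      ∫ u in X.q j..X.q (j + 1), (f u : ℂ) *
        (((u : ℂ) ^ (-w) - (X.q j : ℂ) ^ (-w)) * (u : ℂ) ^ (-(n * Complex.I))) := by
    have h1 : ∫ u in X.q j..X.q (j + 1), (f u : ℂ) *
        (((u : ℂ) ^ (-w) - (X.q j : ℂ) ^ (-w)) * (u : ℂ) ^ (-(n * Complex.I))) =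
        (∫ u in X.q j..X.q (j + 1), (f u : ℂ) * (u : ℂ) ^ (-(w + n * Complex.I))) -
        (X.q j : ℂ) ^ (-w) *
          ∫ u in X.q j..X.q (j + 1), (f u : ℂ) * (u : ℂ) ^ (-(n * Complex.I)) := by
      rw [← intervalIntegral.integral_const_mul, ← intervalIntegral.integral_sub
        (X.intervalIntegrable_mul j (X.continuousOn_cpow j _))
        ((X.intervalIntegrable_mul j (X.continuousOn_cpow j _)).const_mul _)]
      refine intervalIntegral.integral_congr fun u hu => ?_
      rw [Set.uIcc_of_le (X.q_le_succ j)] at hu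
      simp only [hsplit u hu]
      ring
    rw [h1]
    simp only [discrepancyTerm, hsplit _ (X.p_mem j)]
    ring
  rw [heq, two_mul]
  exact (norm_sub_le _ _).trans (add_le_add (hnorm _ (X.p_mem j)) (X.norm_integral_mul_le j hnorm))

/-- Converts powers of `J` into powers of `q i`. The slack `J ≤ i + 1` serves the two terms of Abel
summation, the boundary term (`J = i`) and the sum (`J = i + 1`). -/
theorem norm_sum_discrepancyTerm_int_le {δ : ℝ} (hδ : 0 < δ) :
    ∃ K : ℝ, 0 ≤ K ∧ ∀ (n : ℤ) (J i : ℕ), J ≤ i + 1 →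
      ‖∑ j ∈ Finset.range J, X.discrepancyTerm (n * Complex.I) j‖ ≤
        K * Real.sqrt (Real.log (|(n : ℝ)| + 3)) * X.q i ^ (1 / 2 + δ) := by
  refine ⟨X.C * (Real.sqrt (1 + 1 / (2 * δ)) * (M + 1) ^ (1 / 2 + δ)),
    mul_nonneg X.C_nonneg (mul_nonneg (Real.sqrt_nonneg _)
      (Real.rpow_nonneg (by linarith [X.M_pos]) _)), fun n J i hJ => ?_⟩
  refine (X.norm_sum_le n J).trans ?_
  rw [mul_assoc, mul_assoc]
  refine mul_le_mul_of_nonneg_left ?_ X.C_nonneg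
  refine (sqrt_mul_log_le hδ (Nat.cast_nonneg J) (abs_nonneg _)).trans ?_
  have h1 : ((J : ℝ) + 1) ^ (1 / 2 + δ) ≤ (M + 1) ^ (1 / 2 + δ) * X.q i ^ (1 / 2 + δ) := by
    rw [← Real.mul_rpow (by linarith [X.M_pos]) (X.q_pos i).le]
    refine Real.rpow_le_rpow (by positivity) ?_ (by linarith)
    have : (J : ℝ) ≤ i + 1 := by exact_mod_cast hJ
    linarith [X.add_two_le_q i]
  calc _ ≤ Real.sqrt (1 + 1 / (2 * δ)) * ((M + 1) ^ (1 / 2 + δ) * X.q i ^ (1 / 2 + δ)) *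
        Real.sqrt (Real.log (|(n : ℝ)| + 3)) := by gcongr
    _ = _ := by ring

/-- Write `s = w + in` with `n` the integer nearest to `Im s`, so that `‖w‖ ≤ Re s + 1`. Abel
summation pairs the weights `q_j^(-w)` with partial sums of size `√log * q_j^b`, where `b = 1/2 + δ
< σ₀ ≤ Re s`; this gap makes everything converge uniformly. -/
theorem exists_norm_discrepancy_le {σ₀ : ℝ} (hσ₀ : 1 / 2 < σ₀) :
    ∃ K : ℝ, 0 ≤ K ∧ ∀ s : ℂ, σ₀ ≤ s.re →
      ‖X.discrepancy s‖ ≤ K * Real.sqrt (Real.log (|s.im| + 4)) := by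
  set δ := (σ₀ - 1 / 2) / 2 with hδ
  have hδ0 : 0 < δ := by rw [hδ]; linarith
  obtain ⟨K, hK, hKb⟩ := X.norm_sum_discrepancyTerm_int_le hδ0
  -- The quotient `(Re s + 1) / (Re s - b)` decreases in `Re s`, and since `σ₀ - b = δ` its value at
  -- `σ₀` is `R`. So no upper bound on `Re s` is needed.
  set R := (1 + σ₀) / δ with hR
  have hR0 : 0 ≤ R := by rw [hR]; positivity
  refine ⟨2 * R + (K + R * K), by positivity, fun s hs => ?_⟩
  have hs0 : 0 < s.re := by linarith
  refine le_of_tendsto (X.summable_discrepancyTerm hs0).hasSum.tendsto_sum_nat.norm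
    (Eventually.of_forall fun J => ?_)
  set n := round s.im with hn
  have hround := abs_sub_round s.im
  set w := s - n * Complex.I with hw
  have hwre : w.re = s.re := by simp [hw]
  have hsw : s = w + n * Complex.I := by rw [hw]; ring
  have hwnorm : ‖w‖ ≤ s.re + 1 := by
    refine (Complex.norm_le_abs_re_add_abs_im _).trans ?_
    have : w.im = s.im - round s.im := by simp [hw, hn]
    rw [hwre, this, abs_of_pos hs0]
    linarith
  set b := 1 / 2 + δ with hb
  have hσb : δ ≤ s.re - b := by rw [hb, hδ]; linarith
  have hwR : ‖w‖ * (1 / (s.re - b)) ≤ R := by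
    rw [mul_one_div, hR, div_le_div_iff₀ (by linarith) hδ0]
    nlinarith
  set ℓ := Real.sqrt (Real.log (|s.im| + 4)) with hℓ
  have hℓ1 : 1 ≤ ℓ := by
    rw [hℓ, Real.one_le_sqrt, Real.le_log_iff_exp_le (by positivity)]
    linarith [Real.exp_one_lt_d9, abs_nonneg s.im]
  have hℓn : Real.sqrt (Real.log (|(n : ℝ)| + 3)) ≤ ℓ := by
    refine Real.sqrt_le_sqrt (Real.log_le_log (by positivity) ?_)
    have := abs_sub_abs_le_abs_sub (n : ℝ) s.im
    rw [abs_sub_comm] at this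
    linarith
  have hE : ∀ J i : ℕ, J ≤ i + 1 →
      ‖∑ j ∈ Finset.range J, X.discrepancyTerm (n * Complex.I) j‖ ≤ K * ℓ * X.q i ^ b :=
    fun J i hJ => (hKb n J i hJ).trans (by
      have := Real.rpow_nonneg (X.q_pos i).le b
      gcongr)
  have herr : ‖∑ j ∈ Finset.range J, (X.discrepancyTerm s j -
      (X.q j : ℂ) ^ (-w) * X.discrepancyTerm (n * Complex.I) j)‖ ≤ 2 * R := by
    calc _ ≤ ∑ j ∈ Finset.range J,
          2 * (‖w‖ * ∫ v in X.q j..X.q (j + 1), v ^ (-w.re - 1)) :=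
          norm_sum_le_of_le _ fun j _ => by
            rw [hsw]
            exact X.norm_discrepancyTerm_sub_le w n j
      _ = 2 * (‖w‖ * ∑ j ∈ Finset.range J, ∫ v in X.q j..X.q (j + 1), v ^ (-w.re - 1)) := by
          rw [Finset.mul_sum, Finset.mul_sum]
      _ ≤ 2 * (‖w‖ * (1 / (s.re - b))) := by
          rw [hwre]
          have h1 := X.sum_integral_rpow_neg_le hs0 J
          have h2 : 1 / s.re ≤ 1 / (s.re - b) :=
            one_div_le_one_div_of_le (by linarith) (by rw [hb]; linarith)
          gcongr
          exact h1.trans h2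
      _ ≤ 2 * R := by linarith
  have hmain : ‖∑ j ∈ Finset.range J,
      (X.q j : ℂ) ^ (-w) * X.discrepancyTerm (n * Complex.I) j‖ ≤ K * ℓ + R * (K * ℓ) := by
    rw [sum_range_mul_eq_abel]
    refine (norm_add_le _ _).trans (add_le_add ?_ ?_)
    · rw [norm_mul, Complex.norm_cpow_eq_rpow_re_of_pos (X.q_pos J), Complex.neg_re, hwre]
      calc _ ≤ X.q J ^ (-s.re) * (K * ℓ * X.q J ^ b) :=
            mul_le_mul_of_nonneg_left (hE J J (Nat.le_succ J)) (Real.rpow_nonneg (X.q_pos J).le _)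
        _ = K * ℓ * X.q J ^ (-s.re + b) := by
            rw [Real.rpow_add (X.q_pos J) (-s.re) b]
            ring
        _ ≤ K * ℓ * 1 := by
            refine mul_le_mul_of_nonneg_left ?_ (by positivity)
            exact Real.rpow_le_one_of_one_le_of_nonpos (by linarith [X.two_le_q J]) (by linarith)
        _ = K * ℓ := mul_one _
    · calc _ ≤ ∑ j ∈ Finset.range J,
            (‖w‖ * (K * ℓ)) * ∫ v in X.q j..X.q (j + 1), v ^ (-(s.re - b) - 1) := by
            refine norm_sum_le_of_le _ fun j _ => ?_
            rw [norm_mul, norm_sub_rev]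
            have h1 := X.norm_cpow_sub_cpow_le j (Set.left_mem_Icc.2 (X.q_le_succ j))
              (Set.right_mem_Icc.2 (X.q_le_succ j)) w
            refine (mul_le_mul h1 (hE (j + 1) j le_rfl) (norm_nonneg _)
              (mul_nonneg (norm_nonneg _) (X.integral_rpow_nonneg _ j))).trans ?_
            have h2 : X.q j ^ b * ∫ v in X.q j..X.q (j + 1), v ^ (-w.re - 1) ≤
                ∫ v in X.q j..X.q (j + 1), v ^ (-(s.re - b) - 1) := by
              rw [← intervalIntegral.integral_const_mul]
              refine intervalIntegral.integral_mono_on (X.q_le_succ j)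
                ((continuousOn_rpow_const_uIcc (X.q_pos j) (X.q_pos _) _).intervalIntegrable.const_mul
                  _)
                (continuousOn_rpow_const_uIcc (X.q_pos j) (X.q_pos _) _).intervalIntegrable
                fun v hv => ?_
              have hv0 : 0 < v := (X.q_pos j).trans_le hv.1
              have : v ^ (-(s.re - b) - 1) = v ^ b * v ^ (-w.re - 1) := by
                rw [← Real.rpow_add hv0, hwre]
                congr 1
                ring
              rw [this]
              exact mul_le_mul_of_nonneg_right (Real.rpow_le_rpow (X.q_pos j).le hv.1
                (by rw [hb]; linarith)) (Real.rpow_nonneg hv0.le _)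
            calc _ = (‖w‖ * (K * ℓ)) *
                  (X.q j ^ b * ∫ v in X.q j..X.q (j + 1), v ^ (-w.re - 1)) := by ring
              _ ≤ _ := mul_le_mul_of_nonneg_left h2 (by positivity)
        _ = (‖w‖ * (K * ℓ)) * ∑ j ∈ Finset.range J,
              ∫ v in X.q j..X.q (j + 1), v ^ (-(s.re - b) - 1) := by rw [Finset.mul_sum]
        _ ≤ (‖w‖ * (K * ℓ)) * (1 / (s.re - b)) :=
            mul_le_mul_of_nonneg_left (X.sum_integral_rpow_neg_le (by linarith) J) (by positivity)
        _ = ‖w‖ * (1 / (s.re - b)) * (K * ℓ) := by ring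
        _ ≤ R * (K * ℓ) := mul_le_mul_of_nonneg_right hwR (by positivity)
  rw [← sub_add_cancel (∑ j ∈ Finset.range J, X.discrepancyTerm s j)
    (∑ j ∈ Finset.range J, (X.q j : ℂ) ^ (-w) * X.discrepancyTerm (n * Complex.I) j),
    ← Finset.sum_sub_distrib]
  refine (norm_add_le _ _).trans ((add_le_add herr hmain).trans ?_)
  nlinarith [mul_nonneg hR0 (sub_nonneg.2 hℓ1)]

end DensitySampling

/-! ### Euler products over a free commutative monoid. -/

theorem sum_finsupp_prod_pow {R : Type*} [CommRing R] (z : ℕ → R) (s : Finset ℕ) (T : Finset ℕ) :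
    ∑ g ∈ s.finsupp (fun _ => T), (g.prod fun j k => z j ^ k) = ∏ j ∈ s, ∑ k ∈ T, z j ^ k := by
  classical
  rw [Finset.prod_sum, Finset.finsupp, Finset.sum_map]
  refine Finset.sum_congr (by congr!) fun g _ => ?_
  simp only [Function.Embedding.coeFn_mk]
  rw [Finsupp.prod_of_support_subset _ (Finsupp.support_indicator_subset s g) _ (by simp),
    ← Finset.prod_attach s]
  refine Finset.prod_congr rfl fun j _ => ?_
  rw [Finsupp.indicator_of_mem j.2]

theorem exists_subset_finsupp_box (A : Finset (ℕ →₀ ℕ)) :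
    ∃ N : ℕ, ∀ n K, N ≤ n → N ≤ K →
      A ⊆ (Finset.range n).finsupp (fun _ => Finset.range (K + 1)) := by
  refine ⟨A.sup (fun g => (g.support.sup id + 1) + g.support.sup g), fun n K hn hK g hg => ?_⟩
  have h1 : (g.support.sup id + 1) + g.support.sup g ≤
      A.sup (fun g => (g.support.sup id + 1) + g.support.sup g) :=
    Finset.le_sup (f := fun g : ℕ →₀ ℕ => (g.support.sup id + 1) + g.support.sup g) hg
  have h3 : ∀ i ∈ g.support, i ≤ g.support.sup id := fun i hi => Finset.le_sup (f := id) hi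
  have h4 : ∀ i ∈ g.support, g i ≤ g.support.sup g := fun i hi => Finset.le_sup (f := g) hi
  rw [Finset.mem_finsupp_iff]
  refine ⟨fun i hi => ?_, fun i _ => ?_⟩
  · have := h3 i hi
    rw [Finset.mem_range]
    omega
  · rw [Finset.mem_range]
    by_cases hi : i ∈ g.support
    · have := h4 i hi
      omega
    · rw [Finsupp.notMem_support_iff.1 hi]
      omega

/-- Any finite set of exponents lies in a box, over which the sum factors. The inequality `(1 - x)⁻¹
≤ 1 + 4x`, valid for `0 ≤ x ≤ 3/4`, bounds the product by `exp (4 ∑ x)`. -/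
theorem summable_finsupp_prod_pow {x : ℕ → ℝ} (hx0 : ∀ j, 0 ≤ x j) (hx : ∀ j, x j ≤ 3 / 4)
    (hs : Summable x) : Summable fun g : ℕ →₀ ℕ => g.prod fun j k => x j ^ k := by
  refine summable_of_sum_le (c := Real.exp (4 * ∑' j, x j))
    (fun g => Finset.prod_nonneg fun j _ => pow_nonneg (hx0 j) _) fun A => ?_
  obtain ⟨N, hN⟩ := exists_subset_finsupp_box A
  calc _ ≤ ∑ g ∈ (Finset.range N).finsupp (fun _ => Finset.range (N + 1)),
        (g.prod fun j k => x j ^ k) :=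
        Finset.sum_le_sum_of_subset_of_nonneg (hN N N le_rfl le_rfl)
          fun g _ _ => Finset.prod_nonneg fun j _ => pow_nonneg (hx0 j) _
    _ = ∏ j ∈ Finset.range N, ∑ k ∈ Finset.range (N + 1), x j ^ k := sum_finsupp_prod_pow _ _ _
    _ ≤ ∏ j ∈ Finset.range N, Real.exp (4 * x j) := by
        refine Finset.prod_le_prod
          (fun j _ => Finset.sum_nonneg fun k _ => pow_nonneg (hx0 j) _) fun j _ => ?_
        have h1 : x j < 1 := by linarith [hx j]
        calc ∑ k ∈ Finset.range (N + 1), x j ^ k ≤ (1 - x j)⁻¹ :=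
              sum_le_hasSum _ (fun k _ => pow_nonneg (hx0 j) _)
                (hasSum_geometric_of_lt_one (hx0 j) h1)
          _ ≤ 4 * x j + 1 := by
              rw [inv_le_iff_one_le_mul₀ (by linarith)]
              nlinarith [hx j, hx0 j]
          _ ≤ _ := Real.add_one_le_exp _
    _ = Real.exp (4 * ∑ j ∈ Finset.range N, x j) := by rw [← Real.exp_sum, Finset.mul_sum]
    _ ≤ _ := by
        gcongr
        exact hs.sum_le_tsum _ fun j _ => hx0 j

theorem norm_neg_log_one_sub_sub_self_le {z : ℂ} (hz : ‖z‖ ≤ 3 / 4) :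
    ‖-Complex.log (1 - z) - z‖ ≤ 2 * ‖z‖ ^ 2 := by
  have h1 : ‖-z‖ < 1 := by rw [norm_neg]; linarith
  have h := Complex.norm_log_one_add_sub_self_le h1
  rw [norm_neg, ← sub_eq_add_neg, sub_neg_eq_add, ← norm_neg] at h
  have h2 : (1 - ‖z‖)⁻¹ ≤ 4 := by
    rw [inv_le_iff_one_le_mul₀ (by linarith)]
    linarith
  calc ‖-Complex.log (1 - z) - z‖ = ‖-(Complex.log (1 - z) + z)‖ := by congr 1; ring
    _ ≤ _ := h
    _ ≤ ‖z‖ ^ 2 * 4 / 2 := by gcongr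
    _ = 2 * ‖z‖ ^ 2 := by ring

/-- The Euler product over a free commutative monoid on countably many generators. -/
theorem hasSum_finsupp_prod_pow {z : ℕ → ℂ} (hz : ∀ j, ‖z j‖ ≤ 3 / 4)
    (hs : Summable fun j => ‖z j‖) :
    HasSum (fun g : ℕ →₀ ℕ => g.prod fun j k => z j ^ k)
      (Complex.exp (∑' j, z j + ∑' j, (-Complex.log (1 - z j) - z j))) := by
  have hsum : Summable fun g : ℕ →₀ ℕ => g.prod fun j k => z j ^ k := by
    refine Summable.of_norm ((summable_finsupp_prod_pow (fun j => norm_nonneg (z j)) hz hs).congr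
      fun g => ?_)
    simp [Finsupp.prod, norm_prod]
  have hs1 : Summable z := hs.of_norm
  have hs2 : Summable fun j => -Complex.log (1 - z j) - z j := by
    refine Summable.of_norm_bounded (g := fun j => 2 * ‖z j‖) (hs.mul_left 2) fun j => ?_
    have h1 := norm_neg_log_one_sub_sub_self_le (hz j)
    nlinarith [norm_nonneg (z j), hz j]
  have hlim : Tendsto (fun n => ∏ j ∈ Finset.range n, (1 - z j)⁻¹) atTop
      (𝓝 (Complex.exp (∑' j, z j + ∑' j, (-Complex.log (1 - z j) - z j)))) := by
    rw [← hs1.tsum_add hs2]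
    have := (Complex.continuous_exp.tendsto _).comp (hs1.add hs2).hasSum.tendsto_sum_nat
    refine this.congr fun n => ?_
    simp only [Function.comp_apply, Complex.exp_sum]
    refine Finset.prod_congr rfl fun j _ => ?_
    have hne : 1 - z j ≠ 0 := fun h => by
      have : ‖z j‖ = 1 := by rw [← sub_eq_zero.1 h, norm_one]
      linarith [hz j]
    rw [add_sub_cancel, Complex.exp_neg, Complex.exp_log hne]
  have hgeo : ∀ n, Tendsto (fun K => ∏ j ∈ Finset.range n, ∑ k ∈ Finset.range (K + 1), z j ^ k)
      atTop (𝓝 (∏ j ∈ Finset.range n, (1 - z j)⁻¹)) := fun n =>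
    tendsto_finsetProd _ fun j _ => ((hasSum_geometric_of_norm_lt_one
      (by linarith [hz j])).tendsto_sum_nat).comp (tendsto_add_atTop_nat 1)
  -- A diagonal choice of boxes: `K n ≥ n` makes them exhaust the monoid, while the truncated
  -- geometric series stay within `1 / (n + 1)` of the full product.
  have hK : ∀ n : ℕ, ∃ K, n ≤ K ∧
      dist (∏ j ∈ Finset.range n, ∑ k ∈ Finset.range (K + 1), z j ^ k)
        (∏ j ∈ Finset.range n, (1 - z j)⁻¹) < 1 / ((n : ℝ) + 1) := fun n => by
    obtain ⟨K, h1, h2⟩ := ((eventually_ge_atTop n).and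
      (Metric.tendsto_nhds.1 (hgeo n) _ (Nat.one_div_pos_of_nat (n := n)))).exists
    exact ⟨K, h1, h2⟩
  choose K hKn hKd using hK
  have hbox : Tendsto (fun n => (Finset.range n).finsupp (fun _ => Finset.range (K n + 1)))
      atTop (atTop : Filter (Finset (ℕ →₀ ℕ))) := tendsto_atTop.2 fun A => by
    obtain ⟨N, hN⟩ := exists_subset_finsupp_box A
    filter_upwards [eventually_ge_atTop N] with n hn using hN n _ hn (hn.trans (hKn n))
  have h1 := hsum.hasSum.comp hbox
  have h2 : Tendsto (fun n => ∏ j ∈ Finset.range n, ∑ k ∈ Finset.range (K n + 1), z j ^ k) atTop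
      (𝓝 (Complex.exp (∑' j, z j + ∑' j, (-Complex.log (1 - z j) - z j)))) := by
    refine (tendsto_iff_of_dist (squeeze_zero (fun _ => dist_nonneg) (fun n => (hKd n).le)
      tendsto_one_div_add_atTop_nhds_zero_nat)).2 hlim
  have h3 := tendsto_nhds_unique (h1.congr fun n => sum_finsupp_prod_pow _ _ _) h2
  rw [← h3]
  exact hsum.hasSum

namespace BeurlingPrimes

variable (P : BeurlingPrimes)

theorem p_pos (j : ℕ) : 0 < P.p j := one_pos.trans (P.one_lt j)

theorem norm_pos (g : P.Integers) : 0 < P.norm g :=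
  Finset.prod_pos fun j _ => pow_pos (P.p_pos j) _

theorem one_le_norm (g : P.Integers) : 1 ≤ P.norm g :=
  (one_le_pow₀ (P.one_lt 0).le).trans (P.pow_le_norm g 0)

theorem ofReal_norm_cpow (g : P.Integers) (s : ℂ) :
    (P.norm g : ℂ) ^ s = g.prod fun j k => ((P.p j : ℂ) ^ s) ^ k := by
  have hpow : ∀ j, (P.p j : ℂ) ^ s = Complex.exp (Real.log (P.p j) * s) := fun j => by
    rw [Complex.cpow_def_of_ne_zero (by exact_mod_cast (P.p_pos j).ne'),
      Complex.ofReal_log (P.p_pos j).le]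
  rw [Complex.cpow_def_of_ne_zero (by exact_mod_cast (P.norm_pos g).ne'),
    ← Complex.ofReal_log (P.norm_pos g).le]
  have hlog : Real.log (P.norm g) = ∑ j ∈ g.support, g j * Real.log (P.p j) := by
    unfold norm Finsupp.prod
    rw [Real.log_prod fun j _ => (pow_pos (P.p_pos j) _).ne']
    exact Finset.sum_congr rfl fun j _ => Real.log_pow _ _
  rw [hlog, Complex.ofReal_sum, Finset.sum_mul, Complex.exp_sum]
  refine Finset.prod_congr rfl fun j _ => ?_
  simp only [hpow, ← Complex.exp_nat_mul]
  push_cast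
  ring_nf

theorem norm_p_cpow_neg (j : ℕ) (s : ℂ) : ‖(P.p j : ℂ) ^ (-s)‖ = P.p j ^ (-s.re) := by
  rw [Complex.norm_cpow_eq_rpow_re_of_pos (P.p_pos j), Complex.neg_re]

/-- The constant `3/4` of the Euler product is chosen to exceed `2^(-1/2)`. -/
theorem norm_p_cpow_neg_le {j : ℕ} (hj : 2 ≤ P.p j) {s : ℂ} (hs : 1 / 2 ≤ s.re) :
    ‖(P.p j : ℂ) ^ (-s)‖ ≤ 3 / 4 := by
  rw [P.norm_p_cpow_neg]
  calc P.p j ^ (-s.re) ≤ P.p j ^ (-(1 / 2) : ℝ) :=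
        Real.rpow_le_rpow_of_exponent_le (P.one_lt j).le (by linarith)
    _ ≤ (2 : ℝ) ^ (-(1 / 2) : ℝ) :=
        Real.rpow_le_rpow_of_nonpos two_pos hj (by norm_num)
    _ ≤ 3 / 4 := by
        rw [Real.rpow_neg two_pos.le, ← Real.sqrt_eq_rpow]
        rw [inv_le_comm₀ (by positivity) (by norm_num)]
        exact Real.le_sqrt_of_sq_le (by norm_num)

/-- The contribution `∑ⱼ ∑_{k ≥ 2} pⱼ^(-ks) / k` of the higher prime powers to `log ζ(s)`. -/
def logZetaPowers (s : ℂ) : ℂ :=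
  ∑' j, (-Complex.log (1 - (P.p j : ℂ) ^ (-s)) - (P.p j : ℂ) ^ (-s))

theorem hasSum_norm_cpow (h2 : ∀ j, 2 ≤ P.p j) {s : ℂ} (hs : 1 / 2 ≤ s.re)
    (hsum : Summable fun j => P.p j ^ (-s.re)) :
    HasSum (fun g : P.Integers => (P.norm g : ℂ) ^ (-s))
      (Complex.exp (∑' j, (P.p j : ℂ) ^ (-s) + P.logZetaPowers s)) := by
  have := hasSum_finsupp_prod_pow (z := fun j => (P.p j : ℂ) ^ (-s))
    (fun j => P.norm_p_cpow_neg_le (h2 j) hs) (hsum.congr fun j => (P.norm_p_cpow_neg j s).symm)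
  simp_rw [P.ofReal_norm_cpow]
  exact this

theorem norm_logZetaPowers_term_le (h2 : ∀ j, 2 ≤ P.p j) {σ : ℝ} (hσ : 1 / 2 ≤ σ) {s : ℂ}
    (hs : σ ≤ s.re) (j : ℕ) :
    ‖-Complex.log (1 - (P.p j : ℂ) ^ (-s)) - (P.p j : ℂ) ^ (-s)‖ ≤ 2 * P.p j ^ (-(2 * σ)) := by
  refine (norm_neg_log_one_sub_sub_self_le (P.norm_p_cpow_neg_le (h2 j) (hσ.trans hs))).trans ?_
  rw [P.norm_p_cpow_neg, ← Real.rpow_mul_natCast (P.p_pos j).le]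
  gcongr
  · exact (P.one_lt j).le
  · push_cast
    linarith

/-- Squares of primes are the leading terms, so the exponent is doubled and `σ > 1/2` becomes `2σ >
1`. -/
theorem exists_norm_logZetaPowers_le (h2 : ∀ j, 2 ≤ P.p j)
    (hsum : ∀ σ : ℝ, 1 < σ → Summable fun j => P.p j ^ (-σ)) {σ : ℝ} (hσ : 1 / 2 < σ) :
    ∃ K : ℝ, ∀ s : ℂ, σ ≤ s.re → ‖P.logZetaPowers s‖ ≤ K :=
  ⟨_, fun _ hs => tsum_of_norm_bounded ((hsum (2 * σ) (by linarith)).mul_left 2).hasSum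
    (P.norm_logZetaPowers_term_le h2 hσ.le hs)⟩

theorem differentiableAt_logZetaPowers (h2 : ∀ j, 2 ≤ P.p j)
    (hsum : ∀ σ : ℝ, 1 < σ → Summable fun j => P.p j ^ (-σ)) {s : ℂ} (hs : 1 / 2 < s.re) :
    DifferentiableAt ℂ P.logZetaPowers s := by
  obtain ⟨σ, hσ, hσs⟩ := exists_between hs
  have hU : IsOpen {z : ℂ | σ < z.re} := isOpen_lt continuous_const Complex.continuous_re
  refine (Complex.differentiableOn_tsum_of_summable_norm
    ((hsum (2 * σ) (by linarith)).mul_left 2) (fun j z hz => ?_) hU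
    (fun j z hz => P.norm_logZetaPowers_term_le h2 hσ.le (le_of_lt hz) j)).differentiableAt
    (hU.mem_nhds hσs)
  have hz' : σ < z.re := hz
  have hp : (P.p j : ℂ) ≠ 0 := by exact_mod_cast (P.p_pos j).ne'
  have hd : DifferentiableAt ℂ (fun z : ℂ => (P.p j : ℂ) ^ (-z)) z :=
    differentiableAt_id.neg.const_cpow (Or.inl hp)
  have hslit : 1 - (P.p j : ℂ) ^ (-z) ∈ Complex.slitPlane := by
    rw [sub_eq_add_neg]
    refine Complex.mem_slitPlane_of_norm_lt_one ?_
    rw [norm_neg]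
    linarith [P.norm_p_cpow_neg_le (h2 j) (s := z) (by linarith)]
  exact ((((differentiableAt_const 1).sub hd).clog hslit).neg.sub hd).differentiableWithinAt

end BeurlingPrimes

/-! ### The density of primes and its transform. -/

/-- The kernel `∫₀¹ u⁻ᵛ dv`, which equals `(1 - 1/u) / log u` for `u > 1`. -/
def logKernel (u : ℝ) : ℝ := ∫ v in (0 : ℝ)..1, Real.exp (-(v * Real.log u))

theorem continuousOn_logKernel : ContinuousOn logKernel (Set.Ioi 0) := by
  have h : Continuous fun y : ℝ => ∫ v in (0 : ℝ)..1, Real.exp (-(v * y)) :=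
    intervalIntegral.continuous_parametric_intervalIntegral_of_continuous' (by fun_prop) 0 1
  exact h.comp_continuousOn (Real.continuousOn_log.mono fun u hu => ne_of_gt hu)

theorem inv_le_logKernel {u : ℝ} (hu : 1 ≤ u) : u⁻¹ ≤ logKernel u := by
  have hl := Real.log_nonneg hu
  have := intervalIntegral.integral_mono_on (μ := volume) zero_le_one (intervalIntegrable_const (c := u⁻¹))
    (Continuous.intervalIntegrable (by fun_prop : Continuous fun v : ℝ =>
      Real.exp (-(v * Real.log u))) 0 1) fun v hv => by
      rw [← Real.exp_log (inv_pos.2 (by linarith : 0 < u)), Real.log_inv, Real.exp_le_exp]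
      nlinarith [hv.2]
  simpa [logKernel] using this

theorem logKernel_le_one {u : ℝ} (hu : 1 ≤ u) : logKernel u ≤ 1 := by
  have hl := Real.log_nonneg hu
  have := intervalIntegral.integral_mono_on (μ := volume) zero_le_one
    (Continuous.intervalIntegrable (by fun_prop : Continuous fun v : ℝ =>
      Real.exp (-(v * Real.log u))) 0 1) (intervalIntegrable_const (c := (1 : ℝ))) fun v hv => by
      rw [Real.exp_le_one_iff]
      nlinarith [hv.1]
  simpa [logKernel] using this

theorem logKernel_mul_log {u : ℝ} (hu : 0 < u) : logKernel u * Real.log u = 1 - u⁻¹ := by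
  unfold logKernel
  rw [← intervalIntegral.integral_mul_const]
  have h : ∀ v ∈ Set.uIcc (0 : ℝ) 1, HasDerivAt (fun v => -Real.exp (-(v * Real.log u)))
      (Real.exp (-(v * Real.log u)) * Real.log u) v := fun v _ => by
    have := (((hasDerivAt_id v).mul_const (Real.log u)).neg.exp).neg
    exact this.congr_deriv (by simp)
  rw [intervalIntegral.integral_eq_sub_of_hasDerivAt h
    (Continuous.intervalIntegrable (by fun_prop) _ _)]
  simp [Real.exp_neg, Real.exp_log hu]
  ring

theorem logKernel_mul_cpow {u : ℝ} (hu : 0 < u) (w : ℂ) :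
    (logKernel u : ℂ) * (u : ℂ) ^ w = ∫ v in Set.Ioc (0 : ℝ) 1, (u : ℂ) ^ (w - v) := by
  rw [logKernel, intervalIntegral.integral_of_le zero_le_one, ← integral_complex_ofReal, mul_comm,
    ← integral_const_mul]
  refine integral_congr_ae (ae_of_all _ fun v => ?_)
  have hu' : (u : ℂ) ≠ 0 := by exact_mod_cast hu.ne'
  simp only
  rw [sub_eq_add_neg, Complex.cpow_add _ _ hu', Complex.cpow_def_of_ne_zero hu' (-(v : ℂ)),
    ← Complex.ofReal_log hu.le]
  push_cast
  ring_nf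

theorem integrable_cpow_sub_prod {z : ℂ} (hz : 0 < z.re) :
    Integrable (Function.uncurry fun (u v : ℝ) => (u : ℂ) ^ (-z - 1 - v))
      ((volume.restrict (Set.Ioi 1)).prod (volume.restrict (Set.Ioc (0 : ℝ) 1))) := by
  have hg : Integrable (fun u : ℝ => u ^ (-z.re - 1)) (volume.restrict (Set.Ioi 1)) :=
    integrableOn_Ioi_rpow_of_lt (by linarith) one_pos
  have hg2 := hg.mul_prod (integrable_const (1 : ℝ) (μ := volume.restrict (Set.Ioc (0 : ℝ) 1)))
  rw [Measure.prod_restrict] at hg2 ⊢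
  refine Integrable.mono' hg2 ?_ ?_
  · refine ContinuousOn.aestronglyMeasurable (fun x hx => ContinuousAt.continuousWithinAt ?_)
      (measurableSet_Ioi.prod measurableSet_Ioc)
    have : (x.1 : ℂ) ∈ Complex.slitPlane :=
      Complex.ofReal_mem_slitPlane.2 (one_pos.trans hx.1)
    exact ContinuousAt.cpow (by fun_prop) (by fun_prop) this
  · filter_upwards [ae_restrict_mem (measurableSet_Ioi.prod measurableSet_Ioc)] with x hx
    have hx1 : (1 : ℝ) < x.1 := hx.1
    have hx2 : 0 < x.2 := hx.2.1
    simp only [Function.uncurry, mul_one]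
    rw [Complex.norm_cpow_eq_rpow_re_of_pos (by linarith)]
    refine Real.rpow_le_rpow_of_exponent_le hx1.le ?_
    simp
    linarith

theorem integrableOn_logKernel_mul_cpow {z : ℂ} (hz : 0 < z.re) :
    IntegrableOn (fun u : ℝ => (logKernel u : ℂ) * (u : ℂ) ^ (-z - 1)) (Set.Ioi 1) := by
  refine (integrable_cpow_sub_prod hz).integral_prod_left.congr ?_
  filter_upwards [ae_restrict_mem measurableSet_Ioi] with u hu
  rw [logKernel_mul_cpow (one_pos.trans hu)]
  rfl

/-- By Fubini the integral equals `∫₀¹ dv / (z + v) = log (z + 1) - log z`; the segment from `z` to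
`z + 1` stays in the right half-plane, where the principal logarithm is a primitive. -/
theorem exp_integral_logKernel_mul_cpow {z : ℂ} (hz : 0 < z.re) :
    Complex.exp (∫ u in Set.Ioi (1 : ℝ), (logKernel u : ℂ) * (u : ℂ) ^ (-z - 1)) =
      (z + 1) / z := by
  have hne : ∀ v : ℝ, 0 ≤ v → 0 < (z + v).re := fun v hv => by
    simp
    linarith
  have h1 : ∫ u in Set.Ioi (1 : ℝ), (logKernel u : ℂ) * (u : ℂ) ^ (-z - 1) =
      ∫ v in (0 : ℝ)..1, (z + v)⁻¹ := by
    rw [setIntegral_congr_fun measurableSet_Ioi fun u hu =>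
      logKernel_mul_cpow (one_pos.trans hu) (-z - 1),
      integral_integral_swap (integrable_cpow_sub_prod hz),
      intervalIntegral.integral_of_le zero_le_one]
    refine setIntegral_congr_fun measurableSet_Ioc fun v hv => ?_
    have h := hne v hv.1.le
    rw [integral_Ioi_cpow_of_lt (by simp at h ⊢; linarith) one_pos]
    have h0 : z + v ≠ 0 := fun h0 => by simp [h0] at h
    have : -z - 1 - (v : ℂ) + 1 = -(z + v) := by ring
    rw [this, Complex.ofReal_one, Complex.one_cpow, neg_div_neg_eq, one_div]
  have h2 : ∫ v in (0 : ℝ)..1, (z + v)⁻¹ = Complex.log (z + 1) - Complex.log z := by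
    have hd : ∀ v ∈ Set.uIcc (0 : ℝ) 1,
        HasDerivAt (fun v : ℝ => Complex.log (z + v)) (z + v)⁻¹ v := fun v hv => by
      rw [Set.uIcc_of_le zero_le_one] at hv
      have hs : z + (v : ℂ) ∈ Complex.slitPlane := Or.inl (hne v hv.1)
      have := (((hasDerivAt_id (v : ℂ)).const_add z).clog hs).comp_ofReal
      simpa using this
    rw [intervalIntegral.integral_eq_sub_of_hasDerivAt hd]
    · simp
    · refine ContinuousOn.intervalIntegrable fun v hv => ContinuousAt.continuousWithinAt ?_
      rw [Set.uIcc_of_le zero_le_one] at hv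
      have h0 : z + (v : ℂ) ≠ 0 := fun h0 => by simpa [h0] using hne v hv.1
      fun_prop (disch := assumption)
  have hz0 : z ≠ 0 := fun h => by simp [h] at hz
  have hz1 : z + 1 ≠ 0 := fun h => by simpa [h] using hne 1 zero_le_one
  rw [h1, h2, Complex.exp_sub, Complex.exp_log hz1, Complex.exp_log hz0]

theorem multiset_logKernel_transform (T : Multiset ℂ) {s : ℂ} (hT : ∀ ρ ∈ T, ρ.re < s.re) :
    IntegrableOn (fun u : ℝ => (logKernel u : ℂ) *
      (T.map fun ρ => (u : ℂ) ^ (-(s - ρ) - 1)).sum) (Set.Ioi 1) ∧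
    Complex.exp (∫ u in Set.Ioi (1 : ℝ), (logKernel u : ℂ) *
      (T.map fun ρ => (u : ℂ) ^ (-(s - ρ) - 1)).sum) =
      (T.map fun ρ => (s - ρ + 1) / (s - ρ)).prod := by
  induction T using Multiset.induction with
  | empty => simp
  | cons ρ T ih =>
    obtain ⟨h1, h2⟩ := ih fun ρ' h' => hT ρ' (Multiset.mem_cons_of_mem h')
    have hz : 0 < (s - ρ).re := by
      rw [Complex.sub_re]
      linarith [hT ρ (Multiset.mem_cons_self _ _)]
    have h3 := integrableOn_logKernel_mul_cpow hz
    simp only [Multiset.map_cons, Multiset.sum_cons, Multiset.prod_cons, mul_add]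
    refine ⟨h3.add h1, ?_⟩
    rw [integral_add h3 h1, Complex.exp_add, h2, exp_integral_logKernel_mul_cpow hz]

/-- The weight `1 + u^(r-1) - ∑ u^(ρ-1)`. -/
def zeroWeight (r : ℝ) (S : Multiset ℂ) (u : ℝ) : ℂ :=
  1 + (u : ℂ) ^ ((r : ℂ) - 1) - (S.map fun ρ => (u : ℂ) ^ (ρ - 1)).sum

/-- The density of primes that produces the zeros `S` and the poles `1` and `r`. -/
def zeroDensity (r : ℝ) (S : Multiset ℂ) (u : ℝ) : ℝ := logKernel u * (zeroWeight r S u).re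

/-- The rational function with the zeros `S` and the poles `1` and `r`. -/
def zeroRational (r : ℝ) (S : Multiset ℂ) (s : ℂ) : ℂ :=
  s / (s - 1) * ((s - r + 1) / (s - r)) * (S.map fun ρ => (s - ρ) / (s - ρ + 1)).prod

theorem conj_ofReal_cpow {u : ℝ} (hu : 0 < u) (w : ℂ) :
    (starRingEnd ℂ) ((u : ℂ) ^ w) = (u : ℂ) ^ ((starRingEnd ℂ) w) := by
  rw [Complex.cpow_conj, Complex.conj_ofReal]
  rw [Complex.arg_ofReal_of_nonneg hu.le]
  exact Real.pi_pos.ne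

/-- Conjugation merely permutes the terms indexed by `S`, so taking the real part in `zeroDensity`
loses nothing. -/
theorem ofReal_re_zeroWeight (r : ℝ) {S : Multiset ℂ} (hsymm : S.map (starRingEnd ℂ) = S)
    {u : ℝ} (hu : 0 < u) : ((zeroWeight r S u).re : ℂ) = zeroWeight r S u := by
  rw [← Complex.conj_eq_iff_re]
  have hS : (starRingEnd ℂ) (S.map fun ρ => (u : ℂ) ^ (ρ - 1)).sum =
      (S.map fun ρ => (u : ℂ) ^ (ρ - 1)).sum := by
    rw [map_multiset_sum, Multiset.map_map]
    conv_rhs => rw [← hsymm, Multiset.map_map]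
    congr 1
    refine Multiset.map_congr rfl fun ρ _ => ?_
    simp [conj_ofReal_cpow hu]
  unfold zeroWeight
  rw [map_sub, hS, map_add, conj_ofReal_cpow hu]
  simp

theorem continuousOn_zeroWeight (r : ℝ) (S : Multiset ℂ) :
    ContinuousOn (zeroWeight r S) (Set.Ioi 0) := by
  have hpow : ∀ w : ℂ, ContinuousOn (fun u : ℝ => (u : ℂ) ^ w) (Set.Ioi 0) := fun w u hu => by
    have : (u : ℂ) ∈ Complex.slitPlane := Complex.ofReal_mem_slitPlane.2 hu
    exact ContinuousAt.continuousWithinAt (by fun_prop (disch := assumption))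
  refine (continuousOn_const.add (hpow _)).sub ?_
  induction S using Multiset.induction with
  | empty => simpa using continuousOn_const
  | cons ρ S ih =>
    simp only [Multiset.map_cons, Multiset.sum_cons]
    exact (hpow _).add ih

theorem continuousOn_zeroDensity (r : ℝ) (S : Multiset ℂ) :
    ContinuousOn (zeroDensity r S) (Set.Ioi 0) :=
  continuousOn_logKernel.mul
    (Complex.continuous_re.comp_continuousOn (continuousOn_zeroWeight r S))

theorem tendsto_ofReal_cpow_atTop_zero {w : ℂ} (hw : w.re < 0) :
    Tendsto (fun u : ℝ => (u : ℂ) ^ w) atTop (𝓝 0) := by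
  rw [tendsto_zero_iff_norm_tendsto_zero]
  have := tendsto_rpow_neg_atTop (neg_pos.2 hw)
  rw [neg_neg] at this
  refine this.congr' ((eventually_gt_atTop 0).mono fun u hu => ?_)
  exact (Complex.norm_cpow_eq_rpow_re_of_pos hu _).symm

theorem tendsto_zeroWeight {r : ℝ} (hr : r < 1) {S : Multiset ℂ} (hS : ∀ ρ ∈ S, ρ.re < 1) :
    Tendsto (zeroWeight r S) atTop (𝓝 1) := by
  have h1 : Tendsto (fun u : ℝ => (u : ℂ) ^ ((r : ℂ) - 1)) atTop (𝓝 0) :=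
    tendsto_ofReal_cpow_atTop_zero (by simpa using hr)
  have h2 : Tendsto (fun u : ℝ => (S.map fun ρ => (u : ℂ) ^ (ρ - 1)).sum) atTop (𝓝 0) := by
    induction S using Multiset.induction with
    | empty => simp
    | cons ρ S ih =>
      have h3 := ih fun ρ' h' => hS ρ' (Multiset.mem_cons_of_mem h')
      have h4 : Tendsto (fun u : ℝ => (u : ℂ) ^ (ρ - 1)) atTop (𝓝 0) :=
        tendsto_ofReal_cpow_atTop_zero (by simpa using hS ρ (Multiset.mem_cons_self _ _))
      simpa using h4.add h3
  have h3 := (h1.const_add 1).sub h2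
  rw [add_zero, sub_zero] at h3
  exact h3

/-- The weight tends to `1`, so beyond some `a` it lies between `1/2` and `2`. Since `1/u ≤
logKernel u ≤ 1`, the density is then at most `2` and at least `1/(2u)`; the lower bound makes its
total mass infinite. -/
theorem exists_sampling_zeroDensity {r : ℝ} (hr : r < 1) {S : Multiset ℂ}
    (hS : ∀ ρ ∈ S, ρ.re < 1) : ∃ a : ℝ, Nonempty (DensitySampling (zeroDensity r S) a 2) := by
  have hre := (Complex.continuous_re.tendsto _).comp (tendsto_zeroWeight hr hS)
  obtain ⟨a, ha⟩ := ((hre.eventually_const_lt (show (1 / 2 : ℝ) < (1 : ℂ).re by norm_num)).and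
    ((hre.eventually_lt_const (show (1 : ℂ).re < 2 by norm_num)).and
      (eventually_ge_atTop 2))).exists_forall_of_atTop
  have ha2 : 2 ≤ a := (ha a le_rfl).2.2
  have hlow : ∀ u, a ≤ u → 1 / 2 * u⁻¹ ≤ zeroDensity r S u := fun u hu => by
    have h1 := inv_le_logKernel (show 1 ≤ u by linarith)
    have h2 : 1 / 2 < (zeroWeight r S u).re := (ha u hu).1
    have h3 : 0 < u⁻¹ := inv_pos.2 (by linarith)
    unfold zeroDensity
    nlinarith
  have hcont : ContinuousOn (zeroDensity r S) (Set.Ici a) :=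
    (continuousOn_zeroDensity r S).mono fun u hu =>
      Set.mem_Ioi.2 (by linarith [Set.mem_Ici.1 hu])
  refine ⟨a, exists_densitySampling ha2 hcont (fun u hu => ?_) (fun u hu => ?_) ?_⟩
  · exact lt_of_lt_of_le (by have : 0 < u := by linarith
                             positivity) (hlow u hu)
  · have h1 := logKernel_le_one (show 1 ≤ u by linarith)
    have h2 : 1 / 2 < (zeroWeight r S u).re := (ha u hu).1
    have h3 : (zeroWeight r S u).re < 2 := (ha u hu).2.1
    unfold zeroDensity
    nlinarith
  · refine tendsto_atTop_mono' _ (f₁ := fun x => 1 / 2 * (Real.log x - Real.log a)) ?_ ?_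
    · filter_upwards [eventually_ge_atTop a] with x hx
      have h0 : (0 : ℝ) ∉ Set.uIcc a x := by
        rw [Set.uIcc_of_le hx]
        exact fun h => by linarith [h.1]
      rw [← Real.log_div (by linarith) (by linarith), ← integral_inv h0,
        ← intervalIntegral.integral_const_mul]
      refine intervalIntegral.integral_mono_on hx
        ((intervalIntegral.intervalIntegrable_inv (fun u hu h => h0 (h ▸ hu))
          continuousOn_id).const_mul _)
        (hcont.mono fun u hu => ?_).intervalIntegrable fun u hu => hlow u hu.1
      rw [Set.uIcc_of_le hx] at hu
      exact hu.1
    · exact ((tendsto_atTop_add_const_right _ (-Real.log a) Real.tendsto_log_atTop)).const_mul_atTop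
        (by norm_num)

/-- The poles form the multiset `{1, r}`; the zeros enter with a minus sign, hence with inverted
factors. -/
theorem zeroDensity_transform {r : ℝ} (hr : r < 1) {S : Multiset ℂ} (hS : ∀ ρ ∈ S, ρ.re < 1)
    (hsymm : S.map (starRingEnd ℂ) = S) {s : ℂ} (hs : 1 < s.re) :
    IntegrableOn (fun u : ℝ => (zeroDensity r S u : ℂ) * (u : ℂ) ^ (-s)) (Set.Ioi 1) ∧
    Complex.exp (∫ u in Set.Ioi (1 : ℝ), (zeroDensity r S u : ℂ) * (u : ℂ) ^ (-s)) =
      zeroRational r S s := by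
  obtain ⟨h1, h1'⟩ := multiset_logKernel_transform {1, (r : ℂ)} (s := s) (by
    intro ρ hρ
    simp only [Multiset.insert_eq_cons, Multiset.mem_cons, Multiset.mem_singleton] at hρ
    rcases hρ with rfl | rfl
    · simpa using hs
    · simpa using hr.trans hs)
  obtain ⟨h2, h2'⟩ := multiset_logKernel_transform S (s := s) fun ρ hρ => (hS ρ hρ).trans hs
  have heq : ∀ u ∈ Set.Ioi (1 : ℝ), (zeroDensity r S u : ℂ) * (u : ℂ) ^ (-s) =
      (logKernel u : ℂ) * (({1, (r : ℂ)} : Multiset ℂ).map fun ρ =>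
        (u : ℂ) ^ (-(s - ρ) - 1)).sum -
      (logKernel u : ℂ) * (S.map fun ρ => (u : ℂ) ^ (-(s - ρ) - 1)).sum := by
    intro u hu
    have hu0 : (0 : ℝ) < u := one_pos.trans hu
    have hpow : ∀ ρ : ℂ, (u : ℂ) ^ (-(s - ρ) - 1) = (u : ℂ) ^ (-s) * (u : ℂ) ^ (ρ - 1) := by
      intro ρ
      rw [← Complex.cpow_add _ _ (by exact_mod_cast hu0.ne')]
      congr 1
      ring
    rw [zeroDensity, Complex.ofReal_mul, ofReal_re_zeroWeight r hsymm hu0]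
    simp only [hpow, Multiset.sum_map_mul_left, zeroWeight]
    simp
    ring
  refine ⟨(h1.sub h2).congr_fun (fun u hu => (heq u hu).symm) measurableSet_Ioi, ?_⟩
  rw [setIntegral_congr_fun measurableSet_Ioi heq, integral_sub h1 h2, Complex.exp_sub, h1', h2',
    div_eq_mul_inv, ← Multiset.prod_map_inv]
  simp [zeroRational]

/-! ### The zeta function of the sampled primes. -/

namespace DensitySampling

variable {f : ℝ → ℝ} {a M : ℝ} (X : DensitySampling f a M)

theorem tendsto_q : Tendsto X.q atTop atTop := by
  have hM := X.M_pos
  refine tendsto_atTop_mono (f := fun j : ℕ => (j : ℝ) * (M + 1)⁻¹) (fun j => ?_)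
    (tendsto_natCast_atTop_atTop.atTop_mul_const (by positivity))
  rw [mul_inv_le_iff₀ (by positivity)]
  linarith [X.add_two_le_q j]

/-- The sample points as a sequence of Beurling primes. -/
def toBeurlingPrimes : BeurlingPrimes where
  p := X.p
  one_lt j := by linarith [X.two_le_p j]
  mono := monotone_nat_of_le_succ fun j => (X.p_mem j).2.trans (X.p_mem (j + 1)).1
  tendsto := tendsto_atTop_mono (fun j => (X.p_mem j).1) X.tendsto_q

theorem summable_rpow_neg {σ : ℝ} (hσ : 1 < σ) : Summable fun j => X.p j ^ (-σ) := by
  have hM := X.M_pos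
  have hsum : Summable fun j : ℕ => (M + 1) ^ σ * ((j : ℝ) + 2) ^ (-σ) := by
    refine Summable.mul_left _ ?_
    have := (summable_nat_add_iff 2).2 (Real.summable_nat_rpow.2 (neg_lt_neg hσ))
    simpa using this
  refine Summable.of_nonneg_of_le (fun j => Real.rpow_nonneg (X.p_pos j).le _) (fun j => ?_) hsum
  have h1 : ((j : ℝ) + 2) / (M + 1) ≤ X.p j := by
    rw [div_le_iff₀ (by positivity), mul_comm]
    exact (X.add_two_le_q j).trans (mul_le_mul_of_nonneg_left (X.p_mem j).1 (by positivity))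
  refine (Real.rpow_le_rpow_of_nonpos (by positivity) h1 (by linarith)).trans_eq ?_
  rw [Real.div_rpow (by positivity) (by positivity), Real.rpow_neg (by positivity : 0 ≤ M + 1),
    div_inv_eq_mul, mul_comm]

theorem exists_mem_Ioc {u : ℝ} (hu : a < u) : ∃ j, u ∈ Set.Ioc (X.q j) (X.q (j + 1)) := by
  classical
  have hex : ∃ n, u ≤ X.q n := (X.tendsto_q.eventually_ge_atTop u).exists
  have hne : Nat.find hex ≠ 0 := fun h0 => by
    have := Nat.find_spec hex
    rw [h0, X.q_zero] at this
    exact this.not_gt hu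
  obtain ⟨j, hj⟩ := Nat.exists_eq_succ_of_ne_zero hne
  exact ⟨j, not_le.1 (Nat.find_min hex (hj ▸ Nat.lt_succ_self j)), by
    have := Nat.find_spec hex
    rwa [hj] at this⟩

theorem hasSum_integral {s : ℂ}
    (hint : IntegrableOn (fun u : ℝ => (f u : ℂ) * (u : ℂ) ^ (-s)) (Set.Ioi a)) :
    HasSum (fun j => ∫ u in X.q j..X.q (j + 1), (f u : ℂ) * (u : ℂ) ^ (-s))
      (∫ u in Set.Ioi a, (f u : ℂ) * (u : ℂ) ^ (-s)) := by
  have hU : ⋃ j, Set.Ioc (X.q j) (X.q (j + 1)) = Set.Ioi a := by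
    ext u
    simp only [Set.mem_iUnion, Set.mem_Ioi]
    refine ⟨fun ⟨j, hj⟩ => (X.le_q j).trans_lt hj.1, X.exists_mem_Ioc⟩
  have h := hasSum_integral_iUnion (μ := volume) (fun j => measurableSet_Ioc)
    (X.q_mono.pairwise_disjoint_on_Ioc_succ) (f := fun u : ℝ => (f u : ℂ) * (u : ℂ) ^ (-s))
    (by simpa only [Nat.succ_eq_succ, Nat.succ_eq_add_one, hU] using hint)
  simp only [Nat.succ_eq_succ, Nat.succ_eq_add_one, hU] at h
  simpa only [intervalIntegral.integral_of_le (X.q_le_succ _)] using h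

theorem tsum_p_cpow {s : ℂ} (hs : 1 < s.re)
    (hint : IntegrableOn (fun u : ℝ => (f u : ℂ) * (u : ℂ) ^ (-s)) (Set.Ioi a)) :
    ∑' j, (X.p j : ℂ) ^ (-s) =
      X.discrepancy s + ∫ u in Set.Ioi a, (f u : ℂ) * (u : ℂ) ^ (-s) := by
  have h := (X.summable_discrepancyTerm (zero_lt_one.trans hs)).hasSum.add (X.hasSum_integral hint)
  rw [show X.discrepancy s = ∑' j, X.discrepancyTerm s j from rfl, ← h.tsum_eq]
  exact tsum_congr fun j => by simp [discrepancyTerm]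

/-- The part of `∫ u⁻ˢ f(u) du` with `u ≤ a`. -/
def initialPart (_ : DensitySampling f a M) (s : ℂ) : ℂ :=
  ∫ u in (1 : ℝ)..a, (f u : ℂ) * (u : ℂ) ^ (-s)

/-- The logarithm of the regular factor of the zeta function. -/
def logRegular (s : ℂ) : ℂ :=
  X.discrepancy s - X.initialPart s + X.toBeurlingPrimes.logZetaPowers s

theorem one_le_a (X : DensitySampling f a M) : 1 ≤ a := by linarith [X.two_le]

theorem differentiableAt_logRegular (hf : ContinuousOn f (Set.Icc 1 a)) {s : ℂ}
    (hs : 1 / 2 < s.re) : DifferentiableAt ℂ X.logRegular s := by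
  refine ((X.differentiableAt_discrepancy (by linarith)).sub ?_).add
    (X.toBeurlingPrimes.differentiableAt_logZetaPowers X.two_le_p
      (fun σ hσ => X.summable_rpow_neg hσ) hs)
  exact differentiable_integral_mul_cpow_neg one_pos X.one_le_a
    (Complex.continuous_ofReal.comp_continuousOn hf) s

theorem exists_norm_logRegular_le (hf : ContinuousOn f (Set.Icc 1 a)) {σ₀ : ℝ}
    (hσ₀ : 1 / 2 < σ₀) :
    ∃ K : ℝ, 0 ≤ K ∧ ∀ s : ℂ, σ₀ ≤ s.re →
      ‖X.logRegular s‖ ≤ K * Real.sqrt (Real.log (|s.im| + 4)) := by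
  obtain ⟨K₁, hK₁, h1⟩ := X.exists_norm_discrepancy_le hσ₀
  obtain ⟨K₂, h2⟩ := X.toBeurlingPrimes.exists_norm_logZetaPowers_le X.two_le_p
      (fun σ hσ => X.summable_rpow_neg hσ) hσ₀
  have hint : IntervalIntegrable (fun u => |f u|) volume 1 a := by
    refine ContinuousOn.intervalIntegrable ?_
    rw [Set.uIcc_of_le X.one_le_a]
    exact hf.abs
  have h3 : ∀ s : ℂ, σ₀ ≤ s.re → ‖X.initialPart s‖ ≤ ∫ u in (1 : ℝ)..a, |f u| := fun s hs => by
    refine intervalIntegral.norm_integral_le_of_norm_le X.one_le_a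
      (ae_of_all _ fun u hu => ?_) hint
    rw [norm_mul, Complex.norm_real, Real.norm_eq_abs,
      Complex.norm_cpow_eq_rpow_re_of_pos (one_pos.trans hu.1), Complex.neg_re]
    exact mul_le_of_le_one_right (abs_nonneg _)
      (Real.rpow_le_one_of_one_le_of_nonpos hu.1.le (by linarith))
  have h0 : 0 ≤ ∫ u in (1 : ℝ)..a, |f u| :=
    intervalIntegral.integral_nonneg X.one_le_a fun _ _ => abs_nonneg _
  refine ⟨K₁ + (∫ u in (1 : ℝ)..a, |f u|) + |K₂|, by positivity, fun s hs => ?_⟩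
  have hℓ1 : 1 ≤ Real.sqrt (Real.log (|s.im| + 4)) := by
    rw [Real.one_le_sqrt, Real.le_log_iff_exp_le (by positivity)]
    linarith [Real.exp_one_lt_d9, abs_nonneg s.im]
  calc ‖X.logRegular s‖ ≤ ‖X.discrepancy s‖ + ‖X.initialPart s‖ +
        ‖X.toBeurlingPrimes.logZetaPowers s‖ :=
        (norm_add_le _ _).trans (add_le_add_left (norm_sub_le _ _) _)
    _ ≤ K₁ * Real.sqrt (Real.log (|s.im| + 4)) +
        (∫ u in (1 : ℝ)..a, |f u|) * Real.sqrt (Real.log (|s.im| + 4)) +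
        |K₂| * Real.sqrt (Real.log (|s.im| + 4)) := by
        refine add_le_add (add_le_add (h1 s hs) ((h3 s hs).trans ?_))
          (((h2 s hs).trans (le_abs_self _)).trans ?_)
        · exact le_mul_of_one_le_right h0 hℓ1
        · exact le_mul_of_one_le_right (abs_nonneg _) hℓ1
    _ = _ := by ring

/-- The sum `∑ p^(-s)` is the discrepancy plus the integral from `a`. Subtracting `initialPart`
inside `logRegular` completes this to the integral from `1`, whose exponential is the rational
function. -/
theorem hasSum_norm_cpow {r : ℝ} (hr : r < 1) {S : Multiset ℂ} (hS : ∀ ρ ∈ S, ρ.re < 1)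
    (hsymm : S.map (starRingEnd ℂ) = S) (X : DensitySampling (zeroDensity r S) a M)
    {s : ℂ} (hs : 1 < s.re) :
    HasSum (fun g : X.toBeurlingPrimes.Integers => (X.toBeurlingPrimes.norm g : ℂ) ^ (-s))
      (zeroRational r S s * Complex.exp (X.logRegular s)) := by
  obtain ⟨h1, h2⟩ := zeroDensity_transform hr hS hsymm hs
  have h3 : IntegrableOn (fun u : ℝ => (zeroDensity r S u : ℂ) * (u : ℂ) ^ (-s)) (Set.Ioi a) :=
    h1.mono_set (Set.Ioi_subset_Ioi X.one_le_a)
  have h := X.toBeurlingPrimes.hasSum_norm_cpow X.two_le_p (by linarith : 1 / 2 ≤ s.re)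
    (X.summable_rpow_neg hs)
  convert h using 1
  have h4 : X.initialPart s + ∫ u in Set.Ioi a, (zeroDensity r S u : ℂ) * (u : ℂ) ^ (-s) =
      ∫ u in Set.Ioi (1 : ℝ), (zeroDensity r S u : ℂ) * (u : ℂ) ^ (-s) :=
    intervalIntegral.integral_interval_add_Ioi h1 h3
  have h5 := X.tsum_p_cpow hs h3
  change ∑' j, (X.toBeurlingPrimes.p j : ℂ) ^ (-s) = _ at h5
  rw [← h2, ← Complex.exp_add, h5, ← h4, logRegular]
  congr 1
  ring

end DensitySampling

/-! ### The formula for `ψ`. -/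

namespace BeurlingPrimes

variable (P : BeurlingPrimes)

theorem exists_index (x : ℝ) : ∃ n : ℕ, ∀ j, P.p j ≤ x ↔ j < n := by
  classical
  have hex : ∃ n, x < P.p n := (P.tendsto.eventually_gt_atTop x).exists
  refine ⟨Nat.find hex, fun j => ⟨fun hj => ?_, fun hj => not_lt.1 (Nat.find_min hex hj)⟩⟩
  by_contra! h
  exact (Nat.find_spec hex).not_ge ((P.mono h).trans hj)

theorem norm_single (j k : ℕ) : P.norm (Finsupp.single j k) = P.p j ^ k := by
  unfold norm
  exact Finsupp.prod_single_index (pow_zero _)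

theorem exists_eq_single_of_Lambda_ne_zero {g : P.Integers} (h : P.Lambda g ≠ 0) :
    ∃ j k : ℕ, 0 < k ∧ g = Finsupp.single j k := by
  by_contra hne
  exact h (dif_neg hne)

/-- Any `K` with `p₀ ^ K > x` bounds the exponents of all prime powers up to `x`, since `p₀` is the
smallest prime. -/
theorem psi_eq_sum {x : ℝ} {n K : ℕ} (hn : ∀ j, P.p j ≤ x ↔ j < n) (hK : x < P.p 0 ^ K) :
    P.psi x = ∑ j ∈ Finset.range n,
      ((Finset.Icc 1 K).filter fun k => P.p j ^ k ≤ x).card * Real.log (P.p j) := by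
  classical
  set A : Finset (ℕ × ℕ) := (Finset.range n ×ˢ Finset.Icc 1 K).filter fun i => P.p i.1 ^ i.2 ≤ x
    with hA
  have hpos : ∀ i ∈ A, 0 < i.2 := fun i hi => by
    simp only [hA, Finset.mem_filter, Finset.mem_product, Finset.mem_Icc] at hi
    omega
  have hinj : Set.InjOn (fun i : ℕ × ℕ => (Finsupp.single i.1 i.2 : ℕ →₀ ℕ)) A := by
    intro i hi i' hi' h
    rcases (Finsupp.single_eq_single_iff _ _ _ _).1 h with h | h
    · exact Prod.ext h.1 h.2
    · exact absurd h.1 (hpos i hi).ne'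
  have hset : {g : P.Integers | P.norm g ≤ x} ∩ Function.support P.Lambda =
      (↑(A.image fun i : ℕ × ℕ => (Finsupp.single i.1 i.2 : ℕ →₀ ℕ)) : Set (ℕ →₀ ℕ)) ∩
        Function.support P.Lambda := by
    ext g
    simp only [Set.mem_inter_iff, Function.mem_support, and_congr_left_iff]
    intro hg
    obtain ⟨j, k, hk, rfl⟩ := P.exists_eq_single_of_Lambda_ne_zero hg
    change P.norm _ ≤ x ↔ _
    rw [P.norm_single, Finset.coe_image, Set.mem_image]
    constructor
    · intro hle
      refine ⟨(j, k), ?_, rfl⟩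
      have h1 : P.p j ≤ x := (le_self_pow₀ (P.one_lt j).le hk.ne').trans hle
      have h2 : k < K := by
        by_contra! h
        have h3 : P.p 0 ^ K ≤ P.p j ^ k := (pow_le_pow_right₀ (P.one_lt 0).le h).trans
          (pow_le_pow_left₀ (P.p_pos 0).le (P.mono (Nat.zero_le j)) _)
        linarith
      simp only [hA, Finset.coe_filter, Finset.mem_product, Finset.mem_range, Finset.mem_Icc]
      exact ⟨⟨(hn j).1 h1, by omega, by omega⟩, hle⟩
    · rintro ⟨i, hi, h⟩
      rcases (Finsupp.single_eq_single_iff _ _ _ _).1 h with h | h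
      · rw [← h.1, ← h.2]
        exact (Finset.mem_filter.1 hi).2
      · exact absurd h.1 (hpos i hi).ne'
  unfold psi
  rw [finsum_mem_eq_sum_of_inter_support_eq _ hset, Finset.sum_image hinj,
    Finset.sum_congr rfl fun i hi => P.Lambda_single i.1 i.2 (hpos i hi), hA, Finset.sum_filter,
    Finset.sum_product]
  refine Finset.sum_congr rfl fun j _ => ?_
  rw [← Finset.sum_filter]
  simp

theorem sum_log_le_psi {x : ℝ} {n : ℕ} (hn : ∀ j, P.p j ≤ x ↔ j < n) :
    ∑ j ∈ Finset.range n, Real.log (P.p j) ≤ P.psi x := by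
  obtain ⟨K, hK⟩ := pow_unbounded_of_one_lt x (P.one_lt 0)
  have hK' : x < P.p 0 ^ (K + 1) :=
    hK.trans_le (pow_le_pow_right₀ (P.one_lt 0).le (Nat.le_succ K))
  rw [P.psi_eq_sum hn hK']
  refine Finset.sum_le_sum fun j hj => ?_
  refine le_mul_of_one_le_left (Real.log_nonneg (P.one_lt j).le) ?_
  rw [Nat.one_le_cast, Nat.one_le_iff_ne_zero, Finset.card_ne_zero]
  refine ⟨1, ?_⟩
  simp only [Finset.mem_filter, Finset.mem_Icc, pow_one]
  exact ⟨⟨le_rfl, by omega⟩, (hn j).2 (Finset.mem_range.1 hj)⟩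

/-- A prime above `√x` contributes only its first power; one below contributes at most `log x`,
having at most `log x / log p` powers up to `x`. -/
theorem psi_le {x : ℝ} (hx : 1 ≤ x) {n m : ℕ} (hn : ∀ j, P.p j ≤ x ↔ j < n)
    (hm : ∀ j, P.p j ≤ Real.sqrt x ↔ j < m) :
    P.psi x ≤ ∑ j ∈ Finset.range n, Real.log (P.p j) + m * Real.log x := by
  obtain ⟨K, hK⟩ := pow_unbounded_of_one_lt x (P.one_lt 0)
  have hlx : 0 ≤ Real.log x := Real.log_nonneg hx
  have hlog : ∀ j, 0 < Real.log (P.p j) := fun j => Real.log_pos (P.one_lt j)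
  have hterm : ∀ j, ((Finset.Icc 1 K).filter fun k => P.p j ^ k ≤ x).card * Real.log (P.p j) ≤
      Real.log (P.p j) + if j < m then Real.log x else 0 := by
    intro j
    split_ifs with hj
    · have hsub : ((Finset.Icc 1 K).filter fun k => P.p j ^ k ≤ x) ⊆
          Finset.Icc 1 ⌊Real.log x / Real.log (P.p j)⌋₊ := by
        intro k hk
        simp only [Finset.mem_filter, Finset.mem_Icc] at hk ⊢
        refine ⟨hk.1.1, Nat.le_floor ?_⟩
        rw [le_div_iff₀ (hlog j), ← Real.log_pow]
        exact Real.log_le_log (pow_pos (P.p_pos j) _) hk.2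
      have h1 : (((Finset.Icc 1 K).filter fun k => P.p j ^ k ≤ x).card : ℝ) ≤
          Real.log x / Real.log (P.p j) := by
        have h2 := Finset.card_le_card hsub
        rw [Nat.card_Icc, Nat.add_sub_cancel] at h2
        exact (Nat.cast_le.2 h2).trans (Nat.floor_le (div_nonneg hlx (hlog j).le))
      rw [le_div_iff₀ (hlog j)] at h1
      linarith [hlog j]
    · have hsub : ((Finset.Icc 1 K).filter fun k => P.p j ^ k ≤ x) ⊆ {1} := by
        intro k hk
        simp only [Finset.mem_filter, Finset.mem_Icc, Finset.mem_singleton] at hk ⊢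
        by_contra hne
        have h1 : Real.sqrt x < P.p j := not_le.1 fun h => hj ((hm j).1 h)
        have h2 : x < P.p j ^ 2 := (Real.sqrt_lt' (P.p_pos j)).1 h1
        have h3 : P.p j ^ 2 ≤ P.p j ^ k := pow_le_pow_right₀ (P.one_lt j).le (by omega)
        linarith [hk.2]
      have h1 := Finset.card_le_card hsub
      rw [Finset.card_singleton] at h1
      rw [add_zero]
      exact mul_le_of_le_one_left (hlog j).le (by exact_mod_cast h1)
  rw [P.psi_eq_sum hn hK]
  refine (Finset.sum_le_sum fun j _ => hterm j).trans ?_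
  rw [Finset.sum_add_distrib]
  refine add_le_add_right ?_ _
  rw [← Finset.sum_filter, Finset.sum_const, nsmul_eq_mul]
  refine mul_le_mul_of_nonneg_right ?_ hlx
  have : (Finset.range n).filter (fun j => j < m) ⊆ Finset.range m := fun j hj =>
    Finset.mem_range.2 (Finset.mem_filter.1 hj).2
  have h2 := Finset.card_le_card this
  rw [Finset.card_range] at h2
  exact_mod_cast h2

end BeurlingPrimes

/-- The main term `x + x^r / r - ∑ x^ρ / ρ` of `ψ(x)`. -/
def psiMain (r : ℝ) (S : Multiset ℂ) (x : ℝ) : ℂ :=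
  x + (x : ℂ) ^ (r : ℂ) / r - (S.map fun ρ => (x : ℂ) ^ ρ / ρ).sum

theorem hasDerivAt_psiMain {r : ℝ} (hr : r ≠ 0) {S : Multiset ℂ} (hS : ∀ ρ ∈ S, ρ ≠ 0)
    {x : ℝ} (hx : 0 < x) : HasDerivAt (psiMain r S) (zeroWeight r S x) x := by
  have hpow : ∀ w : ℂ, w ≠ 0 → HasDerivAt (fun u : ℝ => (u : ℂ) ^ w / w) ((x : ℂ) ^ (w - 1)) x := by
    intro w hw
    have hs : (x : ℂ) ∈ Complex.slitPlane := Complex.ofReal_mem_slitPlane.2 hx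
    have := (((hasDerivAt_id (x : ℂ)).cpow_const (c := w) hs).div_const w).comp_ofReal
    simpa [mul_div_assoc, mul_div_cancel_left₀ _ hw] using this
  have hsum : HasDerivAt (fun u : ℝ => (S.map fun ρ => (u : ℂ) ^ ρ / ρ).sum)
      (S.map fun ρ => (x : ℂ) ^ (ρ - 1)).sum x := by
    induction S using Multiset.induction with
    | empty => simpa using hasDerivAt_const x (0 : ℂ)
    | cons ρ S ih =>
      simp only [Multiset.map_cons, Multiset.sum_cons]
      exact (hpow ρ (hS ρ (Multiset.mem_cons_self _ _))).add
        (ih fun ρ' h' => hS ρ' (Multiset.mem_cons_of_mem h'))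
  exact (((hasDerivAt_id (x : ℂ)).comp_ofReal).add (hpow r (by exact_mod_cast hr))).sub hsum

theorem norm_multiset_sum_map_le {ι : Type*} (S : Multiset ι) (φ : ι → ℂ) :
    ‖(S.map φ).sum‖ ≤ (S.map fun i => ‖φ i‖).sum := by
  induction S using Multiset.induction with
  | empty => simp
  | cons i S ih =>
    simp only [Multiset.map_cons, Multiset.sum_cons]
    exact (norm_add_le _ _).trans (add_le_add_right ih _)

theorem norm_zeroWeight_le {r : ℝ} (hr : r ≤ 1) {S : Multiset ℂ} (hS : ∀ ρ ∈ S, ρ.re ≤ 1)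
    {u : ℝ} (hu : 1 ≤ u) : ‖zeroWeight r S u‖ ≤ 2 + Multiset.card S := by
  have hpow : ∀ w : ℂ, w.re ≤ 1 → ‖(u : ℂ) ^ (w - 1)‖ ≤ 1 := fun w hw => by
    rw [Complex.norm_cpow_eq_rpow_re_of_pos (by linarith)]
    exact Real.rpow_le_one_of_one_le_of_nonpos hu (by simpa using hw)
  have h1 : ‖(S.map fun ρ => (u : ℂ) ^ (ρ - 1)).sum‖ ≤ Multiset.card S := by
    refine (norm_multiset_sum_map_le _ _).trans ?_
    refine (Multiset.sum_le_card_nsmul _ 1 fun y hy => ?_).trans_eq (by simp)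
    obtain ⟨ρ, hρ, rfl⟩ := Multiset.mem_map.1 hy
    exact hpow ρ (hS ρ hρ)
  refine (norm_sub_le _ _).trans (add_le_add ((norm_add_le _ _).trans ?_) h1)
  rw [norm_one]
  linarith [hpow r (by simpa using hr)]

theorem exists_norm_psiMain_le {r : ℝ} (hr : r ≤ 1) {S : Multiset ℂ} (hS : ∀ ρ ∈ S, ρ.re ≤ 1) :
    ∃ C : ℝ, 0 ≤ C ∧ ∀ x : ℝ, 1 ≤ x → ‖psiMain r S x‖ ≤ C * x := by
  refine ⟨1 + 1 / |r| + (S.map fun ρ => 1 / ‖ρ‖).sum, ?_, fun x hx => ?_⟩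
  · have : 0 ≤ (S.map fun ρ => 1 / ‖ρ‖).sum := Multiset.sum_nonneg fun y hy => by
      obtain ⟨ρ, _, rfl⟩ := Multiset.mem_map.1 hy
      positivity
    positivity
  have hpow : ∀ w : ℂ, w.re ≤ 1 → ‖(x : ℂ) ^ w / w‖ ≤ 1 / ‖w‖ * x := fun w hw => by
    rw [norm_div, Complex.norm_cpow_eq_rpow_re_of_pos (by linarith), one_div_mul_eq_div]
    refine div_le_div_of_nonneg_right ?_ (norm_nonneg _)
    calc x ^ w.re ≤ x ^ (1 : ℝ) := Real.rpow_le_rpow_of_exponent_le hx hw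
      _ = x := Real.rpow_one x
  have h1 : ‖(S.map fun ρ => (x : ℂ) ^ ρ / ρ).sum‖ ≤ (S.map fun ρ => 1 / ‖ρ‖).sum * x := by
    refine (norm_multiset_sum_map_le _ _).trans ?_
    rw [← Multiset.sum_map_mul_right]
    exact Multiset.sum_map_le_sum_map _ _ fun ρ hρ => hpow ρ (hS ρ hρ)
  have h2 := hpow r (by simpa using hr)
  rw [Complex.norm_real, Real.norm_eq_abs] at h2
  calc ‖psiMain r S x‖ ≤ ‖(x : ℂ)‖ + ‖(x : ℂ) ^ (r : ℂ) / r‖ +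
        ‖(S.map fun ρ => (x : ℂ) ^ ρ / ρ).sum‖ :=
        (norm_sub_le _ _).trans (add_le_add_left (norm_add_le _ _) _)
    _ ≤ x + 1 / |r| * x + (S.map fun ρ => 1 / ‖ρ‖).sum * x := by
        refine add_le_add (add_le_add ?_ h2) h1
        rw [Complex.norm_real, Real.norm_of_nonneg (by linarith)]
    _ = _ := by ring

theorem log_le_two_mul_sqrt {x : ℝ} (hx : 1 ≤ x) : Real.log x ≤ 2 * Real.sqrt x := by
  have h := Real.log_le_rpow_div (show 0 ≤ x by linarith) (show (0 : ℝ) < 1 / 2 by norm_num)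
  rw [← Real.sqrt_eq_rpow] at h
  linarith

theorem intervalIntegrable_of_continuousOn_Ici {E : Type*} [NormedAddCommGroup E] {g : ℝ → E}
    {a x y : ℝ} (hg : ContinuousOn g (Set.Ici a)) (hx : a ≤ x) (hy : a ≤ y) :
    IntervalIntegrable g volume x y :=
  (hg.mono fun _ hz => (le_min hx hy).trans hz.1).intervalIntegrable

namespace DensitySampling

variable {f : ℝ → ℝ} {a M : ℝ} (X : DensitySampling f a M)

theorem continuousOn_mul_log (X : DensitySampling f a M) :
    ContinuousOn (fun u => f u * Real.log u) (Set.Ici a) :=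
  X.cont.mul (Real.continuousOn_log.mono fun u hu => by
    have : a ≤ u := hu
    exact (show 0 < u by linarith [X.two_le]).ne')

/-- Both quantities lie between the logarithms of the endpoints, the integral being an average of
total mass `1`. Summed over `j` the bound telescopes. -/
theorem abs_log_sub_integral_le (j : ℕ) :
    |Real.log (X.p j) - ∫ u in X.q j..X.q (j + 1), f u * Real.log u| ≤
      Real.log (X.q (j + 1)) - Real.log (X.q j) := by
  have hi := intervalIntegrable_of_continuousOn_Ici X.continuousOn_mul_log (X.le_q j) (X.le_q (j + 1))
  have hf := intervalIntegrable_of_continuousOn_Ici X.cont (X.le_q j) (X.le_q (j + 1))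
  have h1 := intervalIntegral.integral_mono_on (X.q_le_succ j) hi
    (hf.mul_const (Real.log (X.q (j + 1)))) fun u hu => mul_le_mul_of_nonneg_left
      (Real.log_le_log ((X.q_pos j).trans_le hu.1) hu.2) (X.pos u ((X.le_q j).trans hu.1)).le
  have h2 := intervalIntegral.integral_mono_on (X.q_le_succ j)
    (hf.mul_const (Real.log (X.q j))) hi fun u hu => mul_le_mul_of_nonneg_left
      (Real.log_le_log (X.q_pos j) hu.1) (X.pos u ((X.le_q j).trans hu.1)).le
  rw [intervalIntegral.integral_mul_const, X.integral_q, one_mul] at h1 h2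
  have h3 := Real.log_le_log (X.q_pos j) (X.p_mem j).1
  have h4 := Real.log_le_log (X.p_pos j) (X.p_mem j).2
  rw [abs_le]
  constructor <;> linarith

theorem abs_sum_log_sub_integral_le (J : ℕ) :
    |∑ j ∈ Finset.range J, Real.log (X.p j) - ∫ u in a..X.q J, f u * Real.log u| ≤
      Real.log (X.q J) := by
  have hsum : ∑ j ∈ Finset.range J, ∫ u in X.q j..X.q (j + 1), f u * Real.log u =
      ∫ u in X.q 0..X.q J, f u * Real.log u :=
    intervalIntegral.sum_integral_adjacent_intervals fun j _ =>
      intervalIntegrable_of_continuousOn_Ici X.continuousOn_mul_log (X.le_q j) (X.le_q (j + 1))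
  rw [X.q_zero] at hsum
  rw [← hsum, ← Finset.sum_sub_distrib]
  refine (Finset.abs_sum_le_sum_abs _ _).trans ((Finset.sum_le_sum fun j _ =>
    X.abs_log_sub_integral_le j).trans ?_)
  rw [Finset.sum_range_sub (fun j => Real.log (X.q j))]
  linarith [Real.log_nonneg (show 1 ≤ X.q 0 by linarith [X.two_le_q 0])]

theorem integral_mul_log_mem {i : ℕ} {x : ℝ} (h1 : X.q i ≤ x) (h2 : x ≤ X.q (i + 2)) :
    0 ≤ ∫ u in X.q i..x, f u * Real.log u ∧
      ∫ u in X.q i..x, f u * Real.log u ≤ 2 * Real.log x := by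
  have hax : a ≤ x := (X.le_q i).trans h1
  have hx1 : 1 ≤ x := X.one_le_a.trans hax
  have hf : ∀ y z, a ≤ y → a ≤ z → IntervalIntegrable f volume y z := fun y z hy hz =>
    intervalIntegrable_of_continuousOn_Ici X.cont hy hz
  constructor
  · refine intervalIntegral.integral_nonneg h1 fun u hu => ?_
    have hau := (X.le_q i).trans hu.1
    exact mul_nonneg (X.pos u hau).le (Real.log_nonneg (X.one_le_a.trans hau))
  · have h3 := intervalIntegral.integral_mono_on h1
      (intervalIntegrable_of_continuousOn_Ici X.continuousOn_mul_log (X.le_q i) hax)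
      ((hf _ _ (X.le_q i) hax).mul_const (Real.log x)) fun u hu => mul_le_mul_of_nonneg_left
        (Real.log_le_log ((X.q_pos i).trans_le hu.1) hu.2) (X.pos u ((X.le_q i).trans hu.1)).le
    rw [intervalIntegral.integral_mul_const] at h3
    refine h3.trans (mul_le_mul_of_nonneg_right ?_ (Real.log_nonneg hx1))
    have h4 : ∫ u in X.q i..x, f u ≤ ∫ u in X.q i..X.q (i + 2), f u :=
      intervalIntegral.integral_mono_interval le_rfl h1 h2
        ((ae_restrict_mem measurableSet_Ioc).mono fun u hu =>
          (X.pos u ((X.le_q i).trans hu.1.le)).le) (hf _ _ (X.le_q i) (X.le_q _))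
    rw [← intervalIntegral.integral_add_adjacent_intervals (hf _ _ (X.le_q i) (X.le_q (i + 1)))
      (hf _ _ (X.le_q (i + 1)) (X.le_q (i + 2))), X.integral_q, X.integral_q] at h4
    linarith

theorem abs_theta_sub_integral_le {x : ℝ} (hx : a ≤ x) {n : ℕ} (hn : ∀ j, X.p j ≤ x ↔ j < n) :
    |∑ j ∈ Finset.range n, Real.log (X.p j) - ∫ u in a..x, f u * Real.log u| ≤
      3 * Real.log x := by
  have hlx : 0 ≤ Real.log x := Real.log_nonneg (X.one_le_a.trans hx)
  rcases n with _ | k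
  · have h1 : x < X.p 0 := not_le.1 fun h => absurd ((hn 0).1 h) (lt_irrefl 0)
    have h2 := X.integral_mul_log_mem (i := 0) (X.q_zero.trans_le hx)
      ((h1.le.trans (X.p_mem 0).2).trans (X.q_mono (by omega)))
    rw [X.q_zero] at h2
    rw [Finset.range_zero, Finset.sum_empty, zero_sub, abs_neg, abs_of_nonneg h2.1]
    linarith [h2.2]
  -- With `p k ≤ x < p (k + 1)` one has `q k ≤ x ≤ q (k + 2)`: comparison with the integral up to `q
  -- k` leaves one prime and mass at most `2` unmatched.
  · have hpk : X.p k ≤ x := (hn k).2 (Nat.lt_succ_self k)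
    have hqk : X.q k ≤ x := (X.p_mem k).1.trans hpk
    have h1 : x < X.p (k + 1) := not_le.1 fun h => absurd ((hn (k + 1)).1 h) (lt_irrefl _)
    have h2 := X.integral_mul_log_mem hqk (h1.le.trans (X.p_mem (k + 1)).2)
    have h3 := X.abs_sum_log_sub_integral_le k
    have h4 := Real.log_le_log (X.q_pos k) hqk
    have h5 := Real.log_le_log (X.p_pos k) hpk
    have h6 : 0 ≤ Real.log (X.p k) := Real.log_nonneg (by linarith [X.two_le_p k])
    rw [← intervalIntegral.integral_add_adjacent_intervals (b := X.q k)
      (intervalIntegrable_of_continuousOn_Ici X.continuousOn_mul_log le_rfl (X.le_q k))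
      (intervalIntegrable_of_continuousOn_Ici X.continuousOn_mul_log (X.le_q k) hx),
      Finset.sum_range_succ]
    rw [abs_le] at h3 ⊢
    constructor <;> linarith [h2.1, h2.2]

theorem index_le {x : ℝ} (hx : 0 ≤ x) {n : ℕ} (hn : ∀ j, X.p j ≤ x ↔ j < n) :
    (n : ℝ) ≤ M * x + 1 := by
  have hM := X.M_pos
  rcases n with _ | k
  · simp
    positivity
  · have hqk : X.q k ≤ x := (X.p_mem k).1.trans ((hn k).2 (Nat.lt_succ_self k))
    have := X.q_lower k
    push_cast
    nlinarith [X.two_le]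

/-- Since `logKernel u * log u = 1 - 1/u`, the integrand `f log u` is `W - W/u` with `W =
zeroWeight`. The first part integrates to `psiMain`, the second is `O(log x)` because `W` is
bounded. -/
theorem exists_norm_theta_sub_psiMain_le {r : ℝ} (hr0 : 0 < r) (hr : r ≤ 1) {S : Multiset ℂ}
    (hS0 : ∀ ρ ∈ S, ρ ≠ 0) (hS : ∀ ρ ∈ S, ρ.re ≤ 1) (hsymm : S.map (starRingEnd ℂ) = S)
    (X : DensitySampling (zeroDensity r S) a M) :
    ∃ C : ℝ, 0 ≤ C ∧ ∀ (x : ℝ) (n : ℕ), 1 ≤ x → (∀ j, X.p j ≤ x ↔ j < n) →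
      ‖((∑ j ∈ Finset.range n, Real.log (X.p j) : ℝ) : ℂ) - psiMain r S x‖ ≤
        C * Real.sqrt x := by
  obtain ⟨C₁, hC₁, hmain⟩ := exists_norm_psiMain_le hr hS
  have ha0 : 0 < a := by linarith [X.two_le]
  set K : ℝ := 2 + Multiset.card S with hK
  refine ⟨max (C₁ * Real.sqrt a) (6 + ‖psiMain r S a‖ + 2 * K), by positivity,
    fun x n hx hn => ?_⟩
  have hsx : 1 ≤ Real.sqrt x := Real.one_le_sqrt.2 hx
  rcases lt_or_ge x a with hxa | hxa
  · have hn0 : n = 0 := by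
      by_contra h
      have := (hn 0).2 (Nat.pos_of_ne_zero h)
      linarith [(X.p_mem 0).1, X.le_q 0]
    rw [hn0, Finset.range_zero, Finset.sum_empty, Complex.ofReal_zero, zero_sub, norm_neg]
    refine (hmain x hx).trans ?_
    calc C₁ * x = C₁ * (Real.sqrt x * Real.sqrt x) := by rw [Real.mul_self_sqrt (by linarith)]
      _ ≤ C₁ * (Real.sqrt a * Real.sqrt x) := by gcongr
      _ = C₁ * Real.sqrt a * Real.sqrt x := by ring
      _ ≤ _ := by
        gcongr
        exact le_max_left _ _
  · have h1 := X.abs_theta_sub_integral_le hxa hn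
    have hsub : Set.Ici a ⊆ Set.Ioi 0 := fun u hu => ha0.trans_le hu
    have hcont : ContinuousOn (zeroWeight r S) (Set.Ici a) := (continuousOn_zeroWeight r S).mono hsub
    have hcont' : ContinuousOn (fun u : ℝ => (u : ℂ)⁻¹ * zeroWeight r S u) (Set.Ici a) := by
      refine ContinuousOn.mul (fun u hu => ContinuousAt.continuousWithinAt ?_) hcont
      have hu0 : (u : ℂ) ≠ 0 := by exact_mod_cast (hsub hu).ne'
      fun_prop (disch := assumption)
    have hW : ∫ u in a..x, zeroWeight r S u = psiMain r S x - psiMain r S a := by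
      refine intervalIntegral.integral_eq_sub_of_hasDerivAt (fun u hu => ?_)
        (intervalIntegrable_of_continuousOn_Ici hcont le_rfl hxa)
      rw [Set.uIcc_of_le hxa] at hu
      exact hasDerivAt_psiMain hr0.ne' hS0 (ha0.trans_le hu.1)
    have h0 : (0 : ℝ) ∉ Set.uIcc a x := by
      rw [Set.uIcc_of_le hxa]
      exact fun h => by linarith [h.1]
    have hWi : ‖∫ u in a..x, (u : ℂ)⁻¹ * zeroWeight r S u‖ ≤ K * Real.log x := by
      have hb : ‖∫ u in a..x, (u : ℂ)⁻¹ * zeroWeight r S u‖ ≤ ∫ u in a..x, K * u⁻¹ := by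
        refine intervalIntegral.norm_integral_le_of_norm_le hxa (ae_of_all _ fun u hu => ?_)
          ((intervalIntegral.intervalIntegrable_inv (fun u hu h => h0 (h ▸ hu))
            continuousOn_id).const_mul _)
        have hu0 : 0 < u := ha0.trans hu.1
        rw [norm_mul, norm_inv, Complex.norm_real, Real.norm_of_nonneg hu0.le, mul_comm]
        exact mul_le_mul_of_nonneg_right (norm_zeroWeight_le hr hS (X.one_le_a.trans hu.1.le))
          (inv_nonneg.2 hu0.le)
      rw [intervalIntegral.integral_const_mul, integral_inv h0,
        Real.log_div (by linarith) ha0.ne'] at hb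
      have hK0 : 0 ≤ K := by positivity
      nlinarith [Real.log_nonneg X.one_le_a]
    have hint : ((∫ u in a..x, zeroDensity r S u * Real.log u : ℝ) : ℂ) =
        (∫ u in a..x, zeroWeight r S u) - ∫ u in a..x, (u : ℂ)⁻¹ * zeroWeight r S u := by
      rw [← intervalIntegral.integral_ofReal, ← intervalIntegral.integral_sub
        (intervalIntegrable_of_continuousOn_Ici hcont le_rfl hxa)
        (intervalIntegrable_of_continuousOn_Ici hcont' le_rfl hxa)]
      refine intervalIntegral.integral_congr fun u hu => ?_
      rw [Set.uIcc_of_le hxa] at hu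
      have hu0 : 0 < u := ha0.trans_le hu.1
      have h2 : zeroDensity r S u * Real.log u = (1 - u⁻¹) * (zeroWeight r S u).re := by
        rw [zeroDensity, ← logKernel_mul_log hu0]
        ring
      simp only [h2]
      rw [Complex.ofReal_mul, ofReal_re_zeroWeight r hsymm hu0]
      push_cast
      ring
    have h2 : ‖((∑ j ∈ Finset.range n, Real.log (X.p j) : ℝ) : ℂ) -
        ((∫ u in a..x, zeroDensity r S u * Real.log u : ℝ) : ℂ)‖ ≤ 3 * Real.log x := by
      rw [← Complex.ofReal_sub, Complex.norm_real]
      exact h1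
    have h3 : ((∑ j ∈ Finset.range n, Real.log (X.p j) : ℝ) : ℂ) - psiMain r S x =
        (((∑ j ∈ Finset.range n, Real.log (X.p j) : ℝ) : ℂ) -
        ((∫ u in a..x, zeroDensity r S u * Real.log u : ℝ) : ℂ)) - psiMain r S a -
        ∫ u in a..x, (u : ℂ)⁻¹ * zeroWeight r S u := by
      rw [hint, hW]
      ring
    have hlog := log_le_two_mul_sqrt hx
    rw [h3]
    calc _ ≤ 3 * Real.log x + ‖psiMain r S a‖ + K * Real.log x :=
          (norm_sub_le _ _).trans (add_le_add ((norm_sub_le _ _).trans (add_le_add_left h2 _)) hWi)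
      _ ≤ 3 * (2 * Real.sqrt x) + ‖psiMain r S a‖ * Real.sqrt x + K * (2 * Real.sqrt x) := by
          gcongr
          exact le_mul_of_one_le_right (norm_nonneg _) hsx
      _ = (6 + ‖psiMain r S a‖ + 2 * K) * Real.sqrt x := by ring
      _ ≤ _ := by
          gcongr
          exact le_max_right _ _

/-- The prime number formula for primes sampled from `zeroDensity`. -/
theorem exists_norm_psi_sub_psiMain_le {r : ℝ} (hr0 : 0 < r) (hr : r ≤ 1) {S : Multiset ℂ}
    (hS0 : ∀ ρ ∈ S, ρ ≠ 0) (hS : ∀ ρ ∈ S, ρ.re ≤ 1) (hsymm : S.map (starRingEnd ℂ) = S)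
    (X : DensitySampling (zeroDensity r S) a M) :
    ∃ C : ℝ, 0 ≤ C ∧ ∀ x : ℝ, 1 ≤ x →
      ‖(X.toBeurlingPrimes.psi x : ℂ) - psiMain r S x‖ ≤ C * Real.sqrt x := by
  obtain ⟨C₁, hC₁, hmain⟩ := exists_norm_psiMain_le hr hS
  obtain ⟨C₂, hC₂, hθ⟩ := exists_norm_theta_sub_psiMain_le hr0 hr hS0 hS hsymm X
  have hM := X.M_pos
  refine ⟨C₂ + ((M + 1) * 6 + 3 * (C₁ + C₂)), by positivity, fun x hx => ?_⟩
  have hx0 : 0 < x := by linarith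
  have hsx : 1 ≤ Real.sqrt x := Real.one_le_sqrt.2 hx
  have hlx : 0 ≤ Real.log x := Real.log_nonneg hx
  obtain ⟨n, hn⟩ := X.toBeurlingPrimes.exists_index x
  obtain ⟨m, hm⟩ := X.toBeurlingPrimes.exists_index (Real.sqrt x)
  -- The linear bound for the number `m` of primes up to `√x` would lose a logarithm in `m * log x`.
  -- Primes between `x^(1/3)` and `√x` satisfy `log x ≤ 3 log p`, so they are paid for by the bound
  -- for `∑ log p` up to `√x`; those below `x^(1/3)` are few enough for the linear bound.
  obtain ⟨k, hk⟩ := X.toBeurlingPrimes.exists_index (x ^ (1 / 3 : ℝ))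
  have hlow := X.toBeurlingPrimes.sum_log_le_psi hn
  have hup := X.toBeurlingPrimes.psi_le hx hn hm
  have hx3 : 1 ≤ x ^ (1 / 3 : ℝ) := Real.one_le_rpow hx (by norm_num)
  have hkb : (k : ℝ) * Real.log x ≤ (M + 1) * 6 * Real.sqrt x := by
    have h1 : (k : ℝ) ≤ (M + 1) * x ^ (1 / 3 : ℝ) := by
      linarith [X.index_le (by linarith : 0 ≤ x ^ (1 / 3 : ℝ)) hk]
    have h2 := Real.log_le_rpow_div hx0.le (show (0 : ℝ) < 1 / 6 by norm_num)
    calc (k : ℝ) * Real.log x ≤ (M + 1) * x ^ (1 / 3 : ℝ) * (x ^ (1 / 6 : ℝ) / (1 / 6)) :=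
          mul_le_mul h1 h2 hlx (by positivity)
      _ = (M + 1) * 6 * (x ^ (1 / 3 : ℝ) * x ^ (1 / 6 : ℝ)) := by ring
      _ = (M + 1) * 6 * Real.sqrt x := by
          rw [← Real.rpow_add hx0, Real.sqrt_eq_rpow]
          norm_num
  have hθm : ∑ j ∈ Finset.range m, Real.log (X.p j) ≤ (C₁ + C₂) * Real.sqrt x := by
    have h1 := hθ (Real.sqrt x) m hsx hm
    have h2 := hmain (Real.sqrt x) hsx
    have h3 : Real.sqrt (Real.sqrt x) ≤ Real.sqrt x := Real.sqrt_le_self_iff.2 (Or.inr hsx)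
    have h4 : ‖((∑ j ∈ Finset.range m, Real.log (X.p j) : ℝ) : ℂ)‖ ≤
        C₂ * Real.sqrt x + C₁ * Real.sqrt x :=
      (norm_le_norm_sub_add _ (psiMain r S (Real.sqrt x))).trans
        (add_le_add (h1.trans (mul_le_mul_of_nonneg_left h3 hC₂)) h2)
    rw [Complex.norm_real] at h4
    linarith [(Real.le_norm_self _).trans h4]
  have hmb : (m : ℝ) * Real.log x ≤ ((M + 1) * 6 + 3 * (C₁ + C₂)) * Real.sqrt x := by
    have h1 : ∑ j ∈ Finset.range m, Real.log x ≤ ∑ j ∈ Finset.range m,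
        ((if j < k then Real.log x else 0) + 3 * Real.log (X.p j)) := by
      refine Finset.sum_le_sum fun j _ => ?_
      have h6 : 0 ≤ Real.log (X.p j) := Real.log_nonneg (by linarith [X.two_le_p j])
      split_ifs with hj
      · linarith
      · have h2 : x ^ (1 / 3 : ℝ) < X.p j := not_le.1 fun h => hj ((hk j).1 h)
        have h3 := Real.log_le_log (by positivity) h2.le
        rw [Real.log_rpow hx0] at h3
        linarith
    rw [Finset.sum_const, Finset.card_range, nsmul_eq_mul, Finset.sum_add_distrib,
      ← Finset.mul_sum, ← Finset.sum_filter, Finset.sum_const, nsmul_eq_mul] at h1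
    have h2 : (((Finset.range m).filter fun j => j < k).card : ℝ) ≤ k := by
      have : (Finset.range m).filter (fun j => j < k) ⊆ Finset.range k := fun j hj =>
        Finset.mem_range.2 (Finset.mem_filter.1 hj).2
      have h2 := Finset.card_le_card this
      rw [Finset.card_range] at h2
      exact_mod_cast h2
    have h3 := mul_le_mul_of_nonneg_right h2 hlx
    linarith
  have h1 := hθ x n hx hn
  have h2 : ‖(X.toBeurlingPrimes.psi x : ℂ) -
      ((∑ j ∈ Finset.range n, Real.log (X.p j) : ℝ) : ℂ)‖ ≤
      ((M + 1) * 6 + 3 * (C₁ + C₂)) * Real.sqrt x := by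
    rw [← Complex.ofReal_sub, Complex.norm_real, Real.norm_eq_abs, abs_le]
    change ∑ j ∈ Finset.range n, Real.log (X.p j) ≤ _ at hlow
    change _ ≤ ∑ j ∈ Finset.range n, Real.log (X.p j) + _ at hup
    constructor <;> nlinarith [mul_nonneg (Nat.cast_nonneg m : (0 : ℝ) ≤ m) hlx]
  rw [add_mul]
  refine (norm_sub_le_norm_sub_add_norm_sub _ _ _).trans ((add_le_add h2 h1).trans_eq (add_comm _ _))

end DensitySampling

/-! ### The integrated counting function and its Mellin transform. -/

theorem hasMellin_indicator_Ioi_cpow {c : ℝ} (hc : 0 < c) {b s : ℂ} (hs : s.re + b.re < 0) :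
    HasMellin ((Set.Ioi c).indicator fun t : ℝ => (t : ℂ) ^ b) s (-(c : ℂ) ^ (s + b) / (s + b)) := by
  have hsub : Set.Ioi c ⊆ Set.Ioi 0 := Set.Ioi_subset_Ioi hc.le
  have heq : ∀ t : ℝ, (t : ℂ) ^ (s - 1) • (Set.Ioi c).indicator (fun t : ℝ => (t : ℂ) ^ b) t =
      (Set.Ioi c).indicator (fun t : ℝ => (t : ℂ) ^ (s + b - 1)) t := fun t => by
    by_cases ht : t ∈ Set.Ioi c
    · rw [Set.indicator_of_mem ht, Set.indicator_of_mem ht, smul_eq_mul,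
        ← Complex.cpow_add _ _ (by exact_mod_cast (hsub ht).ne')]
      congr 1
      ring
    · rw [Set.indicator_of_notMem ht, Set.indicator_of_notMem ht, smul_zero]
  have hre : (s + b - 1).re < -1 := by
    simp
    linarith
  constructor
  · unfold MellinConvergent
    simp_rw [heq]
    rw [IntegrableOn, integrable_indicator_iff measurableSet_Ioi]
    exact (integrableOn_Ioi_cpow_of_lt hre hc).mono_measure Measure.restrict_le_self
  · unfold mellin
    simp_rw [heq]
    rw [setIntegral_indicator measurableSet_Ioi, Set.inter_eq_self_of_subset_right hsub,
      integral_Ioi_cpow_of_lt hre hc, sub_add_cancel]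

theorem ofReal_max_sub_zero (c t : ℝ) : ((max (t - c) 0 : ℝ) : ℂ) =
    (Set.Ioi c).indicator (fun t : ℝ => (t : ℂ) ^ (1 : ℂ)) t -
      (c : ℂ) • (Set.Ioi c).indicator (fun t : ℝ => (t : ℂ) ^ (0 : ℂ)) t := by
  by_cases ht : t ∈ Set.Ioi c
  · have : c < t := ht
    rw [Set.indicator_of_mem ht, Set.indicator_of_mem ht, max_eq_left (by linarith)]
    simp
  · have : t ≤ c := not_lt.1 ht
    rw [Set.indicator_of_notMem ht, Set.indicator_of_notMem ht, max_eq_right (by linarith)]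
    simp

theorem hasMellin_max_sub_zero {c : ℝ} (hc : 0 < c) {w : ℂ} (hw : 0 < w.re) :
    HasMellin (fun t : ℝ => ((max (t - c) 0 : ℝ) : ℂ)) (-(w + 1))
      ((c : ℂ) ^ (-w) / (w * (w + 1))) := by
  have h1 := hasMellin_indicator_Ioi_cpow hc (b := 1) (s := -(w + 1)) (by simpa using hw)
  have h2 := hasMellin_indicator_Ioi_cpow hc (b := 0) (s := -(w + 1)) (by simp; linarith)
  have h3 := hasMellin_const_smul h2.1 (c : ℂ)
  have h4 := hasMellin_sub h1.1 h3.1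
  have hw0 : w ≠ 0 := fun h => by simp [h] at hw
  have hw1 : w + 1 ≠ 0 := fun h => by
    have := congrArg Complex.re h
    simp at this
    linarith
  have hc0 : (c : ℂ) ≠ 0 := by exact_mod_cast hc.ne'
  simp_rw [ofReal_max_sub_zero c]
  refine ⟨h4.1, h4.2.trans ?_⟩
  rw [h1.2, h3.2, h2.2]
  have e1 : -(w + 1) + 1 = -w := by ring
  have e2 : (c : ℂ) ^ (-(w + 1) + 0) = (c : ℂ) ^ (-w) / c := by
    rw [show -(w + 1) + 0 = -w - 1 by ring, Complex.cpow_sub _ _ hc0, Complex.cpow_one]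
  rw [e1, e2, smul_eq_mul, add_zero, neg_div_neg_eq, neg_div_neg_eq]
  field_simp
  ring

namespace BeurlingPrimes

variable (P : BeurlingPrimes)

/-- The integrated counting function `∫₀ˣ N = ∑ (x - |g|)₊`. -/
def NInt (x : ℝ) : ℝ := ∑' g : P.Integers, max (x - P.norm g) 0

theorem NInt_eq_sum {x y : ℝ} (hxy : x ≤ y) :
    P.NInt x = ∑ g ∈ (P.finite_norm_le y).toFinset, max (x - P.norm g) 0 := by
  refine tsum_eq_sum fun g hg => max_eq_right ?_
  rw [Set.Finite.mem_toFinset] at hg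
  have : y < P.norm g := not_le.1 hg
  linarith

theorem N_eq_card (x : ℝ) : P.N x = (P.finite_norm_le x).toFinset.card :=
  Set.ncard_eq_toFinset_card _ _

theorem continuous_NInt : Continuous P.NInt := by
  refine continuous_iff_continuousAt.2 fun x => ?_
  have h : ContinuousAt (fun t => ∑ g ∈ (P.finite_norm_le (x + 1)).toFinset,
      max (t - P.norm g) 0) x := by fun_prop
  refine h.congr ?_
  filter_upwards [eventually_le_nhds (lt_add_one x)] with t ht using (P.NInt_eq_sum ht).symm

theorem NInt_of_le_one {x : ℝ} (hx : x ≤ 1) : P.NInt x = 0 := by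
  unfold NInt
  have h : ∀ g : P.Integers, max (x - P.norm g) 0 = 0 := fun g =>
    max_eq_right (by linarith [P.one_le_norm g])
  simp_rw [h, tsum_zero]

/-- Monotonicity of `N` in integrated form; with its companion for the upper bound it recovers `N`
from differences of `NInt`. -/
theorem mul_N_le_NInt_sub (x : ℝ) {h : ℝ} (hh : 0 ≤ h) :
    h * P.N x ≤ P.NInt (x + h) - P.NInt x := by
  rw [P.NInt_eq_sum le_rfl, P.NInt_eq_sum (show x ≤ x + h by linarith), ← Finset.sum_sub_distrib,
    N_eq_card]
  calc h * ((P.finite_norm_le x).toFinset.card : ℝ) =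
        ∑ g ∈ (P.finite_norm_le x).toFinset, h := by simp [mul_comm]
    _ ≤ ∑ g ∈ (P.finite_norm_le x).toFinset,
        (max (x + h - P.norm g) 0 - max (x - P.norm g) 0) := by
        refine Finset.sum_le_sum fun g hg => ?_
        have hg' : P.norm g ≤ x := by simpa using hg
        rw [max_eq_left (by linarith), max_eq_left (by linarith)]
        linarith
    _ ≤ _ := by
        refine Finset.sum_le_sum_of_subset_of_nonneg (fun g hg => ?_) fun g _ _ => ?_
        · have hg' : P.norm g ≤ x := by simpa using hg
          simpa using hg'.trans (by linarith)
        · exact sub_nonneg.2 (max_le_max (by linarith) le_rfl)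

theorem NInt_sub_le_mul_N (x : ℝ) {h : ℝ} (hh : 0 ≤ h) :
    P.NInt (x + h) - P.NInt x ≤ h * P.N (x + h) := by
  rw [P.NInt_eq_sum le_rfl, P.NInt_eq_sum (show x ≤ x + h by linarith), ← Finset.sum_sub_distrib,
    N_eq_card]
  calc _ ≤ ∑ g ∈ (P.finite_norm_le (x + h)).toFinset, h := by
        refine Finset.sum_le_sum fun g _ => ?_
        rw [sub_le_iff_le_add]
        refine max_le ?_ (add_nonneg hh (le_max_right _ _))
        linarith [le_max_left (x - P.norm g) 0]
    _ = _ := by simp [mul_comm]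

theorem summable_norm_rpow {σ : ℝ}
    (h : Summable fun g : P.Integers => (P.norm g : ℂ) ^ (-(σ : ℂ))) :
    Summable fun g : P.Integers => P.norm g ^ (-σ) :=
  (summable_norm_iff.2 h).congr fun g => by
    rw [Complex.norm_cpow_eq_rpow_re_of_pos (P.norm_pos g)]
    simp

/-- Rankin's trick: `(x - |g|)₊ ≤ x * (x / |g|)^σ`. -/
theorem NInt_le {σ x : ℝ} (hσ : 0 ≤ σ) (hx : 0 < x)
    (h : Summable fun g : P.Integers => P.norm g ^ (-σ)) :
    P.NInt x ≤ (∑' g : P.Integers, P.norm g ^ (-σ)) * x ^ (1 + σ) := by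
  rw [← tsum_mul_right]
  refine Summable.tsum_le_tsum (fun g => ?_) ?_ (h.mul_right _)
  · have hg := P.norm_pos g
    rcases le_or_gt x (P.norm g) with hxg | hxg
    · rw [max_eq_right (by linarith)]
      positivity
    · rw [max_eq_left (by linarith), Real.rpow_add hx, Real.rpow_one, Real.rpow_neg hg.le]
      have h1 : 1 ≤ (P.norm g ^ σ)⁻¹ * x ^ σ := by
        rw [inv_mul_eq_div, one_le_div (by positivity)]
        exact Real.rpow_le_rpow hg.le hxg.le hσ
      nlinarith
  · refine summable_of_ne_finset_zero (s := (P.finite_norm_le x).toFinset) fun g hg =>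
      max_eq_right ?_
    rw [Set.Finite.mem_toFinset] at hg
    have : x < P.norm g := not_le.1 hg
    linarith

theorem isBigO_nhds_zero_of_eq_zero {F : ℝ → ℂ} (hF : ∀ x, x ≤ 1 → F x = 0) (b : ℝ) :
    F =O[𝓝[>] 0] fun u : ℝ => u ^ (-b) :=
  IsBigO.of_bound 0 (((eventually_le_nhds zero_lt_one).filter_mono nhdsWithin_le_nhds).mono
    fun u hu => by simp [hF u hu])

/-- Each `g` contributes `|g|^(-w) / (w (w + 1))`, and absolute convergence of `ζ` permits summation
under the integral. Integrating `N` once gives a continuous function and the extra factor `1 / (w +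
1)` that makes the inversion integral absolutely convergent. -/
theorem hasMellin_NInt {Z : ℂ → ℂ}
    (hZ : ∀ s : ℂ, 1 < s.re → HasSum (fun g : P.Integers => (P.norm g : ℂ) ^ (-s)) (Z s))
    {w : ℂ} (hw : 1 < w.re) :
    HasMellin (fun x => (P.NInt x : ℂ)) (-(w + 1)) (Z w / (w * (w + 1))) := by
  have hsum : ∀ σ : ℝ, 1 < σ → Summable fun g : P.Integers => P.norm g ^ (-σ) := fun σ hσ =>
    P.summable_norm_rpow (hZ σ (by simpa using hσ)).summable
  constructor
  · obtain ⟨σ, hσ, hσw⟩ := exists_between hw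
    refine mellinConvergent_of_isBigO_rpow (a := -(1 + σ)) (b := -(w.re + 2))
      ((Complex.continuous_ofReal.comp P.continuous_NInt).locallyIntegrable.locallyIntegrableOn _)
      (IsBigO.of_bound (∑' g : P.Integers, P.norm g ^ (-σ)) ?_) (by simpa using hσw)
      (isBigO_nhds_zero_of_eq_zero (fun x hx => by simp [P.NInt_of_le_one hx]) _)
      (by simp)
    filter_upwards [eventually_gt_atTop 0] with x hx
    have h0 : 0 ≤ P.NInt x := tsum_nonneg fun g => le_max_right _ _
    rw [Complex.norm_real, Real.norm_of_nonneg h0, neg_neg,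
      Real.norm_of_nonneg (Real.rpow_nonneg hx.le _)]
    exact P.NInt_le (by linarith) hx (hsum σ hσ)
  · set F : P.Integers → ℝ → ℂ := fun g t =>
      (t : ℂ) ^ (-(w + 1) - 1) • ((max (t - P.norm g) 0 : ℝ) : ℂ) with hF
    have hw0 : 0 < w.re := by linarith
    have hm := fun g => hasMellin_max_sub_zero (P.norm_pos g) hw0
    have hbound : ∀ g, ∫ t in Set.Ioi (0 : ℝ), ‖F g t‖ ≤ P.norm g ^ (-w.re) * (1 / w.re) := by
      intro g
      have hg := P.norm_pos g
      have h1 : ∀ t ∈ Set.Ioi (0 : ℝ), ‖F g t‖ ≤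
          (Set.Ioi (P.norm g)).indicator (fun t : ℝ => t ^ (-w.re - 1)) t := by
        intro t ht
        have ht0 : (0 : ℝ) < t := ht
        rw [hF]
        simp only
        rw [norm_smul, Complex.norm_cpow_eq_rpow_re_of_pos ht0, Complex.norm_real,
          Real.norm_of_nonneg (le_max_right _ _)]
        by_cases htg : t ∈ Set.Ioi (P.norm g)
        · have htg' : P.norm g < t := htg
          rw [Set.indicator_of_mem htg, max_eq_left (by linarith)]
          have : t ^ (-w.re - 1) = t ^ (-(w + 1) - 1).re * t := by
            rw [← Real.rpow_add_one ht0.ne']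
            congr 1
            simp
            ring
          rw [this]
          exact mul_le_mul_of_nonneg_left (by linarith) (Real.rpow_nonneg ht0.le _)
        · have htg' : t ≤ P.norm g := not_lt.1 htg
          rw [Set.indicator_of_notMem htg, max_eq_right (by linarith), mul_zero]
      have hint : IntegrableOn (fun t : ℝ => t ^ (-w.re - 1)) (Set.Ioi (P.norm g)) :=
        integrableOn_Ioi_rpow_of_lt (by linarith) hg
      refine (setIntegral_mono_on (hm g).1.norm
        (((integrable_indicator_iff measurableSet_Ioi).2 hint).integrableOn)
        measurableSet_Ioi h1).trans_eq ?_
      rw [setIntegral_indicator measurableSet_Ioi,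
        Set.inter_eq_self_of_subset_right (Set.Ioi_subset_Ioi hg.le),
        integral_Ioi_rpow_of_lt (by linarith) hg, sub_add_cancel, neg_div_neg_eq]
      ring
    have hS : Summable fun g => ∫ t in Set.Ioi (0 : ℝ), ‖F g t‖ :=
      Summable.of_nonneg_of_le (fun g => integral_nonneg fun _ => norm_nonneg _) hbound
        ((hsum _ hw).mul_right _)
    have h := hasSum_integral_of_summable_integral_norm (fun g => (hm g).1) hS
    have h' : HasSum (fun g => ∫ t in Set.Ioi (0 : ℝ), F g t) (Z w / (w * (w + 1))) := by
      have heq : (fun g => ∫ t in Set.Ioi (0 : ℝ), F g t) =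
          fun g => (P.norm g : ℂ) ^ (-w) / (w * (w + 1)) := funext fun g => (hm g).2
      rw [heq]
      exact (hZ w hw).div_const _
    rw [← h.unique h']
    refine setIntegral_congr_fun measurableSet_Ioi fun t _ => ?_
    change _ = ∑' g, (t : ℂ) ^ (-(w + 1) - 1) • ((max (t - P.norm g) 0 : ℝ) : ℂ)
    rw [tsum_const_smul'', ← Complex.ofReal_tsum]
    rfl

end BeurlingPrimes

/-! ### Mellin inversion and the shift of the line of integration. -/

theorem integrable_one_add_abs_rpow {b : ℝ} (hb : 1 < b) :
    Integrable fun t : ℝ => (1 + |t|) ^ (-b) := by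
  simpa using integrable_one_add_norm (E := ℝ) (μ := volume) (r := b) (by simpa using hb)

theorem integrable_of_norm_le_one_add_abs_rpow {φ : ℝ → ℂ} (hφ : Continuous φ) {C b : ℝ}
    (hb : 1 < b) (h : ∀ t, ‖φ t‖ ≤ C * (1 + |t|) ^ (-b)) : Integrable φ :=
  Integrable.mono' ((integrable_one_add_abs_rpow hb).const_mul C) hφ.aestronglyMeasurable
    (ae_of_all _ h)

theorem continuous_vertical {g : ℂ → ℂ} {σ : ℝ} (hd : ∀ s : ℂ, s.re = σ → DifferentiableAt ℂ g s) :
    Continuous fun t : ℝ => g (σ + t * Complex.I) := by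
  refine continuous_iff_continuousAt.2 fun t => ?_
  have h1 : ContinuousAt g (σ + t * Complex.I) := (hd _ (by simp)).continuousAt
  exact ContinuousAt.comp (f := fun t : ℝ => (σ : ℂ) + t * Complex.I) h1 (by fun_prop)

/-- Vertical lines of integration may be moved through a strip of holomorphy where the integrand
decays. -/
theorem integral_vertical_eq {g : ℂ → ℂ} {σ₁ σ₂ C b : ℝ} (hσ : σ₁ ≤ σ₂) (hb : 1 < b)
    (hd : ∀ s : ℂ, σ₁ ≤ s.re → s.re ≤ σ₂ → DifferentiableAt ℂ g s)
    (hg : ∀ s : ℂ, σ₁ ≤ s.re → s.re ≤ σ₂ → ‖g s‖ ≤ C * (1 + |s.im|) ^ (-b)) :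
    ∫ t : ℝ, g (σ₁ + t * Complex.I) = ∫ t : ℝ, g (σ₂ + t * Complex.I) := by
  have hint : ∀ σ : ℝ, σ₁ ≤ σ → σ ≤ σ₂ → Integrable fun t : ℝ => g (σ + t * Complex.I) :=
    fun σ h1 h2 => integrable_of_norm_le_one_add_abs_rpow
      (continuous_vertical fun s hs => hd s (by rwa [hs]) (by rwa [hs])) hb fun t => by
        simpa using hg (σ + t * Complex.I) (by simpa using h1) (by simpa using h2)
  have hlim : ∀ σ : ℝ, σ₁ ≤ σ → σ ≤ σ₂ →
      Tendsto (fun T : ℝ => ∫ t in (-T)..T, g (σ + t * Complex.I)) atTop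
        (𝓝 (∫ t : ℝ, g (σ + t * Complex.I))) := fun σ h1 h2 =>
    intervalIntegral_tendsto_integral (hint σ h1 h2) tendsto_neg_atTop_atBot tendsto_id
  have hdecay : Tendsto (fun T : ℝ => C * (1 + |T|) ^ (-b) * |σ₂ - σ₁|) atTop (𝓝 0) := by
    have h1 : Tendsto (fun T : ℝ => 1 + |T|) atTop atTop :=
      tendsto_atTop_add_const_left _ _ tendsto_abs_atTop_atTop
    have h2 := (tendsto_rpow_neg_atTop (by linarith : 0 < b)).comp h1
    simpa using (h2.const_mul C).mul_const |σ₂ - σ₁|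
  have hhor : ∀ ε : ℝ, |ε| = 1 → Tendsto (fun T : ℝ => ∫ x in σ₁..σ₂,
      g (x + (ε * T : ℝ) * Complex.I)) atTop (𝓝 0) := fun ε hε => by
    refine squeeze_zero_norm (fun T => ?_) hdecay
    refine intervalIntegral.norm_integral_le_of_norm_le_const fun x hx => ?_
    rw [Set.uIoc_of_le hσ] at hx
    have := hg (x + (ε * T : ℝ) * Complex.I) (by simpa using hx.1.le) (by simpa using hx.2)
    have him : ((x : ℂ) + (ε * T : ℝ) * Complex.I).im = ε * T := by simp
    rwa [him, abs_mul, hε, one_mul] at this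
  have hrect : ∀ T : ℝ, (∫ x in σ₁..σ₂, g (x + ((-1) * T : ℝ) * Complex.I)) -
      (∫ x in σ₁..σ₂, g (x + (1 * T : ℝ) * Complex.I)) +
      Complex.I • (∫ t in (-T)..T, g (σ₂ + t * Complex.I)) -
      Complex.I • (∫ t in (-T)..T, g (σ₁ + t * Complex.I)) = 0 := fun T => by
    have h := Complex.integral_boundary_rect_eq_zero_of_differentiableOn g
      (⟨σ₁, -T⟩ : ℂ) (⟨σ₂, T⟩ : ℂ) fun s hs => by
        have hre : s.re ∈ Set.uIcc σ₁ σ₂ := hs.1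
        rw [Set.uIcc_of_le hσ] at hre
        exact (hd s hre.1 hre.2).differentiableWithinAt
    simpa only [neg_mul, one_mul] using h
  have h1 := (((hhor (-1) (by simp)).sub (hhor 1 (by simp))).add
    ((hlim σ₂ hσ le_rfl).const_smul Complex.I)).sub ((hlim σ₁ le_rfl hσ).const_smul Complex.I)
  simp_rw [hrect] at h1
  have h2 := tendsto_nhds_unique h1 tendsto_const_nhds
  rw [sub_zero, zero_add, sub_eq_zero, smul_right_inj Complex.I_ne_zero] at h2
  exact h2.symm

/-- The function `x^(a+1) - 1` on `x > 1`, extended by `0`. -/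
def truncPow (a : ℂ) (x : ℝ) : ℂ :=
  (Set.Ioi 1).indicator (fun t : ℝ => (t : ℂ) ^ (a + 1)) x -
    (Set.Ioi 1).indicator (fun t : ℝ => (t : ℂ) ^ (0 : ℂ)) x

theorem truncPow_of_one_lt (a : ℂ) {x : ℝ} (hx : 1 < x) : truncPow a x = (x : ℂ) ^ (a + 1) - 1 := by
  have : x ∈ Set.Ioi (1 : ℝ) := hx
  simp [truncPow, Set.indicator_of_mem this]

theorem continuousAt_truncPow (a : ℂ) {x : ℝ} (hx : 1 < x) : ContinuousAt (truncPow a) x := by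
  have hs : (x : ℂ) ∈ Complex.slitPlane := Complex.ofReal_mem_slitPlane.2 (by linarith)
  have h : ContinuousAt (fun t : ℝ => (t : ℂ) ^ (a + 1) - 1) x := by
    fun_prop (disch := assumption)
  refine h.congr ?_
  filter_upwards [eventually_gt_nhds hx] with t ht using (truncPow_of_one_lt a ht).symm

theorem hasMellin_truncPow {a w : ℂ} (h0 : 0 < w.re) (ha : a.re < w.re) :
    HasMellin (truncPow a) (-(w + 1)) (1 / (w - a) - 1 / (w + 1)) := by
  have h1 := hasMellin_indicator_Ioi_cpow one_pos (b := a + 1) (s := -(w + 1))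
    (by simp; linarith)
  have h2 := hasMellin_indicator_Ioi_cpow one_pos (b := 0) (s := -(w + 1)) (by simp; linarith)
  have h3 := hasMellin_sub h1.1 h2.1
  refine ⟨h3.1, h3.2.trans ?_⟩
  rw [h1.2, h2.2, Complex.ofReal_one, Complex.one_cpow, Complex.one_cpow,
    show -(w + 1) + (a + 1) = -(w - a) by ring, add_zero, neg_div_neg_eq, neg_div_neg_eq]

theorem one_add_abs_im_le {w : ℂ} (hw : 0 ≤ w.re) : 1 + |w.im| ≤ 2 * ‖w + 1‖ := by
  have h1 := Complex.abs_im_le_norm (w + 1)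
  have h2 := (le_abs_self _).trans (Complex.abs_re_le_norm (w + 1))
  simp at h1 h2
  linarith

theorem norm_cpow_sub_cpow_le_mul {y h : ℝ} (hy : 0 < y) (hh : 0 ≤ h) {w : ℂ} (hw : 0 ≤ w.re) :
    ‖((y + h : ℝ) : ℂ) ^ (w + 1) - (y : ℂ) ^ (w + 1)‖ ≤ ‖w + 1‖ * (h * (y + h) ^ w.re) := by
  refine (norm_cpow_sub_cpow_le hy (by linarith) (w + 1)).trans
    (mul_le_mul_of_nonneg_left ?_ (norm_nonneg _))
  have h1 : (w + 1).re - 1 = w.re := by simp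
  rw [h1]
  have h2 := intervalIntegral.integral_mono_on (μ := volume) (show y ≤ y + h by linarith)
    (continuousOn_rpow_const_uIcc hy (by linarith) w.re).intervalIntegrable
    (intervalIntegrable_const (c := (y + h) ^ w.re)) fun v hv =>
      Real.rpow_le_rpow (hy.le.trans hv.1) hv.2 hw
  simpa using h2

namespace BeurlingPrimes

variable (P : BeurlingPrimes)

/-- `∫₀ˣ N` minus the contributions of the poles of the zeta function. -/
def NIntError (κ : ℝ) (c : ℂ) (r x : ℝ) : ℂ :=
  P.NInt x - (κ / 2 : ℂ) • truncPow 1 x - (c / (r + 1)) • truncPow r x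

section Tauberian

variable {P} {Z E : ℂ → ℂ} {κ r σ₀ ε C : ℝ} {c : ℂ}

/-- The transform of `truncPow a` is `(a + 1) / ((w - a) (w + 1))`, so the coefficients `κ / 2` and
`c / (r + 1)` remove exactly the terms `κ / (w - 1)` and `c / (w - r)`. -/
theorem hasMellin_NIntError
    (hZ : ∀ s : ℂ, 1 < s.re → HasSum (fun g : P.Integers => (P.norm g : ℂ) ^ (-s)) (Z s))
    (hr : 0 ≤ r) (hr1 : r < 1)
    (hE : ∀ s : ℂ, 1 < s.re → E s = Z s / s - κ / (s - 1) - c / (s - r))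
    {w : ℂ} (hw : 1 < w.re) :
    HasMellin (P.NIntError κ c r) (-(w + 1)) (E w / (w + 1)) := by
  have h1 := P.hasMellin_NInt hZ hw
  have h2 := hasMellin_truncPow (a := 1) (w := w) (by linarith) (by simpa using hw)
  have h3 := hasMellin_truncPow (a := r) (w := w) (by linarith) (by simpa using hr1.trans hw)
  have h4 := hasMellin_const_smul h2.1 (κ / 2 : ℂ)
  have h5 := hasMellin_const_smul h3.1 (c / (r + 1))
  have h6 := hasMellin_sub h1.1 h4.1
  have h7 := hasMellin_sub h6.1 h5.1
  refine ⟨h7.1, h7.2.trans ?_⟩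
  rw [h6.2, h1.2, h4.2, h5.2, h2.2, h3.2, hE w hw]
  have hne : ∀ a : ℝ, a < w.re → w - a ≠ 0 := fun a ha h => by
    have := congrArg Complex.re h
    simp at this
    linarith
  have e1 : w ≠ 0 := by simpa using hne 0 (by linarith)
  have e2 : w - 1 ≠ 0 := by simpa using hne 1 hw
  have e3 : w - r ≠ 0 := hne r (by linarith)
  have e4 : w + 1 ≠ 0 := by simpa using hne (-1) (by linarith)
  have e5 : (r : ℂ) + 1 ≠ 0 := by
    have : (r : ℝ) + 1 ≠ 0 := by linarith
    exact_mod_cast this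
  simp only [smul_eq_mul]
  field_simp
  ring

/-- Invert on `Re w = 2`, where the series converges, and move the line to `σ₀`. The quotient `E w /
(w + 1)` decays like `(1 + |t|)^(ε - 2)`, which suffices for both. -/
theorem NIntError_eq_integral
    (hZ : ∀ s : ℂ, 1 < s.re → HasSum (fun g : P.Integers => (P.norm g : ℂ) ^ (-s)) (Z s))
    (hr : 0 ≤ r) (hr1 : r < 1)
    (hE : ∀ s : ℂ, 1 < s.re → E s = Z s / s - κ / (s - 1) - c / (s - r))
    (hσ₀ : 0 < σ₀) (hσ₀2 : σ₀ ≤ 2) (hε : ε < 1) (hC : 0 ≤ C)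
    (hEd : ∀ s : ℂ, σ₀ ≤ s.re → DifferentiableAt ℂ E s)
    (hEb : ∀ s : ℂ, σ₀ ≤ s.re → s.re ≤ 2 → ‖E s‖ ≤ C * (1 + |s.im|) ^ (ε - 1))
    {x : ℝ} (hx : 1 < x) :
    (Integrable fun t : ℝ => E (σ₀ + t * Complex.I) / (σ₀ + t * Complex.I + 1) *
      (x : ℂ) ^ (σ₀ + t * Complex.I + 1)) ∧
    P.NIntError κ c r x = (1 / (2 * Real.pi) : ℝ) •
      ∫ t : ℝ, E (σ₀ + t * Complex.I) / (σ₀ + t * Complex.I + 1) *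
        (x : ℂ) ^ (σ₀ + t * Complex.I + 1) := by
  have hx0 : 0 < x := by linarith
  have hxc : (x : ℂ) ≠ 0 := by exact_mod_cast hx0.ne'
  set g : ℂ → ℂ := fun w => E w / (w + 1) * (x : ℂ) ^ (w + 1) with hg
  have hw1 : ∀ s : ℂ, σ₀ ≤ s.re → s + 1 ≠ 0 := fun s hs h => by
    have := congrArg Complex.re h
    simp at this
    linarith
  have hEb' : ∀ s : ℂ, σ₀ ≤ s.re → s.re ≤ 2 →
      ‖E s / (s + 1)‖ ≤ (2 * C) * (1 + |s.im|) ^ (-(2 - ε)) := fun s h1 h2 => by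
    have h3 := one_add_abs_im_le (w := s) (by linarith)
    have h4 : 0 < 1 + |s.im| := by positivity
    rw [norm_div, div_le_iff₀ (norm_pos_iff.2 (hw1 s h1))]
    have h5 : (1 + |s.im|) ^ (ε - 1) = (1 + |s.im|) ^ (-(2 - ε)) * (1 + |s.im|) := by
      rw [← Real.rpow_add_one h4.ne']
      congr 1
      ring
    calc ‖E s‖ ≤ C * (1 + |s.im|) ^ (ε - 1) := hEb s h1 h2
      _ = C * (1 + |s.im|) ^ (-(2 - ε)) * (1 + |s.im|) := by rw [h5]; ring
      _ ≤ C * (1 + |s.im|) ^ (-(2 - ε)) * (2 * ‖s + 1‖) :=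
          mul_le_mul_of_nonneg_left h3 (by positivity)
      _ = _ := by ring
  have hd0 : ∀ s : ℂ, σ₀ ≤ s.re → DifferentiableAt ℂ (fun w => E w / (w + 1)) s := fun s hs =>
    (hEd s hs).div (by fun_prop) (hw1 s hs)
  have hd : ∀ s : ℂ, σ₀ ≤ s.re → DifferentiableAt ℂ g s := fun s hs =>
    (hd0 s hs).mul ((differentiableAt_id.add_const 1).const_cpow (Or.inl hxc))
  have hb : ∀ s : ℂ, σ₀ ≤ s.re → s.re ≤ 2 →
      ‖g s‖ ≤ (2 * C * x ^ (3 : ℝ)) * (1 + |s.im|) ^ (-(2 - ε)) := fun s h1 h2 => by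
    rw [hg]
    simp only
    rw [norm_mul, Complex.norm_cpow_eq_rpow_re_of_pos hx0]
    have h3 : x ^ (s + 1).re ≤ x ^ (3 : ℝ) :=
      Real.rpow_le_rpow_of_exponent_le hx.le (by simp; linarith)
    calc _ ≤ (2 * C) * (1 + |s.im|) ^ (-(2 - ε)) * x ^ (3 : ℝ) :=
          mul_le_mul (hEb' s h1 h2) h3 (Real.rpow_nonneg hx0.le _) (by positivity)
      _ = _ := by ring
  refine ⟨integrable_of_norm_le_one_add_abs_rpow (C := 2 * C * x ^ (3 : ℝ))
    (continuous_vertical fun s hs => hd s (by rw [hs])) (by linarith : 1 < 2 - ε)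
    fun t => ?_, ?_⟩
  · have h := hb (σ₀ + t * Complex.I) (by simp) (by simpa using hσ₀2)
    rwa [show ((σ₀ : ℂ) + t * Complex.I).im = t by simp] at h
  change _ = (1 / (2 * Real.pi) : ℝ) • ∫ t : ℝ, g (σ₀ + t * Complex.I)
  rw [integral_vertical_eq hσ₀2 (by linarith : 1 < 2 - ε) (fun s h1 _ => hd s h1) hb]
  -- The Mellin variable is `-(w + 1)`, so the line `Re w = 2` becomes `Re = -3`, traversed
  -- backwards.
  have hmel : ∀ y : ℝ, mellin (P.NIntError κ c r) ((-3 : ℝ) + y * Complex.I) =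
      E ((2 : ℝ) + (-y : ℝ) * Complex.I) / ((2 : ℝ) + (-y : ℝ) * Complex.I + 1) := fun y => by
    have h := (hasMellin_NIntError hZ hr hr1 hE (w := (2 : ℝ) + (-y : ℝ) * Complex.I)
      (by simp)).2
    rw [← h]
    congr 1
    push_cast
    ring
  have hconv : MellinConvergent (P.NIntError κ c r) ((-3 : ℝ) : ℂ) := by
    have h := (hasMellin_NIntError hZ hr hr1 hE (w := 2) (by simp)).1
    convert h using 1
    push_cast
    ring
  have hvert : Complex.VerticalIntegrable (mellin (P.NIntError κ c r)) (-3) := by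
    unfold Complex.VerticalIntegrable
    simp_rw [hmel]
    refine Integrable.comp_neg (f := fun y : ℝ => E ((2 : ℝ) + (y : ℝ) * Complex.I) /
      ((2 : ℝ) + (y : ℝ) * Complex.I + 1)) ?_
    exact integrable_of_norm_le_one_add_abs_rpow
      (continuous_vertical fun s hs => hd0 s (by rw [hs]; exact hσ₀2)) (by linarith : 1 < 2 - ε)
      fun t => by simpa using hEb' ((2 : ℝ) + t * Complex.I) (by simpa using hσ₀2) (by simp)
  have hcont : ContinuousAt (P.NIntError κ c r) x := by
    have h1 : ContinuousAt (fun x => (P.NInt x : ℂ)) x :=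
      (Complex.continuous_ofReal.comp P.continuous_NInt).continuousAt
    have h2 : ContinuousAt (fun x => (κ / 2 : ℂ) • truncPow 1 x) x :=
      continuousAt_const.fun_smul (continuousAt_truncPow 1 hx)
    have h3 : ContinuousAt (fun x => (c / (r + 1)) • truncPow r x) x :=
      continuousAt_const.fun_smul (continuousAt_truncPow r hx)
    exact (h1.sub h2).sub h3
  rw [← mellinInv_mellin_eq (-3) _ hx0 hconv hvert hcont, mellinInv]
  congr 1
  rw [← integral_neg_eq_self]
  refine integral_congr_ae (ae_of_all _ fun t => ?_)
  simp only [hmel, hg, smul_eq_mul]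
  have e : -(((-3 : ℝ) : ℂ) + ((-t : ℝ) : ℂ) * Complex.I) = (2 : ℝ) + t * Complex.I + 1 := by
    push_cast
    ring
  rw [e, neg_neg, mul_comm]

end Tauberian

end BeurlingPrimes

/-! ### The Tauberian step: from integrated to plain counting. -/

namespace BeurlingPrimes

section Tauberian

variable {P : BeurlingPrimes} {Z E : ℂ → ℂ} {κ r σ₀ ε C : ℝ} {c : ℂ}

/-- There are two bounds: `A = h (2y)^(Re w)` from the derivative, and `A * B` with `B = 8 (y/h) /
(1 + |Im w|)` from the triangle inequality. Their minimum is at most `A * B^(2ε)`, since `0 < 2ε ≤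
1`. -/
theorem norm_cpow_sub_cpow_div_le (hε : 0 < ε) (hε2 : 2 * ε ≤ 1) {y h : ℝ} (hy : 0 < y)
    (hh : 0 < h) (hhy : h ≤ y) {w : ℂ} (hw : 0 ≤ w.re) :
    ‖((y + h : ℝ) : ℂ) ^ (w + 1) - (y : ℂ) ^ (w + 1)‖ / ‖w + 1‖ ≤
      h * (2 * y) ^ w.re * ((8 * (y / h)) ^ (2 * ε) * (1 + |w.im|) ^ (-(2 * ε))) := by
  have h0 : 0 < 1 + |w.im| := by positivity
  have h1 := one_add_abs_im_le hw
  have hw1 : 0 < ‖w + 1‖ := by linarith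
  set A := h * (2 * y) ^ w.re with hA
  have hA0 : 0 ≤ A := by positivity
  set B := 8 * (y / h) / (1 + |w.im|) with hB
  have hB0 : 0 ≤ B := by positivity
  have hyh : (y + h) ^ w.re ≤ (2 * y) ^ w.re := Real.rpow_le_rpow (by positivity) (by linarith) hw
  have hQA : ‖((y + h : ℝ) : ℂ) ^ (w + 1) - (y : ℂ) ^ (w + 1)‖ / ‖w + 1‖ ≤ A := by
    rw [div_le_iff₀ hw1, mul_comm]
    refine (norm_cpow_sub_cpow_le_mul hy hh.le hw).trans ?_
    rw [hA]
    gcongr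
  have hQB : ‖((y + h : ℝ) : ℂ) ^ (w + 1) - (y : ℂ) ^ (w + 1)‖ / ‖w + 1‖ ≤ A * B := by
    have h2 : ‖((y + h : ℝ) : ℂ) ^ (w + 1) - (y : ℂ) ^ (w + 1)‖ ≤ 2 * ((2 * y) ^ w.re * (2 * y)) := by
      refine (norm_sub_le _ _).trans ?_
      rw [Complex.norm_cpow_eq_rpow_re_of_pos (by positivity), Complex.norm_cpow_eq_rpow_re_of_pos hy,
        Complex.add_re, Complex.one_re, ← Real.rpow_add_one (by positivity)]
      have h3 : (y + h) ^ (w.re + 1) ≤ (2 * y) ^ (w.re + 1) :=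
        Real.rpow_le_rpow (by positivity) (by linarith) (by linarith)
      have h4 : y ^ (w.re + 1) ≤ (2 * y) ^ (w.re + 1) :=
        Real.rpow_le_rpow (by positivity) (by linarith) (by linarith)
      linarith
    rw [div_le_iff₀ hw1]
    refine h2.trans ?_
    have h5 : A * B * ‖w + 1‖ = 2 * ((2 * y) ^ w.re * (2 * y)) * (2 * ‖w + 1‖ / (1 + |w.im|)) := by
      rw [hA, hB]
      field_simp
      ring
    rw [h5]
    refine le_mul_of_one_le_right (by positivity) ?_
    rwa [one_le_div h0]
  have hBe : B ^ (2 * ε) = (8 * (y / h)) ^ (2 * ε) * (1 + |w.im|) ^ (-(2 * ε)) := by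
    rw [hB, Real.div_rpow (by positivity) h0.le, Real.rpow_neg h0.le, div_eq_mul_inv]
  rw [← hBe]
  rcases le_total B 1 with hB1 | hB1
  · refine hQB.trans (mul_le_mul_of_nonneg_left ?_ hA0)
    rcases hB0.eq_or_lt with hB00 | hB00
    · rw [← hB00]
      exact Real.rpow_nonneg le_rfl _
    · calc B = B ^ (1 : ℝ) := (Real.rpow_one B).symm
        _ ≤ B ^ (2 * ε) := Real.rpow_le_rpow_of_exponent_ge hB00 hB1 hε2
  · refine hQA.trans (le_mul_of_one_le_right hA0 ?_)
    exact Real.one_le_rpow hB1 (by linarith)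

/-- The interpolated factor `(1 + |t|)^(-2ε)` turns the decay `(1 + |t|)^(ε - 1)` of `E` into the
integrable `(1 + |t|)^(-(1 + ε))`, while the gain of `h` costs only `(y/h)^(2ε)`. -/
theorem exists_norm_NIntError_sub_le
    (hZ : ∀ s : ℂ, 1 < s.re → HasSum (fun g : P.Integers => (P.norm g : ℂ) ^ (-s)) (Z s))
    (hr : 0 ≤ r) (hr1 : r < 1)
    (hE : ∀ s : ℂ, 1 < s.re → E s = Z s / s - κ / (s - 1) - c / (s - r))
    (hσ₀ : 0 < σ₀) (hσ₀2 : σ₀ ≤ 2) (hε : 0 < ε) (hε2 : 2 * ε ≤ 1) (hC : 0 ≤ C)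
    (hEd : ∀ s : ℂ, σ₀ ≤ s.re → DifferentiableAt ℂ E s)
    (hEb : ∀ s : ℂ, σ₀ ≤ s.re → s.re ≤ 2 → ‖E s‖ ≤ C * (1 + |s.im|) ^ (ε - 1)) :
    ∃ K : ℝ, 0 ≤ K ∧ ∀ y h : ℝ, 1 < y → 0 < h → h ≤ y →
      ‖P.NIntError κ c r (y + h) - P.NIntError κ c r y‖ ≤
        K * (h * (y ^ σ₀ * (y / h) ^ (2 * ε))) := by
  set I := ∫ t : ℝ, (1 + |t|) ^ (-(1 + ε)) with hI
  have hI0 : 0 ≤ I := integral_nonneg fun t => by positivity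
  refine ⟨(1 / (2 * Real.pi)) * (C * (2 ^ σ₀ * 8 ^ (2 * ε)) * I), by positivity,
    fun y h hy hh hhy => ?_⟩
  have hy0 : 0 < y := by linarith
  obtain ⟨hi1, he1⟩ := NIntError_eq_integral hZ hr hr1 hE hσ₀ hσ₀2 (by linarith) hC hEd hEb
    (show 1 < y + h by linarith)
  obtain ⟨hi2, he2⟩ := NIntError_eq_integral hZ hr hr1 hE hσ₀ hσ₀2 (by linarith) hC hEd hEb hy
  rw [he1, he2, ← smul_sub, ← integral_sub hi1 hi2, norm_smul,
    Real.norm_of_nonneg (by positivity : 0 ≤ 1 / (2 * Real.pi)), mul_assoc]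
  refine mul_le_mul_of_nonneg_left ?_ (by positivity)
  set D := C * (h * (2 * y) ^ σ₀ * (8 * (y / h)) ^ (2 * ε)) with hD
  have hpt : ∀ t : ℝ, ‖E (σ₀ + t * Complex.I) / (σ₀ + t * Complex.I + 1) *
      ((y + h : ℝ) : ℂ) ^ (σ₀ + t * Complex.I + 1) - E (σ₀ + t * Complex.I) /
      (σ₀ + t * Complex.I + 1) * (y : ℂ) ^ (σ₀ + t * Complex.I + 1)‖ ≤
      D * (1 + |t|) ^ (-(1 + ε)) := fun t => by
    set w : ℂ := σ₀ + t * Complex.I with hw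
    have hwre : w.re = σ₀ := by simp [hw]
    have hwim : w.im = t := by simp [hw]
    have h1 := norm_cpow_sub_cpow_div_le hε hε2 hy0 hh hhy (w := w) (by rw [hwre]; exact hσ₀.le)
    have h2 := hEb w hwre.ge (by rw [hwre]; exact hσ₀2)
    rw [hwre, hwim] at h1
    rw [hwim] at h2
    rw [← mul_sub, norm_mul, norm_div, div_mul_eq_mul_div, mul_div_assoc]
    have h3 : 0 < 1 + |t| := by positivity
    calc _ ≤ (C * (1 + |t|) ^ (ε - 1)) *
          (h * (2 * y) ^ σ₀ * ((8 * (y / h)) ^ (2 * ε) * (1 + |t|) ^ (-(2 * ε)))) :=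
          mul_le_mul h2 h1 (by positivity) (by positivity)
      _ = D * ((1 + |t|) ^ (ε - 1) * (1 + |t|) ^ (-(2 * ε))) := by
          rw [hD]
          ring
      _ = D * (1 + |t|) ^ (-(1 + ε)) := by
          rw [← Real.rpow_add h3]
          congr 2
          ring
  refine (norm_integral_le_of_norm_le ((integrable_one_add_abs_rpow
    (by linarith : 1 < 1 + ε)).const_mul D) (ae_of_all _ hpt)).trans_eq ?_
  rw [integral_const_mul, ← hI, hD, Real.mul_rpow (by norm_num) hy0.le,
    Real.mul_rpow (by norm_num) (by positivity)]
  ring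

theorem N_mono {x y : ℝ} (hxy : x ≤ y) : P.N x ≤ P.N y :=
  Set.ncard_le_ncard (fun _ hg => le_trans hg hxy) (P.finite_norm_le y)

theorem exists_abs_NInt_sub_le
    (hZ : ∀ s : ℂ, 1 < s.re → HasSum (fun g : P.Integers => (P.norm g : ℂ) ^ (-s)) (Z s))
    (hκ : 0 ≤ κ) (hr : 0 ≤ r) (hr1 : r < 1)
    (hE : ∀ s : ℂ, 1 < s.re → E s = Z s / s - κ / (s - 1) - c / (s - r))
    (hσ₀ : 0 < σ₀) (hσ₀2 : σ₀ ≤ 2) (hε : 0 < ε) (hε2 : 2 * ε ≤ 1) (hC : 0 ≤ C)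
    (hEd : ∀ s : ℂ, σ₀ ≤ s.re → DifferentiableAt ℂ E s)
    (hEb : ∀ s : ℂ, σ₀ ≤ s.re → s.re ≤ 2 → ‖E s‖ ≤ C * (1 + |s.im|) ^ (ε - 1)) :
    ∃ K : ℝ, 0 ≤ K ∧ ∀ y h : ℝ, 1 < y → 0 < h → h ≤ y →
      |P.NInt (y + h) - P.NInt y - κ * h * y| ≤
        h * (κ / 2 * h + ‖c‖ * (2 * y) ^ r + K * (y ^ σ₀ * (y / h) ^ (2 * ε))) := by
  obtain ⟨K, hK, hKb⟩ := exists_norm_NIntError_sub_le hZ hr hr1 hE hσ₀ hσ₀2 hε hε2 hC hEd hEb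
  refine ⟨K, hK, fun y h hy hh hhy => ?_⟩
  have h1 := hKb y h hy hh hhy
  have hpow := norm_cpow_sub_cpow_le_mul (show 0 < y by linarith) hh.le (w := (r : ℂ))
    (by simpa using hr)
  have hr10 : (r : ℂ) + 1 ≠ 0 := by
    have : (r : ℝ) + 1 ≠ 0 := by linarith
    exact_mod_cast this
  have heq : ((P.NInt (y + h) - P.NInt y - κ * h * y : ℝ) : ℂ) =
      (P.NIntError κ c r (y + h) - P.NIntError κ c r y) + ((κ / 2 * h ^ 2 : ℝ) : ℂ) +
      c / (r + 1) * (((y + h : ℝ) : ℂ) ^ ((r : ℂ) + 1) - (y : ℂ) ^ ((r : ℂ) + 1)) := by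
    simp only [NIntError, truncPow_of_one_lt _ hy, truncPow_of_one_lt _ (show 1 < y + h by linarith)]
    have e : ∀ x : ℝ, (x : ℂ) ^ ((1 : ℂ) + 1) = (x : ℂ) ^ 2 := fun x => by
      rw [one_add_one_eq_two, Complex.cpow_ofNat]
    rw [e, e]
    push_cast
    simp only [smul_eq_mul]
    ring
  have h2 : ‖c / (r + 1) * (((y + h : ℝ) : ℂ) ^ ((r : ℂ) + 1) - (y : ℂ) ^ ((r : ℂ) + 1))‖ ≤
      h * (‖c‖ * (2 * y) ^ r) := by
    rw [norm_mul, norm_div]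
    have h3 : 0 < ‖(r : ℂ) + 1‖ := norm_pos_iff.2 hr10
    have h4 : (y + h) ^ r ≤ (2 * y) ^ r := Real.rpow_le_rpow (by linarith) (by linarith) hr
    rw [Complex.ofReal_re] at hpow
    calc _ ≤ ‖c‖ / ‖(r : ℂ) + 1‖ * (‖(r : ℂ) + 1‖ * (h * (y + h) ^ r)) := by gcongr
      _ = ‖c‖ * (h * (y + h) ^ r) := by field_simp
      _ ≤ ‖c‖ * (h * (2 * y) ^ r) := by gcongr
      _ = _ := by ring
  rw [← Real.norm_eq_abs, ← Complex.norm_real, heq]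
  refine (norm_add₃_le).trans ?_
  rw [Complex.norm_real, Real.norm_of_nonneg (by positivity : 0 ≤ κ / 2 * h ^ 2)]
  calc _ ≤ K * (h * (y ^ σ₀ * (y / h) ^ (2 * ε))) + κ / 2 * h ^ 2 + h * (‖c‖ * (2 * y) ^ r) := by
        gcongr
    _ = _ := by ring

/-- The Tauberian step: holomorphy of the zeta function and its slow growth to the right of `σ₀`
give a power saving in the counting function. -/
theorem exists_abs_N_sub_le
    (hZ : ∀ s : ℂ, 1 < s.re → HasSum (fun g : P.Integers => (P.norm g : ℂ) ^ (-s)) (Z s))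
    (hκ : 0 ≤ κ) (hr : 0 ≤ r) (hr1 : r < 1)
    (hE : ∀ s : ℂ, 1 < s.re → E s = Z s / s - κ / (s - 1) - c / (s - r))
    (hσ₀ : 0 < σ₀) (hσ₀2 : σ₀ ≤ 2) (hε : 0 < ε) (hε2 : 2 * ε ≤ 1) (hC : 0 ≤ C)
    (hEd : ∀ s : ℂ, σ₀ ≤ s.re → DifferentiableAt ℂ E s)
    (hEb : ∀ s : ℂ, σ₀ ≤ s.re → s.re ≤ 2 → ‖E s‖ ≤ C * (1 + |s.im|) ^ (ε - 1))
    {τ : ℝ} (hτ : 1 / 2 ≤ τ) (hrτ : r ≤ τ) (hστ : σ₀ + ε ≤ τ) :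
    ∃ A : ℝ, ∀ x : ℝ, 1 ≤ x → |(P.N x : ℝ) - κ * (x - 1)| ≤ A * x ^ τ := by
  obtain ⟨K, hK, hKb⟩ := exists_abs_NInt_sub_le hZ hκ hr hr1 hE hσ₀ hσ₀2 hε hε2 hC hEd hEb
  set A := κ / 2 + 2 * ‖c‖ + K with hA
  have hA0 : 0 ≤ A := by positivity
  refine ⟨max (A + 2 * κ) (P.N 4 + 3 * κ), fun x hx => ?_⟩
  have hx0 : 0 < x := by linarith
  have hxτ : 1 ≤ x ^ τ := Real.one_le_rpow hx (by linarith)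
  rcases le_or_gt x 4 with hx4 | hx4
  · have h1 : (P.N x : ℝ) ≤ P.N 4 := by exact_mod_cast N_mono hx4
    have h2 : |(P.N x : ℝ) - κ * (x - 1)| ≤ P.N 4 + 3 * κ := by
      rw [abs_le]
      constructor <;> nlinarith [(Nat.cast_nonneg (P.N x) : (0 : ℝ) ≤ P.N x)]
    calc _ ≤ _ := h2
      _ ≤ (P.N 4 + 3 * κ) * x ^ τ := le_mul_of_one_le_right (by positivity) hxτ
      _ ≤ _ := by
        gcongr
        exact le_max_right _ _
  -- With this step the error `κ h / 2` is admissible as `τ ≥ 1/2`, and `(x/h)^(2ε) = x^ε`. The case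
  -- `x > 4` ensures `2h ≤ x`, so that the window starting at `x - h` is also allowed.
  · set h := Real.sqrt x with hh
    have hsq : h * h = x := Real.mul_self_sqrt hx0.le
    have hh2 : 2 < h := by
      rw [hh, Real.lt_sqrt (by norm_num)]
      linarith
    have hhτ : h ≤ x ^ τ := by
      rw [hh, Real.sqrt_eq_rpow]
      exact Real.rpow_le_rpow_of_exponent_le hx hτ
    have hpow : (x / h) ^ (2 * ε) = x ^ ε := by
      have : x / h = x ^ (1 / 2 : ℝ) := by
        rw [← Real.sqrt_eq_rpow, ← hh, div_eq_iff (by linarith), hsq]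
      rw [this, ← Real.rpow_mul hx0.le]
      congr 1
      ring
    have hmain : ∀ y, 1 < y → h ≤ y → y ≤ x →
        |P.NInt (y + h) - P.NInt y - κ * h * y| ≤ h * (A * x ^ τ) := fun y h1 h2 h3 => by
      refine (hKb y h h1 (by linarith) h2).trans (mul_le_mul_of_nonneg_left ?_ (by linarith))
      have h4 : (2 * y) ^ r ≤ 2 * x ^ τ := by
        rw [Real.mul_rpow (by norm_num) (by linarith)]
        refine mul_le_mul ?_ ?_ (Real.rpow_nonneg (by linarith) _) (by norm_num)
        · calc (2 : ℝ) ^ r ≤ 2 ^ (1 : ℝ) :=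
                Real.rpow_le_rpow_of_exponent_le (by norm_num) hr1.le
            _ = 2 := Real.rpow_one 2
        · exact (Real.rpow_le_rpow (by linarith) h3 hr).trans
            (Real.rpow_le_rpow_of_exponent_le hx hrτ)
      have h5 : y ^ σ₀ * (y / h) ^ (2 * ε) ≤ x ^ τ := by
        calc _ ≤ x ^ σ₀ * (x / h) ^ (2 * ε) := by gcongr
          _ = x ^ (σ₀ + ε) := by rw [hpow, Real.rpow_add hx0]
          _ ≤ x ^ τ := Real.rpow_le_rpow_of_exponent_le hx hστ
      calc κ / 2 * h + ‖c‖ * (2 * y) ^ r + K * (y ^ σ₀ * (y / h) ^ (2 * ε))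
          ≤ κ / 2 * x ^ τ + ‖c‖ * (2 * x ^ τ) + K * x ^ τ := by gcongr
        _ = A * x ^ τ := by rw [hA]; ring
    have hhx : h * 2 ≤ x := by nlinarith
    -- The window `[x, x + h]` bounds `N x` from above, the window `[x - h, x]` from below.
    have hu := hmain x (by linarith) (by linarith) le_rfl
    have hl := hmain (x - h) (by linarith) (by linarith) (by linarith)
    have hu' := P.mul_N_le_NInt_sub x (show 0 ≤ h by linarith)
    have hl' := P.NInt_sub_le_mul_N (x - h) (show 0 ≤ h by linarith)
    rw [sub_add_cancel] at hl hl'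
    rw [abs_le] at hu hl
    have hup : (P.N x : ℝ) ≤ κ * x + A * x ^ τ := by
      refine le_of_mul_le_mul_left ?_ (show 0 < h by linarith)
      linarith [hu.2]
    have hlo : κ * (x - h) - A * x ^ τ ≤ P.N x := by
      refine le_of_mul_le_mul_left ?_ (show 0 < h by linarith)
      linarith [hl.1]
    have hfin : |(P.N x : ℝ) - κ * (x - 1)| ≤ (A + 2 * κ) * x ^ τ := by
      have h6 := mul_le_mul_of_nonneg_left hhτ hκ
      have h7 := mul_le_mul_of_nonneg_left hxτ hκ
      have h8 : 0 ≤ κ * x ^ τ := by positivity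
      rw [abs_le]
      constructor <;> linarith
    refine hfin.trans ?_
    gcongr
    exact le_max_left _ _

end Tauberian

end BeurlingPrimes

/-! ### Zeros, poles and residue of the zeta function. -/

/-- The finite Blaschke-like product `∏ (s - ρ) / (s - ρ + 1)`. -/
def zeroProd (S : Multiset ℂ) (s : ℂ) : ℂ := (S.map fun ρ => (s - ρ) / (s - ρ + 1)).prod

/-- The poles of the compensating factors have real part below `0`, outside the half-plane of
interest. -/
theorem sub_add_one_ne_zero {s ρ : ℂ} (hs : 1 / 2 < s.re) (hρ : ρ.re < 1) : s - ρ + 1 ≠ 0 :=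
  fun h => by
    have := congrArg Complex.re h
    simp at this
    linarith

theorem zeroProd_cons (ρ : ℂ) (S : Multiset ℂ) (s : ℂ) :
    zeroProd (ρ ::ₘ S) s = (s - ρ) / (s - ρ + 1) * zeroProd S s := by
  simp [zeroProd]

theorem analyticAt_sub_div {s ρ : ℂ} (h : s - ρ + 1 ≠ 0) :
    AnalyticAt ℂ (fun z : ℂ => (z - ρ) / (z - ρ + 1)) s := by
  fun_prop (disch := assumption)

theorem analyticOrderAt_sub_div {s ρ : ℂ} (h : s - ρ + 1 ≠ 0) :
    analyticOrderAt (fun z : ℂ => (z - ρ) / (z - ρ + 1)) s = if s = ρ then 1 else 0 := by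
  split_ifs with hsρ
  · have h1 : ((1 : ℕ) : ℕ∞) = 1 := rfl
    rw [← h1, (analyticAt_sub_div h).analyticOrderAt_eq_natCast]
    refine ⟨fun z => 1 / (z - ρ + 1), by fun_prop (disch := assumption),
      one_div_ne_zero h, Eventually.of_forall fun z => ?_⟩
    rw [hsρ, pow_one, smul_eq_mul, mul_one_div]
  · rw [(analyticAt_sub_div h).analyticOrderAt_eq_zero]
    exact div_ne_zero (sub_ne_zero.2 hsρ) h

theorem analyticAt_zeroProd {S : Multiset ℂ} (hS : ∀ ρ ∈ S, ρ.re < 1) {s : ℂ} (hs : 1 / 2 < s.re) :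
    AnalyticAt ℂ (zeroProd S) s := by
  induction S using Multiset.induction with
  | empty => exact analyticAt_const
  | cons ρ S ih =>
    have h1 := ih fun ρ' h' => hS ρ' (Multiset.mem_cons_of_mem h')
    have h2 := analyticAt_sub_div (sub_add_one_ne_zero hs (hS ρ (Multiset.mem_cons_self _ _)))
    exact (h2.mul h1).congr (Eventually.of_forall fun z => (zeroProd_cons ρ S z).symm)

theorem analyticOrderAt_zeroProd {S : Multiset ℂ} (hS : ∀ ρ ∈ S, ρ.re < 1) {s : ℂ}
    (hs : 1 / 2 < s.re) : analyticOrderAt (zeroProd S) s = S.count s := by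
  induction S using Multiset.induction with
  | empty =>
    rw [(analyticAt_zeroProd (S := 0) (by simp) hs).analyticOrderAt_eq_zero.2 (by simp [zeroProd])]
    simp
  | cons ρ S ih =>
    have hS' : ∀ ρ' ∈ S, ρ'.re < 1 := fun ρ' h' => hS ρ' (Multiset.mem_cons_of_mem h')
    have hne := sub_add_one_ne_zero hs (hS ρ (Multiset.mem_cons_self _ _))
    have heq : zeroProd (ρ ::ₘ S) = (fun z : ℂ => (z - ρ) / (z - ρ + 1)) * zeroProd S :=
      funext fun z => zeroProd_cons ρ S z
    rw [heq, analyticOrderAt_mul (analyticAt_sub_div hne) (analyticAt_zeroProd hS' hs), ih hS',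
      analyticOrderAt_sub_div hne, Multiset.count_cons]
    split_ifs <;> simp [add_comm]

theorem zeroProd_eq_zero_iff {S : Multiset ℂ} (hS : ∀ ρ ∈ S, ρ.re < 1) {s : ℂ}
    (hs : 1 / 2 < s.re) : zeroProd S s = 0 ↔ s ∈ S := by
  rw [zeroProd, Multiset.prod_eq_zero_iff, Multiset.mem_map]
  constructor
  · rintro ⟨ρ, hρ, h⟩
    rw [div_eq_zero_iff, or_iff_left (sub_add_one_ne_zero hs (hS ρ hρ)), sub_eq_zero] at h
    rwa [h]
  · exact fun h => ⟨s, h, by simp⟩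

theorem norm_zeroProd_le {S : Multiset ℂ} (hS : ∀ ρ ∈ S, ρ.re < 1) {s : ℂ} (hs : 1 / 2 < s.re) :
    ‖zeroProd S s‖ ≤ 3 ^ Multiset.card S := by
  induction S using Multiset.induction with
  | empty => simp [zeroProd]
  | cons ρ S ih =>
    have hρ := hS ρ (Multiset.mem_cons_self _ _)
    have hne := sub_add_one_ne_zero hs hρ
    rw [zeroProd_cons, norm_mul, Multiset.card_cons, pow_succ', norm_div]
    refine mul_le_mul ?_ (ih fun ρ' h' => hS ρ' (Multiset.mem_cons_of_mem h')) (norm_nonneg _)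
      (by norm_num)
    rw [div_le_iff₀ (norm_pos_iff.2 hne)]
    have h1 : 1 / 2 ≤ ‖s - ρ + 1‖ := by
      refine le_trans ?_ ((le_abs_self _).trans (Complex.abs_re_le_norm _))
      simp
      linarith
    calc ‖s - ρ‖ = ‖(s - ρ + 1) - 1‖ := by congr 1; ring
      _ ≤ ‖s - ρ + 1‖ + ‖(1 : ℂ)‖ := norm_sub_le _ _
      _ ≤ 3 * ‖s - ρ + 1‖ := by
        rw [norm_one]
        linarith

/-- The function with zeros `S` and simple poles at `1` and `r`, twisted by the factor `exp ∘ G`. -/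
def twistedZeta (r : ℝ) (S : Multiset ℂ) (G : ℂ → ℂ) (s : ℂ) : ℂ :=
  zeroRational r S s * Complex.exp (G s)

/-- `twistedZeta` with its poles removed. -/
def twistedZetaNum (r : ℝ) (S : Multiset ℂ) (G : ℂ → ℂ) (s : ℂ) : ℂ :=
  s * (s - r + 1) * zeroProd S s * Complex.exp (G s)

/-- This holds even at `1` and `r`, where both sides are `0` by the convention for division. -/
theorem twistedZeta_eq (r : ℝ) (S : Multiset ℂ) (G : ℂ → ℂ) (s : ℂ) :
    twistedZeta r S G s = twistedZetaNum r S G s / ((s - 1) * (s - r)) := by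
  unfold twistedZeta twistedZetaNum zeroRational zeroProd
  rw [div_mul_div_comm]
  ring

section

variable {r : ℝ} {S : Multiset ℂ} {G : ℂ → ℂ}

theorem analyticAt_of_forall_differentiableAt {F : ℂ → ℂ} {σ : ℝ}
    (hF : ∀ s : ℂ, σ < s.re → DifferentiableAt ℂ F s) {s : ℂ} (hs : σ < s.re) :
    AnalyticAt ℂ F s :=
  DifferentiableOn.analyticAt (s := {s : ℂ | σ < s.re})
    (fun z hz => (hF z hz).differentiableWithinAt)
    ((isOpen_lt continuous_const Complex.continuous_re).mem_nhds hs)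

theorem analyticAt_twistedZetaNum (hS : ∀ ρ ∈ S, ρ.re < 1)
    (hG : ∀ s : ℂ, 1 / 2 < s.re → DifferentiableAt ℂ G s) {s : ℂ} (hs : 1 / 2 < s.re) :
    AnalyticAt ℂ (twistedZetaNum r S G) s := by
  have h1 := analyticAt_zeroProd hS hs
  have h2 := analyticAt_of_forall_differentiableAt hG hs
  have h3 : AnalyticAt ℂ (fun s : ℂ => s * (s - r + 1)) s := by fun_prop
  exact (h3.mul h1).mul h2.cexp

theorem twistedZetaNum_eq_zero_iff (hr : r < 1) (hS : ∀ ρ ∈ S, ρ.re < 1) {s : ℂ}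
    (hs : 1 / 2 < s.re) : twistedZetaNum r S G s = 0 ↔ s ∈ S := by
  have h1 : s ≠ 0 := fun h => by
    rw [h, Complex.zero_re] at hs
    linarith
  have h2 := sub_add_one_ne_zero (ρ := r) hs (by simpa using hr)
  rw [← zeroProd_eq_zero_iff hS hs]
  simp [twistedZetaNum, h1, h2, Complex.exp_ne_zero]

theorem meromorphicOn_twistedZeta (hS : ∀ ρ ∈ S, ρ.re < 1)
    (hG : ∀ s : ℂ, 1 / 2 < s.re → DifferentiableAt ℂ G s) :
    MeromorphicOn (twistedZeta r S G) {s : ℂ | 1 / 2 < s.re} := fun s hs => by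
  have h1 : AnalyticAt ℂ (fun s : ℂ => (s - 1) * (s - r)) s := by fun_prop
  exact ((analyticAt_twistedZetaNum hS hG hs).meromorphicAt.div h1.meromorphicAt).congr
    (Eventually.of_forall fun z => (twistedZeta_eq r S G z).symm)

theorem analyticAt_twistedZeta (hS : ∀ ρ ∈ S, ρ.re < 1)
    (hG : ∀ s : ℂ, 1 / 2 < s.re → DifferentiableAt ℂ G s) {s : ℂ} (hs : 1 / 2 < s.re)
    (hs1 : s ≠ 1) (hsr : s ≠ r) : AnalyticAt ℂ (twistedZeta r S G) s := by
  have h1 : AnalyticAt ℂ (fun s : ℂ => (s - 1) * (s - r)) s := by fun_prop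
  exact ((analyticAt_twistedZetaNum hS hG hs).div h1
    (mul_ne_zero (sub_ne_zero.2 hs1) (sub_ne_zero.2 hsr))).congr
    (Eventually.of_forall fun z => (twistedZeta_eq r S G z).symm)

theorem twistedZeta_eq_zero_iff (hr : r < 1) (hS : ∀ ρ ∈ S, ρ.re < 1) {s : ℂ}
    (hs : 1 / 2 < s.re) (hs1 : s ≠ 1) (hsr : s ≠ r) : twistedZeta r S G s = 0 ↔ s ∈ S := by
  rw [twistedZeta_eq, div_eq_zero_iff,
    or_iff_left (mul_ne_zero (sub_ne_zero.2 hs1) (sub_ne_zero.2 hsr)),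
    twistedZetaNum_eq_zero_iff hr hS hs]

theorem analyticOrderAt_twistedZeta (hr : r < 1) (hS : ∀ ρ ∈ S, ρ.re < 1)
    (hG : ∀ s : ℂ, 1 / 2 < s.re → DifferentiableAt ℂ G s) {s : ℂ} (hs : 1 / 2 < s.re)
    (hs1 : s ≠ 1) (hsr : s ≠ r) : analyticOrderAt (twistedZeta r S G) s = S.count s := by
  -- A nonvanishing analytic factor near `s`, so that the order comes from `zeroProd` alone.
  set u : ℂ → ℂ := fun z => z * (z - r + 1) / ((z - 1) * (z - r)) * Complex.exp (G z) with hu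
  have heq : twistedZeta r S G = u * zeroProd S := funext fun z => by
    rw [twistedZeta_eq, Pi.mul_apply, hu, twistedZetaNum]
    ring
  have hd : (s - 1) * (s - r) ≠ 0 := mul_ne_zero (sub_ne_zero.2 hs1) (sub_ne_zero.2 hsr)
  have hua : AnalyticAt ℂ u s := by
    have h1 : AnalyticAt ℂ (fun z : ℂ => z * (z - r + 1) / ((z - 1) * (z - r))) s := by
      fun_prop (disch := assumption)
    exact h1.mul (analyticAt_of_forall_differentiableAt hG hs).cexp
  have hs0 : s ≠ 0 := fun h => by
    rw [h, Complex.zero_re] at hs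
    linarith
  have h2 := sub_add_one_ne_zero (ρ := r) hs (by simpa using hr)
  have hu0 : analyticOrderAt u s = 0 := hua.analyticOrderAt_eq_zero.2
    (mul_ne_zero (div_ne_zero (mul_ne_zero hs0 h2) hd) (Complex.exp_ne_zero _))
  rw [heq, analyticOrderAt_mul hua (analyticAt_zeroProd hS hs), hu0, zero_add,
    analyticOrderAt_zeroProd hS hs]

theorem meromorphicOrderAt_div_mul_eq_neg_one {A Z : ℂ → ℂ} {a b : ℂ} (hab : a ≠ b)
    (hZ : ∀ z, Z z = A z / ((z - a) * (z - b))) (hA : AnalyticAt ℂ A a) (hA0 : A a ≠ 0) :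
    meromorphicOrderAt Z a = -1 := by
  have hne : a - b ≠ 0 := sub_ne_zero.2 hab
  have hg : AnalyticAt ℂ (fun z => A z / (z - b)) a := hA.div (by fun_prop) hne
  have h1 : AnalyticAt ℂ (fun z : ℂ => (z - a) * (z - b)) a := by fun_prop
  have hm : MeromorphicAt Z a := (hA.meromorphicAt.div h1.meromorphicAt).congr
    (Eventually.of_forall fun z => (hZ z).symm)
  have h := (meromorphicOrderAt_eq_int_iff (n := -1) hm).2
    ⟨_, hg, div_ne_zero hA0 hne, Eventually.of_forall fun z => ?_⟩
  · exact_mod_cast h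
  · rw [hZ, zpow_neg_one, smul_eq_mul]
    field_simp

/-- The residue of `twistedZeta` at `1`. -/
def twistedResidue (r : ℝ) (S : Multiset ℂ) (G : ℂ → ℂ) : ℂ := twistedZetaNum r S G 1 / (1 - r)

theorem tendsto_sub_one_mul_twistedZeta (hr : r < 1) (hS : ∀ ρ ∈ S, ρ.re < 1)
    (hG : ∀ s : ℂ, 1 / 2 < s.re → DifferentiableAt ℂ G s) :
    Tendsto (fun s : ℂ => (s - 1) * twistedZeta r S G s) (𝓝[≠] 1) (𝓝 (twistedResidue r S G)) := by
  have hne : (1 : ℂ) - r ≠ 0 := by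
    have : (1 : ℝ) - r ≠ 0 := by linarith
    exact_mod_cast this
  have h1 : ContinuousAt (fun s => twistedZetaNum r S G s / (s - r)) 1 :=
    (analyticAt_twistedZetaNum hS hG (by norm_num)).continuousAt.div (by fun_prop) hne
  refine (h1.tendsto.mono_left nhdsWithin_le_nhds).congr' ?_
  filter_upwards [self_mem_nhdsWithin] with s hs
  have hs1 : s - 1 ≠ 0 := sub_ne_zero.2 hs
  rw [twistedZeta_eq]
  field_simp

/-- For real `x > 1` the series is a sum of positive terms, so the limit of `(x - 1) ζ(x)` is real
and nonnegative; it is nonzero because `1 ∉ S`. -/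
theorem twistedResidue_pos (hr : r < 1) (hS : ∀ ρ ∈ S, ρ.re < 1)
    (hG : ∀ s : ℂ, 1 / 2 < s.re → DifferentiableAt ℂ G s) {P : BeurlingPrimes}
    (hZ : ∀ s : ℂ, 1 < s.re → HasSum (fun g : P.Integers => (P.norm g : ℂ) ^ (-s))
      (twistedZeta r S G s)) :
    0 < (twistedResidue r S G).re ∧ ((twistedResidue r S G).re : ℂ) = twistedResidue r S G := by
  have hlim := tendsto_sub_one_mul_twistedZeta hr hS hG
  have hmap : Tendsto (fun x : ℝ => (x : ℂ)) (𝓝[>] 1) (𝓝[≠] 1) := by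
    refine tendsto_nhdsWithin_iff.2 ⟨?_, ?_⟩
    · have := Complex.continuous_ofReal.tendsto (1 : ℝ)
      rw [Complex.ofReal_one] at this
      exact this.mono_left nhdsWithin_le_nhds
    · filter_upwards [self_mem_nhdsWithin] with x hx
      have hx1 : (1 : ℝ) < x := hx
      exact fun h => hx1.ne' (by exact_mod_cast (Set.mem_singleton_iff.1 h))
  have hcl : IsClosed {z : ℂ | 0 ≤ z.re ∧ z.im = 0} :=
    (isClosed_le continuous_const Complex.continuous_re).inter
      (isClosed_eq Complex.continuous_im continuous_const)
  have hmem : twistedResidue r S G ∈ {z : ℂ | 0 ≤ z.re ∧ z.im = 0} := by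
    refine hcl.mem_of_tendsto (hlim.comp hmap) ?_
    filter_upwards [self_mem_nhdsWithin] with x hx
    have hx1 : (1 : ℝ) < x := hx
    have hterm : ∀ g : P.Integers, (P.norm g : ℂ) ^ (-(x : ℂ)) = ((P.norm g ^ (-x) : ℝ) : ℂ) :=
      fun g => by
        rw [Complex.ofReal_cpow (P.norm_pos g).le]
        push_cast
        rfl
    have hval := (hZ x (by simpa using hx1)).tsum_eq
    simp_rw [hterm] at hval
    rw [← Complex.ofReal_tsum] at hval
    simp only [Function.comp_apply, ← hval]
    rw [← Complex.ofReal_one, ← Complex.ofReal_sub, ← Complex.ofReal_mul]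
    exact ⟨mul_nonneg (by linarith) (tsum_nonneg fun g => Real.rpow_nonneg (P.norm_pos g).le _),
      Complex.ofReal_im _⟩
  have hne : (1 : ℂ) - r ≠ 0 := by
    have : (1 : ℝ) - r ≠ 0 := by linarith
    exact_mod_cast this
  have h0 : twistedResidue r S G ≠ 0 := div_ne_zero (fun h => by
    have h1 := hS 1 ((twistedZetaNum_eq_zero_iff hr hS (by norm_num)).1 h)
    simp at h1) hne
  have heq : ((twistedResidue r S G).re : ℂ) = twistedResidue r S G :=
    Complex.ext (by simp) (by simpa using hmem.2.symm)
  refine ⟨lt_of_le_of_ne hmem.1 fun h => h0 ?_, heq⟩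
  rw [← heq, ← h, Complex.ofReal_zero]

end

/-! ### Removal of the poles and growth on vertical lines. -/

theorem differentiableAt_dslope_of_forall {F : ℂ → ℂ} {σ : ℝ} {a : ℂ} (ha : σ < a.re)
    (hF : ∀ s : ℂ, σ < s.re → DifferentiableAt ℂ F s) {s : ℂ} (hs : σ < s.re) :
    DifferentiableAt ℂ (dslope F a) s := by
  have ho : IsOpen {s : ℂ | σ < s.re} := isOpen_lt continuous_const Complex.continuous_re
  exact ((Complex.differentiableOn_dslope (ho.mem_nhds ha)).2
    fun z hz => (hF z hz).differentiableWithinAt).differentiableAt (ho.mem_nhds hs)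

theorem dslope_eq_div_of_eq_zero {F : ℂ → ℂ} {a s : ℂ} (hF : F a = 0) (hs : s ≠ a) :
    dslope F a s = F s / (s - a) := by
  rw [dslope_of_ne _ hs, slope_def_field, hF, sub_zero]

/-- Subtraction of the principal parts of `A s / ((s - 1) (s - r) s)` in `1 / 2 < Re s`. -/
theorem exists_differentiableAt_sub_poles {A : ℂ → ℂ} {r : ℝ} (hr : 1 / 2 ≤ r) (hr1 : r < 1)
    (hA : ∀ s : ℂ, 1 / 2 < s.re → DifferentiableAt ℂ A s) :
    ∃ (c : ℂ) (E : ℂ → ℂ), (∀ s : ℂ, 1 / 2 < s.re → DifferentiableAt ℂ E s) ∧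
      ∀ s : ℂ, 1 / 2 < s.re → s ≠ 1 → s ≠ r →
        E s = A s / ((s - 1) * (s - r)) / s - A 1 / (1 - r) / (s - 1) - c / (s - r) := by
  have h0 : ∀ s : ℂ, 1 / 2 < s.re → s ≠ 0 := fun s hs h => by
    rw [h, Complex.zero_re] at hs
    linarith
  have h1 : (1 / 2 : ℝ) < (1 : ℂ).re := by norm_num
  have h1r : (1 : ℂ) - r ≠ 0 := by
    have : (1 : ℝ) - r ≠ 0 := by linarith
    exact_mod_cast this
  have hr0 : (r : ℂ) ≠ 0 := by
    have : r ≠ 0 := by linarith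
    exact_mod_cast this
  rcases hr.eq_or_lt with hr2 | hr2
  -- For `r = 1/2` the point `r` is on the boundary, where `A` need not be defined well; nothing is
  -- subtracted and `c = 0`.
  · set m : ℂ → ℂ := fun s => A s / (s * (s - r)) - A 1 / (1 - r) with hm
    have hm1 : m 1 = 0 := by simp [hm]
    have hmd : ∀ s : ℂ, 1 / 2 < s.re → DifferentiableAt ℂ m s := fun s hs => by
      have hd : DifferentiableAt ℂ (fun s : ℂ => s * (s - r)) s := by fun_prop
      refine ((hA s hs).div hd (mul_ne_zero (h0 s hs) ?_)).sub_const _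
      refine sub_ne_zero.2 fun h => ?_
      rw [h, Complex.ofReal_re] at hs
      linarith
    refine ⟨0, dslope m 1, fun s hs => differentiableAt_dslope_of_forall h1 hmd hs,
      fun s hs hs1 hsr => ?_⟩
    have hs1' := sub_ne_zero.2 hs1
    have hsr' := sub_ne_zero.2 hsr
    have hs0 := h0 s hs
    rw [dslope_eq_div_of_eq_zero hm1 hs1, hm]
    field_simp
    ring
  -- This is the residue at `r`. The function `n` vanishes at `1` and at `r`, and two successive
  -- `dslope`s divide it by `(s - 1) (s - r)`.
  · set c : ℂ := A r / (r * (r - 1)) with hc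
    set n : ℂ → ℂ := fun s => A s / s - A 1 / (1 - r) * (s - r) - c * (s - 1) with hn
    have h1r' : (r : ℂ) - 1 ≠ 0 := fun h => h1r (by linear_combination -h)
    have hn1 : n 1 = 0 := by
      simp only [hn]
      field_simp
      ring
    have hnr : n r = 0 := by
      simp only [hn, hc]
      field_simp
      ring
    have hnd : ∀ s : ℂ, 1 / 2 < s.re → DifferentiableAt ℂ n s := fun s hs =>
      (((hA s hs).div (by fun_prop) (h0 s hs)).sub (by fun_prop)).sub (by fun_prop)
    have hr2' : 1 / 2 < (r : ℂ).re := by simpa using hr2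
    have hz : dslope n 1 r = 0 := by
      rw [dslope_eq_div_of_eq_zero hn1 (sub_ne_zero.1 h1r'), hnr, zero_div]
    refine ⟨c, dslope (dslope n 1) r, fun s hs => differentiableAt_dslope_of_forall hr2'
      (fun z hz => differentiableAt_dslope_of_forall h1 hnd hz) hs, fun s hs hs1 hsr => ?_⟩
    have hs1' := sub_ne_zero.2 hs1
    have hsr' := sub_ne_zero.2 hsr
    have hs0 := h0 s hs
    rw [dslope_eq_div_of_eq_zero hz hsr, dslope_eq_div_of_eq_zero hn1 hs1]
    simp only [hn]
    field_simp

/-- Completing the square: `K q ≤ K² / (4ε) + ε q²` with `q = √(log y)`. -/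
theorem exp_mul_sqrt_log_le {K ε y : ℝ} (hε : 0 < ε) (hy : 1 ≤ y) :
    Real.exp (K * √(Real.log y)) ≤ Real.exp (K ^ 2 / (4 * ε)) * y ^ ε := by
  rw [Real.rpow_def_of_pos (by linarith), ← Real.exp_add]
  refine Real.exp_le_exp.2 ?_
  have h := Real.sq_sqrt (Real.log_nonneg hy)
  set q := √(Real.log y)
  rw [← h, ← sub_nonneg]
  have : K ^ 2 / (4 * ε) + q ^ 2 * ε - K * q = (K - 2 * ε * q) ^ 2 / (4 * ε) := by
    field_simp
    ring
  rw [this]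
  positivity

/-- The remaining part of the strip is compact, and `E` is continuous on it. -/
theorem exists_norm_le_of_im_large {E : ℂ → ℂ} {σ₀ ε C : ℝ} (hε : 0 ≤ ε) (hC : 0 ≤ C)
    (hE : ∀ s : ℂ, σ₀ ≤ s.re → DifferentiableAt ℂ E s)
    (hb : ∀ s : ℂ, σ₀ ≤ s.re → s.re ≤ 2 → 1 ≤ |s.im| → ‖E s‖ ≤ C * (1 + |s.im|) ^ (ε - 1)) :
    ∃ C', 0 ≤ C' ∧ ∀ s : ℂ, σ₀ ≤ s.re → s.re ≤ 2 → ‖E s‖ ≤ C' * (1 + |s.im|) ^ (ε - 1) := by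
  have hcpt : IsCompact (Set.Icc σ₀ 2 ×ℂ Set.Icc (-1) 1) := isCompact_Icc.reProdIm isCompact_Icc
  obtain ⟨B, hB⟩ := hcpt.exists_bound_of_continuousOn (f := E) fun s hs =>
    (hE s hs.1.1).continuousAt.continuousWithinAt
  refine ⟨C + |B| * 2, by positivity, fun s hs hs2 => ?_⟩
  have hp : 0 ≤ (1 + |s.im|) ^ (ε - 1) := by positivity
  rcases le_total 1 |s.im| with h | h
  · exact (hb s hs hs2 h).trans (mul_le_mul_of_nonneg_right (by linarith [abs_nonneg B]) hp)
  · have h1 : ‖E s‖ ≤ |B| := (hB s ⟨⟨hs, hs2⟩, abs_le.1 h⟩).trans (le_abs_self B)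
    have h2 : 1 ≤ 2 * (1 + |s.im|) ^ (ε - 1) := by
      have h3 : (1 + |s.im|) ^ (-1 : ℝ) ≤ (1 + |s.im|) ^ (ε - 1) :=
        Real.rpow_le_rpow_of_exponent_le (by linarith [abs_nonneg s.im]) (by linarith)
      have h4 : (2 : ℝ)⁻¹ ≤ (1 + |s.im|)⁻¹ := inv_anti₀ (by positivity) (by linarith)
      rw [Real.rpow_neg_one] at h3
      linarith
    calc ‖E s‖ ≤ |B| * 1 := by rw [mul_one]; exact h1
      _ ≤ |B| * (2 * (1 + |s.im|) ^ (ε - 1)) := by gcongr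
      _ ≤ (C + |B| * 2) * (1 + |s.im|) ^ (ε - 1) := by nlinarith [abs_nonneg B]

theorem exists_norm_twistedZeta_div_sub_le {r : ℝ} {S : Multiset ℂ} {G E : ℂ → ℂ} {κ c : ℂ}
    {σ₀ ε K : ℝ} (hσ₀ : 1 / 2 < σ₀) (hε : 0 < ε) (hS : ∀ ρ ∈ S, ρ.re < 1)
    (hG : ∀ s : ℂ, σ₀ ≤ s.re → ‖G s‖ ≤ K * √(Real.log (|s.im| + 4)))
    (hEd : ∀ s : ℂ, 1 / 2 < s.re → DifferentiableAt ℂ E s)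
    (hE : ∀ s : ℂ, 1 / 2 < s.re → s ≠ 1 → s ≠ r →
      E s = twistedZeta r S G s / s - κ / (s - 1) - c / (s - r)) :
    ∃ C, 0 ≤ C ∧ ∀ s : ℂ, σ₀ ≤ s.re → s.re ≤ 2 → ‖E s‖ ≤ C * (1 + |s.im|) ^ (ε - 1) := by
  -- The factor `4 ^ ε` comes from `|t| + 4 ≤ 4 (1 + |t|)`.
  set B := Real.exp (K ^ 2 / (4 * ε)) * 4 ^ ε with hB
  refine exists_norm_le_of_im_large (C := 2 * (2 * 3 ^ Multiset.card S * B + ‖κ‖ + ‖c‖)) hε.le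
    (by positivity) (fun s hs => hEd s (hσ₀.trans_le hs)) fun s hs _ ht => ?_
  have hs' := hσ₀.trans_le hs
  have hsub : ∀ a : ℝ, |s.im| ≤ ‖s - a‖ := fun a => by
    simpa using Complex.abs_im_le_norm (s - a)
  have hsne : ∀ a : ℝ, s - a ≠ 0 := fun a => norm_pos_iff.1 (by linarith [hsub a])
  have hinv : ∀ (a : ℝ) (z : ℂ), ‖z / (s - a)‖ ≤ 2 * ‖z‖ / (1 + |s.im|) := fun a z => by
    rw [norm_div, div_le_div_iff₀ (by linarith [hsub a]) (by positivity)]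
    nlinarith [hsub a, norm_nonneg z]
  have hs0 : s ≠ 0 := by simpa using hsne 0
  have hs1 : s - 1 ≠ 0 := by simpa using hsne 1
  have hexp : ‖Complex.exp (G s)‖ ≤ B * (1 + |s.im|) ^ ε := by
    refine (Complex.norm_exp_le_exp_norm _).trans ?_
    refine (Real.exp_le_exp.2 (hG s hs)).trans ?_
    refine (exp_mul_sqrt_log_le hε (by linarith)).trans ?_
    rw [hB, mul_assoc, ← Real.mul_rpow (by norm_num) (by positivity)]
    gcongr
    linarith
  have hfac : ‖(s - r + 1) / (s - r)‖ ≤ 2 := by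
    rw [norm_div, div_le_iff₀ (by linarith [hsub r])]
    refine (norm_add_le _ _).trans ?_
    rw [norm_one]
    linarith [hsub r]
  have hone : 1 ≤ (1 + |s.im|) ^ ε := Real.one_le_rpow (by linarith) hε.le
  set y := 1 + |s.im| with hy
  have hy0 : 0 < y := by positivity
  -- The factor `s` of `zeroRational` cancels the division by `s`, and `1 / (s - 1)` supplies the
  -- decay.
  have hmain : twistedZeta r S G s / s =
      ((s - r + 1) / (s - r) * zeroProd S s * Complex.exp (G s)) / (s - 1) := by
    rw [twistedZeta_eq, twistedZetaNum]
    have := hsne r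
    field_simp
  have hnum : ‖(s - r + 1) / (s - r) * zeroProd S s * Complex.exp (G s)‖ ≤
      2 * 3 ^ Multiset.card S * (B * y ^ ε) := by
    rw [norm_mul, norm_mul]
    gcongr
    exact norm_zeroProd_le hS hs'
  rw [hE s hs' (sub_ne_zero.1 hs1) (sub_ne_zero.1 (hsne r)), hmain, Real.rpow_sub_one hy0.ne']
  have e1 := hinv 1 ((s - r + 1) / (s - r) * zeroProd S s * Complex.exp (G s))
  have e2 := hinv 1 κ
  have e3 := hinv r c
  rw [Complex.ofReal_one] at e1 e2
  calc _ ≤ _ := (norm_sub_le _ _).trans (add_le_add (norm_sub_le _ _) le_rfl)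
    _ ≤ 2 * (2 * 3 ^ Multiset.card S * (B * y ^ ε)) / y + 2 * (‖κ‖ * y ^ ε) / y +
        2 * (‖c‖ * y ^ ε) / y := by
      refine add_le_add (add_le_add (e1.trans ?_) (e2.trans ?_)) (e3.trans ?_)
      · gcongr
      · gcongr
        exact le_mul_of_one_le_right (norm_nonneg _) hone
      · gcongr
        exact le_mul_of_one_le_right (norm_nonneg _) hone
    _ = _ := by ring

/-- Axiom A for every exponent `τ ≥ r` with `1 / 2 < τ < 1`. -/
theorem axiomA_of_twistedZeta {r τ : ℝ} {S : Multiset ℂ} {G : ℂ → ℂ} {P : BeurlingPrimes}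
    (hr : 1 / 2 ≤ r) (hr1 : r < 1) (hS : ∀ ρ ∈ S, ρ.re < 1)
    (hG : ∀ s : ℂ, 1 / 2 < s.re → DifferentiableAt ℂ G s)
    (hGb : ∀ σ₀ : ℝ, 1 / 2 < σ₀ → ∃ K : ℝ, 0 ≤ K ∧ ∀ s : ℂ, σ₀ ≤ s.re →
      ‖G s‖ ≤ K * √(Real.log (|s.im| + 4)))
    (hZ : ∀ s : ℂ, 1 < s.re → HasSum (fun g : P.Integers => (P.norm g : ℂ) ^ (-s))
      (twistedZeta r S G s))
    (hτ : 1 / 2 < τ) (hrτ : r ≤ τ) (hτ1 : τ < 1) :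
    P.AxiomA (twistedResidue r S G).re τ := by
  obtain ⟨hκ, hκ'⟩ := twistedResidue_pos hr1 hS hG hZ
  obtain ⟨c, E, hEd, hE⟩ := exists_differentiableAt_sub_poles hr hr1
    (fun s hs => (analyticAt_twistedZetaNum (r := r) hS hG hs).differentiableAt)
  -- Chosen so that `σ₀ + ε = τ`. The line may lie to the left of `r`, since the pole there is
  -- removed from `E`.
  set σ₀ := 1 / 2 + (τ - 1 / 2) / 2 with hσ₀
  set ε := (τ - 1 / 2) / 2 with hε
  have hσ : 1 / 2 < σ₀ := by linarith
  have hE' : ∀ s : ℂ, 1 / 2 < s.re → s ≠ 1 → s ≠ r →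
      E s = twistedZeta r S G s / s - (twistedResidue r S G).re / (s - 1) - c / (s - r) :=
    fun s hs h1 h2 => by rw [hE s hs h1 h2, hκ', twistedZeta_eq, twistedResidue]
  obtain ⟨K, -, hK⟩ := hGb σ₀ hσ
  obtain ⟨C, hC, hb⟩ := exists_norm_twistedZeta_div_sub_le (ε := ε) hσ (by linarith) hS hK hEd hE'
  refine ⟨hκ, by linarith, hτ1, P.exists_abs_N_sub_le hZ hκ.le (by linarith) hr1
    (fun s hs => hE' s (by linarith) ?_ ?_) (by linarith) (by linarith) (by linarith)
    (by linarith) hC (fun s hs => hEd s (hσ.trans_le hs)) hb hτ.le hrτ (by linarith)⟩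
  · rintro rfl
    simp at hs
  · rintro rfl
    rw [Complex.ofReal_re] at hs
    linarith

/-! ### Failure of Axiom A below `r`. -/

theorem hasDerivWithinAt_max_sub_zero (c x : ℝ) :
    HasDerivWithinAt (fun t : ℝ => max (t - c) 0) (if c ≤ x then 1 else 0) (Set.Ici x) x := by
  split_ifs with h
  · refine ((hasDerivAt_id x).sub_const c).hasDerivWithinAt.congr_of_mem (fun t ht => ?_)
      Set.self_mem_Ici
    have : x ≤ t := ht
    exact max_eq_left (by linarith)
  · have : (fun t : ℝ => max (t - c) 0) =ᶠ[𝓝 x] fun _ => 0 := by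
      filter_upwards [eventually_lt_nhds (not_le.1 h)] with t ht
      exact max_eq_right (by linarith)
    exact ((hasDerivAt_const x (0 : ℝ)).congr_of_eventuallyEq this).hasDerivWithinAt

namespace BeurlingPrimes

variable (P : BeurlingPrimes)

/-- The right derivative exists everywhere because `N` counts with `≤` and is therefore
right-continuous. -/
theorem hasDerivWithinAt_NInt (x : ℝ) : HasDerivWithinAt P.NInt (P.N x) (Set.Ici x) x := by
  have h := HasDerivWithinAt.fun_sum (u := (P.finite_norm_le (x + 1)).toFinset)
    fun g _ => hasDerivWithinAt_max_sub_zero (P.norm g) x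
  have hN : ∑ g ∈ (P.finite_norm_le (x + 1)).toFinset, (if P.norm g ≤ x then (1 : ℝ) else 0) =
      P.N x := by
    rw [Finset.sum_boole, N_eq_card]
    congr 2
    ext g
    simp only [Finset.mem_filter, Set.Finite.mem_toFinset, Set.mem_ofPred_eq]
    exact ⟨fun h => h.2, fun h => ⟨by linarith, h⟩⟩
  rw [hN] at h
  refine h.congr_of_eventuallyEq ?_ (P.NInt_eq_sum (by linarith))
  filter_upwards [(eventually_le_nhds (lt_add_one x)).filter_mono nhdsWithin_le_nhds] with t ht
    using P.NInt_eq_sum ht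

/-- Integrates Axiom A by comparing right derivatives: that of `A t^(θ+1)` is at least `A t^θ`. -/
theorem abs_NInt_sub_le {κ θ A x : ℝ} (hθ : 0 < θ)
    (hA : ∀ x : ℝ, 1 ≤ x → |(P.N x : ℝ) - κ * (x - 1)| ≤ A * x ^ θ) (hx : 1 ≤ x) :
    |P.NInt x - κ * (x - 1) ^ 2 / 2| ≤ A * x ^ (θ + 1) := by
  have hA0 : 0 ≤ A := by
    have := (abs_nonneg _).trans (hA 1 le_rfl)
    simpa using this
  have hB : ∀ t : ℝ, HasDerivAt (fun t : ℝ => A * t ^ (θ + 1)) (A * ((θ + 1) * t ^ θ)) t :=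
    fun t => by
      have := (Real.hasDerivAt_rpow_const (x := t) (p := θ + 1) (Or.inr (by linarith))).const_mul A
      simpa using this
  have hf : ∀ t : ℝ, HasDerivWithinAt (fun t => P.NInt t - κ * (t - 1) ^ 2 / 2)
      (P.N t - κ * (t - 1)) (Set.Ici t) t := fun t => by
    have h1 : HasDerivAt (fun t : ℝ => κ * (t - 1) ^ 2 / 2) (κ * (t - 1)) t := by
      have := ((((hasDerivAt_id t).sub_const 1).pow 2).const_mul κ).div_const 2
      refine this.congr_deriv ?_
      simp only [id_eq, mul_one]
      ring
    exact (P.hasDerivWithinAt_NInt t).sub h1.hasDerivWithinAt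
  have hcont : ContinuousOn (fun t => P.NInt t - κ * (t - 1) ^ 2 / 2) (Set.Icc 1 x) := by
    have := P.continuous_NInt
    fun_prop
  refine image_norm_le_of_norm_deriv_right_le_deriv_boundary hcont (fun t _ => hf t) ?_ hB
    (fun t ht => ?_) (Set.right_mem_Icc.2 hx)
  · simpa [P.NInt_of_le_one le_rfl] using hA0
  · have ht0 : 0 ≤ t := by linarith [ht.1]
    refine (hA t ht.1).trans (mul_le_mul_of_nonneg_left ?_ hA0)
    nlinarith [Real.rpow_nonneg ht0 θ]

variable {P} {Z : ℂ → ℂ} {κ θ : ℝ}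

/-- Taking `c = -κ` and pole position `0` recovers the normalisation `κ (x - 1)` of Axiom A, so the
earlier Mellin computation can be reused. -/
theorem NIntError_zero_eq (x : ℝ) :
    P.NIntError κ (-κ) 0 x = ((P.NInt x - κ * max (x - 1) 0 ^ 2 / 2 : ℝ) : ℂ) := by
  rcases le_or_gt x 1 with hx | hx
  · rw [max_eq_right (by linarith)]
    simp [NIntError, truncPow, hx.not_gt]
  · rw [max_eq_left (by linarith), NIntError, truncPow_of_one_lt _ hx, truncPow_of_one_lt _ hx,
      one_add_one_eq_two, show ((2 : ℂ)) = ((2 : ℕ) : ℂ) by norm_num, Complex.cpow_natCast]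
    simp only [Complex.ofReal_zero, zero_add, Complex.cpow_one, smul_eq_mul]
    push_cast
    ring

theorem hasMellin_NIntError_zero
    (hZ : ∀ s : ℂ, 1 < s.re → HasSum (fun g : P.Integers => (P.norm g : ℂ) ^ (-s)) (Z s))
    {w : ℂ} (hw : 1 < w.re) :
    HasMellin (P.NIntError κ (-κ) 0) (-(w + 1)) ((Z w / w - κ / (w - 1) + κ / w) / (w + 1)) :=
  hasMellin_NIntError (E := fun w => Z w / w - κ / (w - 1) + κ / w) hZ le_rfl zero_lt_one
    (fun s _ => by simp [neg_div]) hw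

theorem differentiableAt_mellin_NIntError_zero (hA : P.AxiomA κ θ) {w : ℂ} (hw : θ < w.re) :
    DifferentiableAt ℂ (fun w => mellin (P.NIntError κ (-κ) 0) (-(w + 1))) w := by
  obtain ⟨-, hθ, -, A, hA⟩ := hA
  have hcont : Continuous (P.NIntError κ (-κ) 0) := by
    have := P.continuous_NInt
    rw [funext NIntError_zero_eq]
    fun_prop
  have h : DifferentiableAt ℂ (mellin (P.NIntError κ (-κ) 0)) (-(w + 1)) := by
    refine mellin_differentiableAt_of_isBigO_rpow (a := -(θ + 1)) (b := -(w.re + 2))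
      (hcont.locallyIntegrable.locallyIntegrableOn _)
      (IsBigO.of_bound A ?_) (by simp only [Complex.neg_re, Complex.add_re, Complex.one_re]; linarith)
      (isBigO_nhds_zero_of_eq_zero (fun x hx => ?_) _) (by simp)
    · filter_upwards [eventually_gt_atTop 1] with x hx
      rw [NIntError_zero_eq, max_eq_left (by linarith), Complex.norm_real, neg_neg,
        Real.norm_of_nonneg (Real.rpow_nonneg (by linarith) _)]
      exact P.abs_NInt_sub_le hθ hA hx.le
    · rw [NIntError_zero_eq, max_eq_right (by linarith), P.NInt_of_le_one hx]
      simp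
  have h2 : DifferentiableAt ℂ (fun w : ℂ => -(w + 1)) w := by fun_prop
  exact DifferentiableAt.comp (g := mellin (P.NIntError κ (-κ) 0)) w h h2

/-- A pole of the zeta function at `r < 1` prevents Axiom A with any exponent below `r`. -/
theorem not_axiomA_of_lt {N : ℂ → ℂ} {r : ℝ} (hr : 1 / 2 < r)
    (hN : ∀ s : ℂ, 1 / 2 < s.re → DifferentiableAt ℂ N s) (hNr : N r ≠ 0)
    (hZ : ∀ s : ℂ, 1 < s.re → HasSum (fun g : P.Integers => (P.norm g : ℂ) ^ (-s))
      (N s / ((s - 1) * (s - r)))) (hr1 : r < 1) (hθ : θ < r) : ¬ P.AxiomA κ θ := fun hA => by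
  set σ := max θ (1 / 2) with hσ
  have hσr : σ < r := max_lt hθ hr
  set M : ℂ → ℂ := fun w => mellin (P.NIntError κ (-κ) 0) (-(w + 1)) with hM
  -- The Mellin identity with denominators cleared. Axiom A makes `F` analytic for `Re w > σ`, where
  -- it must agree with `N`; but `F r = 0` while `N r ≠ 0`.
  set F : ℂ → ℂ := fun w => (w - 1) * (w - r) * w * (w + 1) * M w + κ * (w - r) with hF
  set U : Set ℂ := {s : ℂ | σ < s.re} with hU
  have hFd : ∀ s : ℂ, σ < s.re → DifferentiableAt ℂ F s := fun s hs => by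
    have h1 : DifferentiableAt ℂ M s :=
      differentiableAt_mellin_NIntError_zero hA ((le_max_left _ _).trans_lt hs)
    have h2 : DifferentiableAt ℂ (fun w : ℂ => (w - 1) * (w - r) * w * (w + 1)) s := by fun_prop
    have h3 : DifferentiableAt ℂ (fun w : ℂ => κ * (w - r)) s := by fun_prop
    exact (h2.mul h1).add h3
  have hFa : AnalyticOnNhd ℂ F U := fun s hs => analyticAt_of_forall_differentiableAt hFd hs
  have hNa : AnalyticOnNhd ℂ N U := fun s hs =>
    analyticAt_of_forall_differentiableAt hN ((le_max_right _ _).trans_lt hs)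
  have hconn : IsPreconnected U := (convex_halfSpace_re_gt σ).isPreconnected
  have h2U : (2 : ℂ) ∈ U := by
    change σ < (2 : ℂ).re
    norm_num
    linarith
  have hev : F =ᶠ[𝓝 2] N := by
    have ho : IsOpen {s : ℂ | 1 < s.re} := isOpen_lt continuous_const Complex.continuous_re
    filter_upwards [ho.mem_nhds (show (1 : ℝ) < (2 : ℂ).re by norm_num)] with w hw
    have hw' : 1 < w.re := hw
    have hne : ∀ a : ℝ, a ≤ 1 → w - a ≠ 0 := fun a ha h => by
      have := congrArg Complex.re h
      simp at this
      linarith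
    have e0 : w ≠ 0 := by simpa using hne 0 zero_le_one
    have e1 : w - 1 ≠ 0 := by simpa using hne 1 le_rfl
    have e2 : w + 1 ≠ 0 := by simpa using hne (-1) (by norm_num)
    have e3 := hne r hr1.le
    simp only [hF, hM]
    rw [(hasMellin_NIntError_zero hZ hw').2]
    field_simp
    ring
  have hEq := hFa.eqOn_of_preconnected_of_eventuallyEq hNa hconn h2U hev
  have hrU : (r : ℂ) ∈ U := by simpa [hU] using hσr
  refine hNr ((hEq hrU).symm.trans ?_)
  simp [hF]

end BeurlingPrimes

/-! ### Asymptotics of `ψ`, and the theorem. -/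

theorem isLittleO_rpow_id {a : ℝ} (ha : a < 1) : (fun x : ℝ => x ^ a) =o[atTop] fun x : ℝ => x := by
  rw [isLittleO_iff_tendsto' ((eventually_gt_atTop 0).mono fun x hx h => absurd h hx.ne')]
  refine (tendsto_rpow_neg_atTop (sub_pos.2 ha)).congr' ?_
  filter_upwards [eventually_gt_atTop 0] with x hx
  rw [neg_sub, Real.rpow_sub_one hx.ne']

theorem isLittleO_cpow_id {ρ : ℂ} (hρ : ρ.re < 1) :
    (fun x : ℝ => (x : ℂ) ^ ρ) =o[atTop] fun x : ℝ => x := by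
  refine IsBigO.trans_isLittleO (IsBigO.of_bound 1 ?_) (isLittleO_rpow_id hρ)
  filter_upwards [eventually_gt_atTop 0] with x hx
  rw [Complex.norm_cpow_eq_rpow_re_of_pos hx, one_mul]
  exact le_abs_self _

theorem isLittleO_sum_cpow_div {S : Multiset ℂ} (hS : ∀ ρ ∈ S, ρ.re < 1) :
    (fun x : ℝ => (S.map fun ρ => (x : ℂ) ^ ρ / ρ).sum) =o[atTop] fun x : ℝ => x := by
  induction S using Multiset.induction with
  | empty => simp
  | cons ρ S ih =>
    simp only [Multiset.map_cons, Multiset.sum_cons, div_eq_mul_inv _ ρ, mul_comm _ ρ⁻¹]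
    exact ((isLittleO_cpow_id (hS ρ (Multiset.mem_cons_self _ _))).const_mul_left _).add
      (ih fun ρ' h' => hS ρ' (Multiset.mem_cons_of_mem h'))

theorem isLittleO_psiMain_sub {r : ℝ} (hr : r < 1) {S : Multiset ℂ} (hS : ∀ ρ ∈ S, ρ.re < 1) :
    (fun x : ℝ => psiMain r S x - x) =o[atTop] fun x : ℝ => x := by
  have h1 := (isLittleO_cpow_id (ρ := r) (by simpa using hr)).const_mul_left (r : ℂ)⁻¹
  refine (h1.sub (isLittleO_sum_cpow_div hS)).congr_left fun x => ?_
  rw [psiMain]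
  ring

theorem isEquivalent_psi {f : ℝ → ℝ} {r C : ℝ} (hr : r < 1) {S : Multiset ℂ}
    (hS : ∀ ρ ∈ S, ρ.re < 1)
    (hf : ∀ x : ℝ, 1 ≤ x → ‖(f x : ℂ) - psiMain r S x‖ ≤ C * √x) :
    f ~[atTop] fun x : ℝ => x := by
  have h1 : (fun x : ℝ => (f x : ℂ) - psiMain r S x) =o[atTop] fun x : ℝ => x := by
    have h := isLittleO_rpow_id (show (1 / 2 : ℝ) < 1 by norm_num)
    simp_rw [← Real.sqrt_eq_rpow] at h
    refine IsBigO.trans_isLittleO (IsBigO.of_bound C ?_) h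
    filter_upwards [eventually_ge_atTop 1] with x hx
    rw [Real.norm_of_nonneg (Real.sqrt_nonneg x)]
    exact hf x hx
  refine IsLittleO.of_norm_left (((h1.add (isLittleO_psiMain_sub hr hS)).norm_left).congr_left
    fun x => ?_)
  rw [sub_add_sub_cancel, ← Complex.ofReal_sub, Complex.norm_real]
  rfl

end

theorem theorem6p3 (r : ℝ) (hr : 1 / 2 ≤ r) (hr1 : r < 1) (S : Multiset ℂ)
    (hS : ∀ ρ ∈ S, r < ρ.re ∧ ρ.re < 1) (hsymm : S.map (starRingEnd ℂ) = S) :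
    ∃ (P : BeurlingPrimes) (κ : ℝ),
      -- Axiom A, with the optimal exponent if `r > 1/2`
      (1 / 2 < r → P.AxiomA κ r ∧ ∀ θ : ℝ, θ < r → ∀ κ' : ℝ, ¬ P.AxiomA κ' θ) ∧
      (r = 1 / 2 → ∀ θ : ℝ, 1 / 2 < θ → θ < 1 → P.AxiomA κ θ) ∧
      -- the prime number formula and its error term
      (P.psi ~[atTop] fun x : ℝ => x) ∧
      (1 / 2 < r → ∃ C : ℝ, ∀ x : ℝ, 1 ≤ x →
        ‖((P.psi x - x : ℝ) : ℂ)
          - ((x : ℂ) ^ (r : ℂ) / (r : ℂ) - (S.map fun ρ => (x : ℂ) ^ ρ / ρ).sum)‖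
          ≤ C * Real.sqrt x) ∧
      (r = 1 / 2 → ∃ C : ℝ, ∀ x : ℝ, 1 ≤ x →
        ‖((P.psi x - x : ℝ) : ℂ) - (-(S.map fun ρ => (x : ℂ) ^ ρ / ρ).sum)‖
          ≤ C * Real.sqrt x) ∧
      -- poles and zeros of the zeta function in `Re s > 1/2`
      ∃ Z : ℂ → ℂ, P.IsZetaContinuation (1 / 2) Z ∧
        meromorphicOrderAt Z 1 = -1 ∧
        Tendsto (fun s : ℂ => (s - 1) * Z s) (𝓝[≠] 1) (𝓝 (κ : ℂ)) ∧
        (1 / 2 < r → meromorphicOrderAt Z (r : ℂ) = -1) ∧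
        ∀ s : ℂ, 1 / 2 < s.re → s ≠ 1 → s ≠ (r : ℂ) →
          AnalyticAt ℂ Z s ∧ (Z s = 0 ↔ s ∈ S) ∧ analyticOrderAt Z s = S.count s := by
  have hS1 : ∀ ρ ∈ S, ρ.re < 1 := fun ρ hρ => (hS ρ hρ).2
  have hS0 : ∀ ρ ∈ S, ρ ≠ 0 := fun ρ hρ h => by
    have := (hS ρ hρ).1
    rw [h, Complex.zero_re] at this
    linarith
  obtain ⟨a, ⟨X⟩⟩ := exists_sampling_zeroDensity hr1 hS1
  have hcont : ContinuousOn (zeroDensity r S) (Set.Icc 1 a) :=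
    (continuousOn_zeroDensity r S).mono fun x hx => zero_lt_one.trans_le hx.1
  have hG : ∀ s : ℂ, 1 / 2 < s.re → DifferentiableAt ℂ X.logRegular s := fun s hs =>
    X.differentiableAt_logRegular hcont hs
  have hGb := fun (σ₀ : ℝ) (h : 1 / 2 < σ₀) => X.exists_norm_logRegular_le hcont h
  have hZ : ∀ s : ℂ, 1 < s.re →
      HasSum (fun g : X.toBeurlingPrimes.Integers => (X.toBeurlingPrimes.norm g : ℂ) ^ (-s))
        (twistedZeta r S X.logRegular s) :=
    fun s hs => DensitySampling.hasSum_norm_cpow hr1 hS1 hsymm X hs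
  have hNa : ∀ s : ℂ, 1 / 2 < s.re → AnalyticAt ℂ (twistedZetaNum r S X.logRegular) s :=
    fun s hs => analyticAt_twistedZetaNum hS1 hG hs
  -- The strict inequalities `r < Re ρ < 1` prevent a zero from cancelling either pole.
  have h1S : (1 : ℂ) ∉ S := fun h => by simpa using hS1 1 h
  have hrS : (r : ℂ) ∉ S := fun h => by simpa using (hS r h).1
  have h1r : (1 : ℂ) ≠ r := by
    have : (1 : ℝ) ≠ r := hr1.ne'
    exact_mod_cast this
  have h1re : (1 / 2 : ℝ) < (1 : ℂ).re := by norm_num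
  obtain ⟨C, hC0, hC⟩ := DensitySampling.exists_norm_psi_sub_psiMain_le (by linarith) hr1.le hS0
    (fun ρ hρ => (hS1 ρ hρ).le) hsymm X
  refine ⟨X.toBeurlingPrimes, (twistedResidue r S X.logRegular).re, fun hr2 => ⟨?_, ?_⟩, ?_,
    isEquivalent_psi hr1 hS1 hC, fun _ => ⟨C, fun x hx => ?_⟩, fun hr2 => ⟨C + 2, fun x hx => ?_⟩,
    twistedZeta r S X.logRegular, ⟨meromorphicOn_twistedZeta hS1 hG, hZ⟩, ?_, ?_, fun hr2 => ?_,
    fun s hs hs1 hsr => ⟨analyticAt_twistedZeta hS1 hG hs hs1 hsr,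
      twistedZeta_eq_zero_iff hr1 hS1 hs hs1 hsr,
      analyticOrderAt_twistedZeta hr1 hS1 hG hs hs1 hsr⟩⟩
  · exact axiomA_of_twistedZeta hr hr1 hS1 hG hGb hZ hr2 le_rfl hr1
  · intro θ hθ κ'
    have hr2' : 1 / 2 < (r : ℂ).re := by simpa using hr2
    refine BeurlingPrimes.not_axiomA_of_lt hr2 (fun s hs => (hNa s hs).differentiableAt)
      (fun h => hrS ((twistedZetaNum_eq_zero_iff hr1 hS1 hr2').1 h))
      (fun s hs => ?_) hr1 hθ
    rw [← twistedZeta_eq]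
    exact hZ s hs
  · intro hr2 θ hθ hθ1
    exact axiomA_of_twistedZeta hr hr1 hS1 hG hGb hZ hθ (by linarith) hθ1
  · refine le_of_eq_of_le ?_ (hC x hx)
    rw [psiMain]
    push_cast
    congr 1
    ring
  · have hx0 : 0 < x := by linarith
    -- For `r = 1/2` this term of `psiMain` joins the error, whence the constant `C + 2`.
    have hpow : ‖(x : ℂ) ^ (r : ℂ) / r‖ = 2 * √x := by
      rw [norm_div, Complex.norm_cpow_eq_rpow_re_of_pos hx0, Complex.ofReal_re, hr2,
        ← Real.sqrt_eq_rpow]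
      norm_num
      ring
    calc _ = ‖((X.toBeurlingPrimes.psi x : ℂ) - psiMain r S x) + (x : ℂ) ^ (r : ℂ) / r‖ := by
          rw [psiMain]
          push_cast
          congr 1
          ring
      _ ≤ C * √x + 2 * √x := (norm_add_le _ _).trans (add_le_add (hC x hx) hpow.le)
      _ = (C + 2) * √x := by ring
  · exact meromorphicOrderAt_div_mul_eq_neg_one h1r (twistedZeta_eq r S X.logRegular)
      (hNa 1 h1re) fun h => h1S ((twistedZetaNum_eq_zero_iff hr1 hS1 h1re).1 h)
  · rw [(twistedResidue_pos hr1 hS1 hG hZ).2]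
    exact tendsto_sub_one_mul_twistedZeta hr1 hS1 hG
  · have hr2' : 1 / 2 < (r : ℂ).re := by simpa using hr2
    refine meromorphicOrderAt_div_mul_eq_neg_one h1r.symm (fun z => ?_)
      (hNa r hr2') fun h => hrS ((twistedZetaNum_eq_zero_iff hr1 hS1 hr2').1 h)
    rw [twistedZeta_eq, mul_comm (z - 1)]
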